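/- Let $k$ be a field (for instance $k=\mathbb{C}$). All tensor products are over $k$, and Sweedler notation $\Delta(a)=\sum a_{(1)}\otimes a_{(2)}$, $\delta(v)=\sum v_{(-1)}\otimes v_{(0)}$ is used. For a Hopf algebra $D$, a ($D$-)Yetter–Drinfel'd module is a left $D$-module and left $D$-comodule $M$ with $\sum h_{(1)}m_{(-1)}\otimes h_{(2)}.m_{(0)}=\sum (h_{(1)}.m)_{(-1)}h_{(2)}\otimes (h_{(1)}.m)_{(0)}$; the braiding is $\sigma(m\otimes n)=\sum m_{(-1)}.n\otimes m_{(0)}$; a Yetter–Drinfel'd module algebra is an associative unital algebra in the category ${}^D_D\mathcal{YD}$, i.e. its multiplication and unit are morphisms of Yetter–Drinfel'd modules. Let $H$ be a Hopf algebra and $V\in{}^H_H\mathcal{YD}$. A Nichols algebra of $V$ is a graded braided Hopf algebra $R=\bigoplus_{n\ge 0}R(n)$ in ${}^H_H\mathcal{YD}$ with $R(0)=k$, $R(1)\cong V$ in ${}^H_H\mathcal{YD}$, generated as an algebra by $R(1)$, and whose set of primitive elements is $R(1)$. Let $\mathfrak N^+=\mathfrak N(V)$ be a Nichols algebra of $V$.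 Let $\mathfrak B^+=\mathfrak N^+\sharp H$ be the Radford biproduct, i.e. the space $\mathfrak N^+\otimes H$ with unit $1\sharp 1$, counit $\varepsilon\otimes\varepsilon$ and $$(a\sharp h)(a'\sharp h')=\sum a(h_{(1)}.a')\sharp h_{(2)}h',\qquad \Delta(a\sharp h)=\sum \bigl(a_{(1)}\sharp (a_{(2)})_{(-1)}h_{(1)}\bigr)\otimes\bigl((a_{(2)})_{(0)}\sharp h_{(2)}\bigr),$$ $$S(a\sharp h)=\sum\bigl(1\sharp S_H(h)S_H(a_{(-1)})\bigr)\bigl(S(a_{(0)})\sharp 1\bigr).$$ Likewise let $H'$ be a Hopf algebra, $V'\in{}^{H'}_{H'}\mathcal{YD}$, $\mathfrak N^-=\mathfrak N(V')$ a Nichols algebra of $V'$ and $\mathfrak B^-=\mathfrak N^-\sharp H'$. (The case $H'=H$, $V'=V$, $\mathfrak N^-=\mathfrak N^+=\mathfrak N(V)$ is the one in which $\mathfrak B^\pm=\mathfrak B^\pm_H(V)$.) Let $\varphi:\mathfrak B^+\times\mathfrak B^-\to k$ be a generalized Hopf pairing, i.e. a bilinear form with $$\varphi(a,bb')=\sum\varphi(a_{(1)},b)\varphi(a_{(2)},b'),\quad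 \varphi(aa',b)=\sum\varphi(a,b_{(2)})\varphi(a',b_{(1)}),\quad \varphi(a,1)=\varepsilon(a),\quad \varphi(1,b)=\varepsilon(b).$$ Let $D_\varphi=D_\varphi(\mathfrak B^+,\mathfrak B^-)$ be the quantum double: the tensor product coalgebra $\mathfrak B^+\otimes\mathfrak B^-$ with unit $1\otimes 1$, product $$(a\otimes b)(a'\otimes b')=\sum\varphi(a'_{(1)},S(b_{(1)}))\,\varphi(a'_{(3)},b_{(3)})\;a a'_{(2)}\otimes b_{(2)}b'$$ and antipode $S(a\otimes b)=(1\otimes S(b))(S(a)\otimes 1)$. The Schrödinger representations of $D_\varphi$ on $\mathfrak B^+$ and $\mathfrak B^-$ are given, with $(a\otimes b).z=(a\otimes 1).((1\otimes b).z)$, by $$(a\otimes 1).x=\sum a_{(1)}xS(a_{(2)}),\quad (1\otimes b).x=\sum\varphi(x_{(1)},S(b))x_{(2)}\qquad (x\in\mathfrak B^+),$$ $$(a\otimes 1).y=\sum\varphi(a,y_{(1)})y_{(2)},\quad (1\otimes b).y=\sum b_{(1)}yS(b_{(2)})\qquad (y\in\mathfrak B^-),$$ and the coactions are $x\mapsto\sum(x_{(1)}\otimes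 1)\otimes x_{(2)}$ on $\mathfrak B^+$ and $y\mapsto\sum(1\otimes y_{(1)})\otimes y_{(2)}$ on $\mathfrak B^-$. Then $\mathfrak B^+$, $\mathfrak B^-$ and $D_\varphi$ are Hopf algebras, and: 1. The Schrödinger representation and the coaction on $\mathfrak B^+$ restrict to $\mathfrak N^+=\mathfrak N^+\sharp 1\subset\mathfrak B^+$; the restricted coaction is $b\mapsto\sum\bigl(b_{(1)}\sharp (b_{(2)})_{(-1)}\otimes 1\bigr)\otimes (b_{(2)})_{(0)}$. With these structures $\mathfrak N^+$ is a $D_\varphi$-Yetter–Drinfel'd module algebra. 2. The Schrödinger representation and the coaction on $\mathfrak B^-$ restrict to $\mathfrak N^-=\mathfrak N^-\sharp 1\subset\mathfrak B^-$, and with these structures $\mathfrak N^-$ is a $D_\varphi$-Yetter–Drinfel'd module algebra. 3. The space $W_\varphi=\mathfrak N^-\otimes\mathfrak N^+$ with the braided product $(y\otimes x)(y'\otimes x')=\sum y\,(x_{(-1)}.y')\otimes x_{(0)}x'$, where $x\mapsto\sum x_{(-1)}\otimes x_{(0)}$ and $.$ are the coaction and action of $D_\varphi$ of 1 and 2, is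 an associative algebra with unit $1\otimes 1$ (the differential algebra of the Nichols algebra $\mathfrak N^-$). 4. $\mathfrak N^-$ is a left $W_\varphi$-module by $(y\otimes x).z=y\,(x.z)$, where $x.z$ is the action of $(x\sharp 1)\otimes 1\in D_\varphi$; that is, $\mathfrak N^-$ acts by left multiplication and $\mathfrak N^+$ by $x.z=\sum\varphi(x,z_{(1)})z_{(2)}$, the coproduct of $z$ being taken in $\mathfrak B^-$. -/

import Mathlib

open scoped TensorProduct

noncomputable section

namespace NicholsDouble

/-! All structure maps are linear maps out of tensor products; the Sweedler formula that a
composite of such maps encodes is given in its doc comment.  Indices in lower position are written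
`a₁ ⊗ a₂` for the coproduct of `a` and `m₋₁ ⊗ m₀` for the coaction on `m`. -/

section Algebra

variable {k : Type*} [Field k] {A : Type*} [AddCommGroup A] [Module k A]

/-- `mul` is an associative multiplication with unit `one`. -/
structure IsUnitalAssoc (mul : A ⊗[k] A →ₗ[k] A) (one : A) : Prop where
  mul_assoc : ∀ a b c : A, mul (mul (a ⊗ₜ b) ⊗ₜ c) = mul (a ⊗ₜ mul (b ⊗ₜ c))
  one_mul : ∀ a : A, mul (one ⊗ₜ a) = a
  mul_one : ∀ a : A, mul (a ⊗ₜ one) = a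

/-- `act` is a left module structure over the algebra with multiplication `mul`, unit `one`. -/
structure IsLeftModule {M : Type*} [AddCommGroup M] [Module k M]
    (mul : A ⊗[k] A →ₗ[k] A) (one : A) (act : A ⊗[k] M →ₗ[k] M) : Prop where
  one_act : ∀ m : M, act (one ⊗ₜ m) = m
  mul_act : ∀ (a b : A) (m : M), act (mul (a ⊗ₜ b) ⊗ₜ m) = act (a ⊗ₜ act (b ⊗ₜ m))

end Algebra

/-- The operations of a Hopf algebra on the vector space `A`. The axioms are in
`HopfOps.IsHopf`. -/
structure HopfOps (k A : Type*) [Field k] [AddCommGroup A] [Module k A] where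
  mul : A ⊗[k] A →ₗ[k] A
  one : A
  comul : A →ₗ[k] A ⊗[k] A
  counit : A →ₗ[k] k
  antipode : A →ₗ[k] A

namespace HopfOps

variable {k A : Type*} [Field k] [AddCommGroup A] [Module k A]

/-- The axioms of a Hopf algebra. -/
structure IsHopf (O : HopfOps k A) : Prop where
  algebra : IsUnitalAssoc O.mul O.one
  coassoc : ∀ a : A, TensorProduct.assoc k A A A (O.comul.rTensor A (O.comul a)) =
    O.comul.lTensor A (O.comul a)
  counit_comul : ∀ a : A, TensorProduct.lid k A (O.counit.rTensor A (O.comul a)) = a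
  comul_counit : ∀ a : A, TensorProduct.rid k A (O.counit.lTensor A (O.comul a)) = a
  comul_one : O.comul O.one = O.one ⊗ₜ O.one
  comul_mul : ∀ a b : A, O.comul (O.mul (a ⊗ₜ b)) =
    TensorProduct.map O.mul O.mul
      (TensorProduct.tensorTensorTensorComm k A A A A (O.comul a ⊗ₜ O.comul b))
  counit_one : O.counit O.one = 1
  counit_mul : ∀ a b : A, O.counit (O.mul (a ⊗ₜ b)) = O.counit a * O.counit b
  antipode_left : ∀ a : A, O.mul (O.antipode.rTensor A (O.comul a)) = O.counit a • O.one
  antipode_right : ∀ a : A, O.mul (O.antipode.lTensor A (O.comul a)) = O.counit a • O.one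

/-- The operations of a Hopf algebra of the library. -/
def of (k A : Type*) [Field k] [Ring A] [HopfAlgebra k A] : HopfOps k A where
  mul := LinearMap.mul' k A
  one := 1
  comul := Coalgebra.comul
  counit := Coalgebra.counit
  antipode := HopfAlgebra.antipode k

/-- The adjoint action `a ⊗ x ↦ ∑ a₁ x S(a₂)`. -/
def adjoint (O : HopfOps k A) : A ⊗[k] A →ₗ[k] A :=
  O.mul ∘ₗ TensorProduct.map O.mul O.antipode ∘ₗ
    (TensorProduct.rightComm k A A A).toLinearMap ∘ₗ O.comul.rTensor A

end HopfOps

section YetterDrinfeld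

/-- An action map and a coaction map of `A` on `M`. -/
structure YDOps (k A M : Type*) [Field k] [AddCommGroup A] [Module k A]
    [AddCommGroup M] [Module k M] where
  act : A ⊗[k] M →ₗ[k] M
  coact : M →ₗ[k] A ⊗[k] M

variable {k A M N : Type*} [Field k] [AddCommGroup A] [Module k A]
  [AddCommGroup M] [Module k M] [AddCommGroup N] [Module k N]

/-- `h ⊗ m ↦ ∑ h₁ m₋₁ ⊗ h₂ • m₀`. -/
def ydLeft (O : HopfOps k A) (Y : YDOps k A M) : A ⊗[k] M →ₗ[k] A ⊗[k] M :=
  TensorProduct.map O.mul Y.act ∘ₗ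
    (TensorProduct.tensorTensorTensorComm k A A A M).toLinearMap ∘ₗ
    TensorProduct.map O.comul Y.coact

/-- `h ⊗ m ↦ ∑ (h₁ • m)₋₁ h₂ ⊗ (h₁ • m)₀`. -/
def ydRight (O : HopfOps k A) (Y : YDOps k A M) : A ⊗[k] M →ₗ[k] A ⊗[k] M :=
  O.mul.rTensor M ∘ₗ (TensorProduct.rightComm k A M A).toLinearMap ∘ₗ
    Y.coact.rTensor A ∘ₗ Y.act.rTensor A ∘ₗ
    (TensorProduct.rightComm k A A M).toLinearMap ∘ₗ O.comul.rTensor M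

/-- Left Yetter-Drinfeld modules. -/
structure IsYetterDrinfeld (O : HopfOps k A) (Y : YDOps k A M) : Prop where
  module : IsLeftModule O.mul O.one Y.act
  counit_coact : ∀ m : M, TensorProduct.lid k M (O.counit.rTensor M (Y.coact m)) = m
  coassoc : ∀ m : M, TensorProduct.assoc k A A M (O.comul.rTensor M (Y.coact m)) =
    Y.coact.lTensor A (Y.coact m)
  compat : ∀ (h : A) (m : M), ydLeft O Y (h ⊗ₜ m) = ydRight O Y (h ⊗ₜ m)

/-- Morphisms of Yetter-Drinfeld modules: linear maps that preserve action and coaction. -/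
structure IsYDHom (Y : YDOps k A M) (Z : YDOps k A N) (f : M →ₗ[k] N) : Prop where
  map_act : ∀ (h : A) (m : M), f (Y.act (h ⊗ₜ m)) = Z.act (h ⊗ₜ f m)
  map_coact : ∀ m : M, Z.coact (f m) = f.lTensor A (Y.coact m)

/-- The unit object: `h • c = ε(h) c` and `c ↦ 1 ⊗ c`. -/
def YDOps.unit (O : HopfOps k A) : YDOps k A k where
  act := LinearMap.mul' k k ∘ₗ O.counit.rTensor k
  coact := TensorProduct.mk k A k O.one

/-- The tensor product: `h • (m ⊗ n) = ∑ h₁ • m ⊗ h₂ • n` and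
`m ⊗ n ↦ ∑ m₋₁ n₋₁ ⊗ (m₀ ⊗ n₀)`. -/
def YDOps.tensor (O : HopfOps k A) (Y : YDOps k A M) (Z : YDOps k A N) :
    YDOps k A (M ⊗[k] N) where
  act := TensorProduct.map Y.act Z.act ∘ₗ
    (TensorProduct.tensorTensorTensorComm k A A M N).toLinearMap ∘ₗ O.comul.rTensor (M ⊗[k] N)
  coact := O.mul.rTensor (M ⊗[k] N) ∘ₗ
    (TensorProduct.tensorTensorTensorComm k A M A N).toLinearMap ∘ₗ
    TensorProduct.map Y.coact Z.coact

/-- The braiding `m ⊗ n ↦ ∑ m₋₁ • n ⊗ m₀`. -/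
def braiding (Y : YDOps k A M) (Z : YDOps k A N) : M ⊗[k] N →ₗ[k] N ⊗[k] M :=
  Z.act.rTensor M ∘ₗ (TensorProduct.rightComm k A M N).toLinearMap ∘ₗ Y.coact.rTensor N

/-- The multiplication of the braided tensor product of two algebras `M` and `N`,
`(m ⊗ n)(m' ⊗ n') = ∑ m (n₋₁ • m') ⊗ n₀ n'`. -/
def braidedMul {M N : Type*} [Ring M] [Algebra k M] [Ring N] [Algebra k N]
    (Y : YDOps k A M) (Z : YDOps k A N) :
    (M ⊗[k] N) ⊗[k] (M ⊗[k] N) →ₗ[k] M ⊗[k] N :=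
  TensorProduct.map (LinearMap.mul' k M) (LinearMap.mul' k N) ∘ₗ
    (TensorProduct.assoc k M M (N ⊗[k] N)).symm.toLinearMap ∘ₗ
    ((TensorProduct.assoc k M N N).toLinearMap ∘ₗ (braiding Z Y).rTensor N ∘ₗ
      (TensorProduct.assoc k N M N).symm.toLinearMap).lTensor M ∘ₗ
    (TensorProduct.assoc k M N (M ⊗[k] N)).toLinearMap

/-- A Yetter-Drinfeld module algebra: an algebra in the category of Yetter-Drinfeld modules, that
is, multiplication and unit are morphisms in this category. -/
structure IsYDAlgebra {M : Type*} [Ring M] [Algebra k M] (O : HopfOps k A) (Y : YDOps k A M) :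
    Prop where
  yd : IsYetterDrinfeld O Y
  mul_hom : IsYDHom (Y.tensor O Y) Y (LinearMap.mul' k M)
  one_hom : IsYDHom (YDOps.unit O) Y (Algebra.linearMap k M)

end YetterDrinfeld

section Nichols

variable {k H : Type*} [Field k] [Ring H] [HopfAlgebra k H]
  {R : Type*} [Ring R] [Algebra k R] [Coalgebra k R]

/-- A braided Hopf algebra in the category of Yetter-Drinfeld modules over `H`. -/
structure IsBraidedHopf (Y : YDOps k H R) (S : R →ₗ[k] R) : Prop where
  algebra : IsYDAlgebra (HopfOps.of k H) Y
  comul_hom : IsYDHom Y (Y.tensor (HopfOps.of k H) Y) (Coalgebra.comul (R := k) (A := R))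
  counit_hom : IsYDHom Y (YDOps.unit (HopfOps.of k H)) (Coalgebra.counit (R := k) (A := R))
  comul_one : Coalgebra.comul (R := k) (1 : R) = 1 ⊗ₜ 1
  comul_mul : ∀ x y : R, Coalgebra.comul (R := k) (x * y) =
    braidedMul Y Y (Coalgebra.comul x ⊗ₜ Coalgebra.comul y)
  counit_one : Coalgebra.counit (R := k) (1 : R) = 1
  counit_mul : ∀ x y : R, Coalgebra.counit (R := k) (x * y) =
    Coalgebra.counit x * Coalgebra.counit y
  antipode_left : ∀ x : R, LinearMap.mul' k R (S.rTensor R (Coalgebra.comul x)) =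
    algebraMap k R (Coalgebra.counit x)
  antipode_right : ∀ x : R, LinearMap.mul' k R (S.lTensor R (Coalgebra.comul x)) =
    algebraMap k R (Coalgebra.counit x)

/-- A grading of a braided Hopf algebra `R` by Yetter-Drinfeld submodules `gr n`, compatible with
product and coproduct. -/
structure IsBraidedGrading (Y : YDOps k H R) (gr : ℕ → Submodule k R) : Prop where
  internal : DirectSum.IsInternal gr
  one_mem : (1 : R) ∈ gr 0
  mul_mem : ∀ (m n : ℕ) (x y : R), x ∈ gr m → y ∈ gr n → x * y ∈ gr (m + n)
  comul_mem : ∀ (n : ℕ) (x : R), x ∈ gr n → Coalgebra.comul (R := k) x ∈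
    ⨆ (p : ℕ × ℕ) (_ : p.1 + p.2 = n),
      LinearMap.range (TensorProduct.map (gr p.1).subtype (gr p.2).subtype)
  counit_eq_zero : ∀ (n : ℕ) (x : R), n ≠ 0 → x ∈ gr n → Coalgebra.counit (R := k) x = 0
  act_mem : ∀ (n : ℕ) (h : H) (x : R), x ∈ gr n → Y.act (h ⊗ₜ x) ∈ gr n
  coact_mem : ∀ (n : ℕ) (x : R), x ∈ gr n →
    Y.coact x ∈ LinearMap.range ((gr n).subtype.lTensor H)

/-- `R`, with the grading `gr`, is a Nichols algebra of the Yetter-Drinfeld module `V`, which is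
identified with the component of degree one by means of `j`. -/
structure IsNicholsAlgebra {V : Type*} [AddCommGroup V] [Module k V] (YV : YDOps k H V)
    (Y : YDOps k H R) (S : R →ₗ[k] R) (gr : ℕ → Submodule k R) (j : V →ₗ[k] R) : Prop where
  braidedHopf : IsBraidedHopf Y S
  grading : IsBraidedGrading Y gr
  degree_zero : gr 0 = Submodule.span k {1}
  j_hom : IsYDHom YV Y j
  j_injective : Function.Injective j
  degree_one : LinearMap.range j = gr 1
  generated : Algebra.adjoin k (gr 1 : Set R) = ⊤
  primitive : ∀ x : R, Coalgebra.comul (R := k) x = x ⊗ₜ 1 + 1 ⊗ₜ x ↔ x ∈ gr 1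

/-! ### Radford's biproduct -/

/-- `(a ⊗ h)(a' ⊗ h') = ∑ a (h₁ • a') ⊗ h₂ h'`. -/
def biproductMul (Y : YDOps k H R) : (R ⊗[k] H) ⊗[k] (R ⊗[k] H) →ₗ[k] R ⊗[k] H :=
  TensorProduct.map
      (LinearMap.mul' k R ∘ₗ Y.act.lTensor R ∘ₗ (TensorProduct.assoc k R H R).toLinearMap)
      (LinearMap.mul' k H) ∘ₗ
    (TensorProduct.tensorTensorTensorComm k (R ⊗[k] H) H R H).toLinearMap ∘ₗ
    ((TensorProduct.assoc k R H H).symm.toLinearMap ∘ₗ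
      (Coalgebra.comul (R := k) (A := H)).lTensor R).rTensor (R ⊗[k] H)

/-- `a ⊗ h ↦ ∑ (a₁ ⊗ (a₂)₋₁ h₁) ⊗ ((a₂)₀ ⊗ h₂)`. -/
def biproductComul (Y : YDOps k H R) : R ⊗[k] H →ₗ[k] (R ⊗[k] H) ⊗[k] (R ⊗[k] H) :=
  ((LinearMap.mul' k H).lTensor R ∘ₗ
      (TensorProduct.assoc k R H H).toLinearMap).rTensor (R ⊗[k] H) ∘ₗ
    (TensorProduct.tensorTensorTensorComm k (R ⊗[k] H) R H H).toLinearMap ∘ₗ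
    ((TensorProduct.assoc k R H R).symm.toLinearMap ∘ₗ Y.coact.lTensor R).rTensor (H ⊗[k] H) ∘ₗ
    TensorProduct.map (Coalgebra.comul (R := k) (A := R)) (Coalgebra.comul (R := k) (A := H))

/-- `a ⊗ h ↦ ∑ (1 ⊗ S_H(h) S_H(a₋₁)) (S(a₀) ⊗ 1)`. -/
def biproductAntipode (Y : YDOps k H R) (S : R →ₗ[k] R) : R ⊗[k] H →ₗ[k] R ⊗[k] H :=
  biproductMul Y ∘ₗ
    TensorProduct.map (TensorProduct.mk k R H 1) ((TensorProduct.mk k R H).flip 1) ∘ₗ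
    TensorProduct.map (LinearMap.mul' k H ∘ₗ
      TensorProduct.map (HopfAlgebra.antipode k) (HopfAlgebra.antipode k)) S ∘ₗ
    (TensorProduct.assoc k H H R).symm.toLinearMap ∘ₗ
    (TensorProduct.comm k (H ⊗[k] R) H).toLinearMap ∘ₗ Y.coact.rTensor H

/-- The operations of Radford's biproduct of `R` and `H`, on the vector space `R ⊗ H`. -/
def biproduct (Y : YDOps k H R) (S : R →ₗ[k] R) : HopfOps k (R ⊗[k] H) where
  mul := biproductMul Y
  one := 1 ⊗ₜ 1
  comul := biproductComul Y
  counit := LinearMap.mul' k k ∘ₗ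
    TensorProduct.map (Coalgebra.counit (R := k) (A := R)) (Coalgebra.counit (R := k) (A := H))
  antipode := biproductAntipode Y S

/-- The inclusion `x ↦ x ⊗ 1` of `R` into the biproduct. -/
def incl (k R H : Type*) [Field k] [Ring R] [Algebra k R] [Ring H] [HopfAlgebra k H] :
    R →ₗ[k] R ⊗[k] H :=
  (TensorProduct.mk k R H).flip 1

end Nichols

section Double

variable {k A B : Type*} [Field k] [AddCommGroup A] [Module k A] [AddCommGroup B] [Module k B]

/-- Generalized Hopf pairings: `φ(a, b b') = ∑ φ(a₁, b) φ(a₂, b')`,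
`φ(a a', b) = ∑ φ(a, b₂) φ(a', b₁)`, `φ(a, 1) = ε(a)` and `φ(1, b) = ε(b)`. -/
structure IsHopfPairing (O : HopfOps k A) (P : HopfOps k B) (φ : A →ₗ[k] B →ₗ[k] k) : Prop where
  right_mul : ∀ (a : A) (b b' : B), φ a (P.mul (b ⊗ₜ b')) =
    LinearMap.mul' k k (TensorProduct.map (φ.flip b) (φ.flip b') (O.comul a))
  left_mul : ∀ (a a' : A) (b : B), φ (O.mul (a ⊗ₜ a')) b =
    LinearMap.mul' k k (TensorProduct.map (φ a') (φ a) (P.comul b))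
  right_one : ∀ a : A, φ a P.one = O.counit a
  left_one : ∀ b : B, φ O.one b = P.counit b

/-- The tensor product coalgebra, `a ⊗ b ↦ ∑ (a₁ ⊗ b₁) ⊗ (a₂ ⊗ b₂)`. -/
def tensorComul (O : HopfOps k A) (P : HopfOps k B) :
    A ⊗[k] B →ₗ[k] (A ⊗[k] B) ⊗[k] (A ⊗[k] B) :=
  (TensorProduct.tensorTensorTensorComm k A A B B).toLinearMap ∘ₗ
    TensorProduct.map O.comul P.comul

/-- `a ⊗ b ↦ φ(a, S(b))`, the convolution inverse of the pairing. It equals `φ(S⁻¹(a), b)` as soon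
as the antipode of `A` is invertible. -/
def pairingInv (P : HopfOps k B) (φ : A →ₗ[k] B →ₗ[k] k) : A ⊗[k] B →ₗ[k] k :=
  TensorProduct.lift φ ∘ₗ P.antipode.lTensor A

/-- The exchange map of the quantum double,
`b ⊗ a ↦ ∑ φ(a₁, S(b₁)) φ(a₃, b₃) a₂ ⊗ b₂`. -/
def exchange (O : HopfOps k A) (P : HopfOps k B) (φ : A →ₗ[k] B →ₗ[k] k) :
    B ⊗[k] A →ₗ[k] A ⊗[k] B :=
  (TensorProduct.lid k (A ⊗[k] B)).toLinearMap ∘ₗ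
    TensorProduct.map (pairingInv P φ)
      ((TensorProduct.rid k (A ⊗[k] B)).toLinearMap ∘ₗ
        (TensorProduct.lift φ).lTensor (A ⊗[k] B) ∘ₗ tensorComul O P) ∘ₗ
    tensorComul O P ∘ₗ (TensorProduct.comm k B A).toLinearMap

/-- `(a ⊗ b)(a' ⊗ b') = ∑ φ(a'₁, S(b₁)) φ(a'₃, b₃) a a'₂ ⊗ b₂ b'`. -/
def doubleMul (O : HopfOps k A) (P : HopfOps k B) (φ : A →ₗ[k] B →ₗ[k] k) :
    (A ⊗[k] B) ⊗[k] (A ⊗[k] B) →ₗ[k] A ⊗[k] B :=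
  TensorProduct.map O.mul P.mul ∘ₗ
    (TensorProduct.assoc k A A (B ⊗[k] B)).symm.toLinearMap ∘ₗ
    ((TensorProduct.assoc k A B B).toLinearMap ∘ₗ (exchange O P φ).rTensor B ∘ₗ
      (TensorProduct.assoc k B A B).symm.toLinearMap).lTensor A ∘ₗ
    (TensorProduct.assoc k A B (A ⊗[k] B)).toLinearMap

/-- The operations of the quantum double of `A` and `B` with respect to `φ`, on the vector space
`A ⊗ B`: the coalgebra is the tensor product coalgebra, the product is `doubleMul` and the
antipode is `a ⊗ b ↦ (1 ⊗ S(b)) (S(a) ⊗ 1)`. -/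
def double (O : HopfOps k A) (P : HopfOps k B) (φ : A →ₗ[k] B →ₗ[k] k) :
    HopfOps k (A ⊗[k] B) where
  mul := doubleMul O P φ
  one := O.one ⊗ₜ P.one
  comul := tensorComul O P
  counit := LinearMap.mul' k k ∘ₗ TensorProduct.map O.counit P.counit
  antipode := doubleMul O P φ ∘ₗ
    TensorProduct.map (TensorProduct.mk k A B O.one) ((TensorProduct.mk k A B).flip P.one) ∘ₗ
    TensorProduct.map P.antipode O.antipode ∘ₗ (TensorProduct.comm k A B).toLinearMap

/-- `b ⊗ x ↦ ∑ φ(x₁, S(b)) x₂`. -/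
def contractPlus (O : HopfOps k A) (P : HopfOps k B) (φ : A →ₗ[k] B →ₗ[k] k) :
    B ⊗[k] A →ₗ[k] A :=
  (TensorProduct.lid k A).toLinearMap ∘ₗ
    (pairingInv P φ ∘ₗ (TensorProduct.comm k B A).toLinearMap).rTensor A ∘ₗ
    (TensorProduct.assoc k B A A).symm.toLinearMap ∘ₗ O.comul.lTensor B

/-- `a ⊗ y ↦ ∑ φ(a, y₁) y₂`. -/
def contractMinus (P : HopfOps k B) (φ : A →ₗ[k] B →ₗ[k] k) : A ⊗[k] B →ₗ[k] B :=
  (TensorProduct.lid k B).toLinearMap ∘ₗ (TensorProduct.lift φ).rTensor B ∘ₗ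
    (TensorProduct.assoc k A B B).symm.toLinearMap ∘ₗ P.comul.lTensor A

/-- The Schrödinger representation of the quantum double on `A`,
`(a ⊗ b) • x = (a ⊗ 1) • ((1 ⊗ b) • x)` with `(a ⊗ 1) • x = ∑ a₁ x S(a₂)` and
`(1 ⊗ b) • x = ∑ φ(x₁, S(b)) x₂`, together with the coaction `x ↦ ∑ (x₁ ⊗ 1) ⊗ x₂`. -/
def schroedingerPlus (O : HopfOps k A) (P : HopfOps k B) (φ : A →ₗ[k] B →ₗ[k] k) :
    YDOps k (A ⊗[k] B) A where
  act := O.adjoint ∘ₗ (contractPlus O P φ).lTensor A ∘ₗ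
    (TensorProduct.assoc k A B A).toLinearMap
  coact := ((TensorProduct.mk k A B).flip P.one).rTensor A ∘ₗ O.comul

/-- The Schrödinger representation of the quantum double on `B`,
`(a ⊗ b) • y = (a ⊗ 1) • ((1 ⊗ b) • y)` with `(a ⊗ 1) • y = ∑ φ(a, y₁) y₂` and
`(1 ⊗ b) • y = ∑ b₁ y S(b₂)`, together with the coaction `y ↦ ∑ (1 ⊗ y₁) ⊗ y₂`. -/
def schroedingerMinus (O : HopfOps k A) (P : HopfOps k B) (φ : A →ₗ[k] B →ₗ[k] k) :
    YDOps k (A ⊗[k] B) B where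
  act := contractMinus P φ ∘ₗ P.adjoint.lTensor A ∘ₗ
    (TensorProduct.assoc k A B B).toLinearMap
  coact := (TensorProduct.mk k A B O.one).rTensor B ∘ₗ P.comul

end Double

section Restriction

variable {k D M N : Type*} [Field k] [AddCommGroup D] [Module k D]
  [AddCommGroup M] [Module k M] [AddCommGroup N] [Module k N]

/-- `Y` is the restriction along `i : M → N` of the action and coaction `Z` on `N`. -/
structure IsRestriction (i : M →ₗ[k] N) (Y : YDOps k D M) (Z : YDOps k D N) : Prop where
  act_eq : ∀ (d : D) (m : M), i (Y.act (d ⊗ₜ m)) = Z.act (d ⊗ₜ i m)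
  coact_eq : ∀ m : M, i.lTensor D (Y.coact m) = Z.coact (i m)

end Restriction

/-- The coaction `x ↦ ∑ ((x₁ ⊗ (x₂)₋₁) ⊗ 1) ⊗ (x₂)₀` of the quantum double on `R`. -/
def plusCoact {k H R : Type*} [Field k] [Ring H] [HopfAlgebra k H] [Ring R] [Algebra k R]
    [Coalgebra k R] (R' H' : Type*) [Ring R'] [Algebra k R'] [Ring H'] [HopfAlgebra k H']
    (Y : YDOps k H R) :
    R →ₗ[k] ((R ⊗[k] H) ⊗[k] (R' ⊗[k] H')) ⊗[k] R :=
  ((TensorProduct.mk k (R ⊗[k] H) (R' ⊗[k] H')).flip (1 ⊗ₜ 1)).rTensor R ∘ₗ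
    (TensorProduct.assoc k R H R).symm.toLinearMap ∘ₗ Y.coact.lTensor R ∘ₗ
    Coalgebra.comul (R := k) (A := R)

/-- `(y ⊗ x) ⊗ z ↦ y (x • z)` for `y, z` in `R'` and `x` in `R`, where `x` acts through the
element `(x ⊗ 1) ⊗ (1 ⊗ 1)` of the quantum double. -/
def differentialAct {k H R H' R' : Type*} [Field k] [Ring H] [HopfAlgebra k H]
    [Ring R] [Algebra k R] [Ring H'] [HopfAlgebra k H'] [Ring R'] [Algebra k R']
    (Z : YDOps k ((R ⊗[k] H) ⊗[k] (R' ⊗[k] H')) R') :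
    (R' ⊗[k] R) ⊗[k] R' →ₗ[k] R' :=
  LinearMap.mul' k R' ∘ₗ
    (Z.act ∘ₗ (((TensorProduct.mk k (R ⊗[k] H) (R' ⊗[k] H')).flip (1 ⊗ₜ 1)) ∘ₗ
      incl k R H).rTensor R').lTensor R' ∘ₗ
    (TensorProduct.assoc k R' R R').toLinearMap

end NicholsDouble

end

open scoped TensorProduct

noncomputable section

namespace NicholsDouble

/-! ### Sweedler sums -/

attribute [fun_prop] IsLinearMap

section Sweedler

variable {k : Type*} [Field k]
  {M N P Q : Type*} [AddCommGroup M] [Module k M] [AddCommGroup N] [Module k N]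
  [AddCommGroup P] [Module k P] [AddCommGroup Q] [Module k Q]

/-! The statement is formal once every structure is written as a sum over Sweedler components. Three
products occur: the biproduct, the quantum double and the algebra `W`. Each has the shape (m ⊗ n)(m'
⊗ n') = m τ(n ⊗ m') n' for an exchange map τ, so one criterion, `twistedMul_isUnitalAssoc`, gives
associativity and unit for all of them.

For the double of Hopf algebras A and B, let ψ(a ⊗ b) = φ(a, S(b)). Multiplicativity of φ in B makes
ψ the convolution inverse of φ on the coalgebra A ⊗ B. On c = a ⊗ b the exchange map is the
conjugation c ↦ ∑ ψ(c₁) c₂ φ(c₃) (`exchange_comm`), and conjugation is a coalgebra map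
(`comul_exchange_comm`). This makes the double a bialgebra, and its antipode cancels one factor at a
time. The Schrödinger representations are Yetter-Drinfeld for two reasons: the adjoint action is
compatible with the coproduct (`adjoint_compat`), and the factor φ or ψ of a contraction cancels one
side of the conjugation (`exchange_contractPlus`, `contractMinus_exchange`).

For a braided Hopf algebra R over H, the image of R in the biproduct is a left coideal
(`biproductComul_incl`), hence stable under contraction of the first leg of the coproduct. It is
also stable under the adjoint action: H acts by conjugation through the given action, and R acts by
the braided adjoint action (`adjoint_incl_mem`). So action and coaction restrict to R. Tensoring
over a field preserves injectivity, so all axioms pass to R (`IsRestriction.isYDAlgebra`). Finally,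
x ↦ (x ⊗ 1) ⊗ 1 is multiplicative and turns the coaction on R into the coproduct of the double
(`double_comul_incl`). This is exactly what makes the action of `W` on R' multiplicative
(`braidedMul_isLeftModule`).

Since R ⊗ H and A ⊗ B already carry the componentwise algebra structure as an instance, the new
structures are kept as bare maps `HopfOps`. Computations are done for instance Hopf algebras and
carried over by `HopfOps.IsHopf.transfer`. -/

/-- A finite family of pure tensors whose sum is `t`. -/
def tensorTerms (t : M ⊗[k] N) : Multiset (M × N) :=
  (TensorProduct.exists_multiset t).choose

theorem sum_tensorTerms (t : M ⊗[k] N) :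
    ((tensorTerms t).map fun p => p.1 ⊗ₜ[k] p.2).sum = t :=
  (TensorProduct.exists_multiset t).choose_spec.symm

/-- `sw t f` is the Sweedler sum `∑ f t₁ t₂`, where `t = ∑ t₁ ⊗ t₂`. -/
def sw {P : Type*} [AddCommMonoid P] (t : M ⊗[k] N) (f : M → N → P) : P :=
  ((tensorTerms t).map fun p => f p.1 p.2).sum

/-- The family representing `t` is fixed, so `f` may be any function here. Bilinearity is needed
only when `t` itself is rewritten, as in `sw_pure` and `sw_sw`. -/
theorem map_sw {P Q F : Type*} [AddCommMonoid P] [AddCommMonoid Q] [FunLike F P Q]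
    [AddMonoidHomClass F P Q] (g : F) (t : M ⊗[k] N) (f : M → N → P) :
    g (sw t f) = sw t fun x y => g (f x y) := by
  simp [sw, map_multiset_sum]

theorem sw_congr {P : Type*} [AddCommMonoid P] (t : M ⊗[k] N) {f g : M → N → P}
    (h : ∀ x y, f x y = g x y) : sw t f = sw t g :=
  congrArg (sw t) (funext₂ h)

theorem sw_tmul_eq (t : M ⊗[k] N) : (sw t fun x y => x ⊗ₜ[k] y) = t := sum_tensorTerms t

omit [Module k P] in
theorem map_eq_sw {F : Type*} [FunLike F (M ⊗[k] N) P] [AddMonoidHomClass F (M ⊗[k] N) P] (g : F)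
    (t : M ⊗[k] N) : g t = sw t fun x y => g (x ⊗ₜ y) := by
  rw [← map_sw, sw_tmul_eq]

omit [Module k P] in
theorem sw_comm {M' N' : Type*} [AddCommGroup M'] [Module k M'] [AddCommGroup N'] [Module k N']
    (t : M ⊗[k] N) (u : M' ⊗[k] N') (f : M → N → M' → N' → P) :
    (sw t fun x y => sw u fun x' y' => f x y x' y') =
      sw u fun x' y' => sw t fun x y => f x y x' y' := by
  exact Multiset.sum_map_sum_map _ _

omit [Module k P] in
theorem sw_add (t : M ⊗[k] N) (f g : M → N → P) :
    (sw t fun x y => f x y + g x y) = sw t f + sw t g :=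
  Multiset.sum_map_add

theorem tmul_sw (t : M ⊗[k] N) (f : M → N → P) (q : Q) :
    q ⊗ₜ[k] sw t f = sw t fun x y => q ⊗ₜ f x y :=
  map_sw (TensorProduct.mk k Q P q) t f

theorem sw_tmul (t : M ⊗[k] N) (f : M → N → P) (q : Q) :
    sw t f ⊗ₜ[k] q = sw t fun x y => f x y ⊗ₜ q :=
  map_sw ((TensorProduct.mk k P Q).flip q) t f

theorem mul_sw {A : Type*} [Ring A] (t : M ⊗[k] N) (f : M → N → A) (q : A) :
    q * sw t f = sw t fun x y => q * f x y :=
  map_sw (AddMonoidHom.mulLeft q) t f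

theorem sw_mul {A : Type*} [Ring A] (t : M ⊗[k] N) (f : M → N → A) (q : A) :
    sw t f * q = sw t fun x y => f x y * q :=
  map_sw (AddMonoidHom.mulRight q) t f

theorem smul_sw (t : M ⊗[k] N) (f : M → N → P) (c : k) :
    c • sw t f = sw t fun x y => c • f x y :=
  map_sw (LinearMap.lsmul k P c) t f

theorem sw_smul (t : M ⊗[k] N) (f : M → N → k) (p : P) :
    sw t f • p = sw t fun x y => f x y • p :=
  map_sw ((LinearMap.lsmul k P).flip p) t f

/-- A bilinear function, as a bundled bilinear map. -/
def bilin (f : M → N → P) (h₁ : ∀ y, IsLinearMap k fun x => f x y)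
    (h₂ : ∀ x, IsLinearMap k fun y => f x y) : M →ₗ[k] N →ₗ[k] P :=
  LinearMap.mk₂ k f (fun x x' y => (h₁ y).map_add x x') (fun c x y => (h₁ y).map_smul c x)
    (fun x y y' => (h₂ x).map_add y y') (fun c x y => (h₂ x).map_smul c y)

/-- For bilinear `f` the sum does not depend on the chosen family. The two linearity conditions are
stated one variable at a time so that `fun_prop` can discharge them inside `simp`. -/
theorem sw_eq_lift (t : M ⊗[k] N) (f : M → N → P) (h₁ : ∀ y, IsLinearMap k fun x => f x y)
    (h₂ : ∀ x, IsLinearMap k fun y => f x y) :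
    sw t f = TensorProduct.lift (bilin f h₁ h₂) t := by
  rw [map_eq_sw (TensorProduct.lift (bilin f h₁ h₂))]
  rfl

theorem smul_tensor_sw (t : M ⊗[k] N) (c : k) (f : M → N → P)
    (h₁ : ∀ y, IsLinearMap k fun x => f x y) (h₂ : ∀ x, IsLinearMap k fun y => f x y) :
    sw (c • t) f = c • sw t f := by
  rw [sw_eq_lift _ f h₁ h₂, sw_eq_lift _ f h₁ h₂, map_smul]

theorem sw_pure (m : M) (n : N) (f : M → N → P) (h₁ : ∀ y, IsLinearMap k fun x => f x y)
    (h₂ : ∀ x, IsLinearMap k fun y => f x y) : sw (m ⊗ₜ[k] n) f = f m n := by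
  rw [sw_eq_lift _ _ h₁ h₂]; rfl

theorem sw_sw {M' N' : Type*} [AddCommGroup M'] [Module k M'] [AddCommGroup N'] [Module k N']
    (t : M' ⊗[k] N') (g : M' → N' → M ⊗[k] N) (f : M → N → P)
    (h₁ : ∀ y, IsLinearMap k fun x => f x y) (h₂ : ∀ x, IsLinearMap k fun y => f x y) :
    sw (sw t g) f = sw t fun x' y' => sw (g x' y') f := by
  simp only [sw_eq_lift _ f h₁ h₂, map_sw]

end Sweedler

/-! ### Linearity in one variable, as rules for `fun_prop`. -/

section Linear

variable {k : Type*} [Field k]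
  {L M N P Q : Type*} [AddCommGroup L] [Module k L] [AddCommGroup M] [Module k M]
  [AddCommGroup N] [Module k N] [AddCommGroup P] [Module k P] [AddCommGroup Q] [Module k Q]

@[fun_prop]
theorem isLinearMap_id : IsLinearMap k fun x : M => x := ⟨fun _ _ => rfl, fun _ _ => rfl⟩

@[fun_prop]
theorem isLinearMap_comp {f : N → P} {g : M → N} (hf : IsLinearMap k f) (hg : IsLinearMap k g) :
    IsLinearMap k fun x => f (g x) :=
  ⟨fun x y => by rw [hg.map_add, hf.map_add], fun c x => by rw [hg.map_smul, hf.map_smul]⟩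

@[fun_prop]
theorem isLinearMap_linearMap (g : N →ₗ[k] P) : IsLinearMap k fun x => g x :=
  g.isLinear

@[fun_prop]
theorem isLinearMap_linearMap_apply {f : M → (N →ₗ[k] P)} (hf : IsLinearMap k f) (n : N) :
    IsLinearMap k fun x => f x n :=
  ⟨fun x y => by rw [hf.map_add]; rfl, fun c x => by rw [hf.map_smul]; rfl⟩

@[fun_prop]
theorem isLinearMap_linearEquiv (g : N ≃ₗ[k] P) : IsLinearMap k fun x => g x :=
  g.toLinearMap.isLinear

@[fun_prop]
theorem isLinearMap_tmul_left {f : M → N} (hf : IsLinearMap k f) (c : P) :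
    IsLinearMap k fun x => f x ⊗ₜ[k] c :=
  (((TensorProduct.mk k N P).flip c) ∘ₗ hf.mk').isLinear

@[fun_prop]
theorem isLinearMap_tmul_right {f : M → N} (hf : IsLinearMap k f) (c : P) :
    IsLinearMap k fun x => c ⊗ₜ[k] f x :=
  ((TensorProduct.mk k P N c) ∘ₗ hf.mk').isLinear

@[fun_prop]
theorem isLinearMap_mul_left {A : Type*} [Ring A] [Algebra k A] {f : M → A}
    (hf : IsLinearMap k f) (c : A) : IsLinearMap k fun x => f x * c :=
  isLinearMap_comp (LinearMap.mulRight k c).isLinear hf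

@[fun_prop]
theorem isLinearMap_mul_right {A : Type*} [Ring A] [Algebra k A] {f : M → A}
    (hf : IsLinearMap k f) (c : A) : IsLinearMap k fun x => c * f x :=
  isLinearMap_comp (LinearMap.mulLeft k c).isLinear hf

@[fun_prop]
theorem isLinearMap_smul_left {f : M → k} (hf : IsLinearMap k f) (c : P) :
    IsLinearMap k fun x => f x • c :=
  isLinearMap_comp ((LinearMap.lsmul k P).flip c).isLinear hf

@[fun_prop]
theorem isLinearMap_smul_right {f : M → P} (hf : IsLinearMap k f) (c : k) :
    IsLinearMap k fun x => c • f x :=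
  isLinearMap_comp (LinearMap.lsmul k P c).isLinear hf

@[fun_prop]
theorem isLinearMap_mulK_left {f : M → k} (hf : IsLinearMap k f) (c : k) :
    IsLinearMap k fun x => f x * c :=
  isLinearMap_comp (LinearMap.mulRight k c).isLinear hf

@[fun_prop]
theorem isLinearMap_mulK_right {f : M → k} (hf : IsLinearMap k f) (c : k) :
    IsLinearMap k fun x => c * f x :=
  isLinearMap_comp (LinearMap.mulLeft k c).isLinear hf

@[fun_prop]
theorem isLinearMap_map (g : M →ₗ[k] P) (h : N →ₗ[k] Q) {f : L → M ⊗[k] N}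
    (hf : IsLinearMap k f) : IsLinearMap k fun x => TensorProduct.map g h (f x) :=
  (TensorProduct.map g h ∘ₗ hf.mk').isLinear

@[fun_prop]
theorem isLinearMap_rTensor (g : M →ₗ[k] P) {f : L → M ⊗[k] N}
    (hf : IsLinearMap k f) : IsLinearMap k fun x => g.rTensor N (f x) :=
  (g.rTensor N ∘ₗ hf.mk').isLinear

@[fun_prop]
theorem isLinearMap_lTensor (g : M →ₗ[k] P) {f : L → N ⊗[k] M}
    (hf : IsLinearMap k f) : IsLinearMap k fun x => g.lTensor N (f x) :=
  (g.lTensor N ∘ₗ hf.mk').isLinear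

@[fun_prop]
theorem isLinearMap_tensorTensorTensorComm {f : L → (M ⊗[k] N) ⊗[k] (P ⊗[k] Q)}
    (hf : IsLinearMap k f) :
    IsLinearMap k fun x => TensorProduct.tensorTensorTensorComm k M N P Q (f x) :=
  ((TensorProduct.tensorTensorTensorComm k M N P Q).toLinearMap ∘ₗ hf.mk').isLinear

@[fun_prop]
-- The parameter sits in the summand, so linearity of each summand suffices. When it sits in the
-- tensor, `isLinearMap_sw_tensor` also needs bilinearity of the summand.
theorem isLinearMap_sw_fun (t : M ⊗[k] N) {f : L → M → N → P}
    (hf : ∀ x y, IsLinearMap k fun l => f l x y) : IsLinearMap k fun l => sw t (f l) := by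
  constructor
  · intro l l'
    have h : f (l + l') = fun x y => f l x y + f l' x y := by
      funext x y; exact (hf x y).map_add l l'
    rw [h, sw_add]
  · intro c l
    have h : f (c • l) = fun x y => c • f l x y := by
      funext x y; exact (hf x y).map_smul c l
    rw [h, smul_sw]

@[fun_prop]
theorem isLinearMap_sw_tensor {t : L → M ⊗[k] N} {f : M → N → P} (ht : IsLinearMap k t)
    (h₁ : ∀ y, IsLinearMap k fun x => f x y) (h₂ : ∀ x, IsLinearMap k fun y => f x y) :
    IsLinearMap k fun l => sw (t l) f := by
  simp only [sw_eq_lift _ f h₁ h₂]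
  exact isLinearMap_comp (LinearMap.isLinear _) ht

end Linear

/-! ### Coassociativity for Sweedler sums. -/

section Coassoc

variable {k : Type*} [Field k] {C M P : Type*} [AddCommGroup C] [Module k C]
  [AddCommGroup M] [Module k M] [AddCommGroup P] [Module k P]

/-- The trilinear `f` induces a linear map on C ⊗ (C ⊗ M), which is applied to both sides of the
coassociativity equation. Allowing a comodule `M` covers coproducts (M = C) and Yetter-Drinfeld
coactions at once. -/
theorem sw_coassoc_of {Δ : C →ₗ[k] C ⊗[k] C} {δ : M →ₗ[k] C ⊗[k] M} {m : M}
    (h : TensorProduct.assoc k C C M (Δ.rTensor M (δ m)) = δ.lTensor C (δ m)) (f : C → C → M → P)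
    (h₁ : ∀ y z, IsLinearMap k fun x => f x y z) (h₂ : ∀ x z, IsLinearMap k fun y => f x y z)
    (h₃ : ∀ x y, IsLinearMap k fun z => f x y z) :
    (sw (δ m) fun x z => sw (Δ x) fun u v => f u v z) =
      sw (δ m) fun x y => sw (δ y) fun u v => f x u v := by
  have hF : IsLinearMap k fun t : C ⊗[k] (C ⊗[k] M) => sw t fun u s => sw s fun v z => f u v z := by
    fun_prop
  have e := congrArg hF.mk' h
  rw [map_eq_sw (Δ.rTensor M) (δ m), map_eq_sw (δ.lTensor C) (δ m)] at e
  simp only [map_sw, LinearMap.rTensor_tmul, LinearMap.lTensor_tmul, IsLinearMap.mk'_apply] at e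
  simp (disch := fun_prop) only [sw_pure] at e
  rw [← e]
  congr! 3 with x z
  conv_rhs => rw [← sw_tmul_eq (Δ x)]
  simp only [sw_tmul, map_sw, TensorProduct.assoc_tmul]
  simp (disch := fun_prop) only [sw_sw, sw_pure]

end Coassoc

/-! ### Sweedler calculus in coalgebras and Hopf algebras. -/

section Coalgebra

open Coalgebra HopfAlgebra

variable {k : Type*} [Field k] {P : Type*} [AddCommGroup P] [Module k P]

section

variable {C : Type*} [AddCommGroup C] [Module k C] [Coalgebra k C]

theorem sw_coassoc (c : C) (f : C → C → C → P)
    (h₁ : ∀ y z, IsLinearMap k fun x => f x y z) (h₂ : ∀ x z, IsLinearMap k fun y => f x y z)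
    (h₃ : ∀ x y, IsLinearMap k fun z => f x y z) :
    (sw (comul (R := k) c) fun x z => sw (comul (R := k) x) fun u v => f u v z) =
      sw (comul (R := k) c) fun x y => sw (comul (R := k) y) fun u v => f x u v :=
  sw_coassoc_of (coassoc_apply c) f h₁ h₂ h₃

/-- Serves as a rewrite rule where an unrelated sum, itself depending on the second leg, stands
between the two coproducts and blocks `sw_coassoc`. -/
theorem sw_coassoc_across {M' N' : Type*} [AddCommGroup M'] [Module k M'] [AddCommGroup N']
    [Module k N'] (c : C) (g : C → M' ⊗[k] N') (f : C → C → M' → N' → P) (hg : IsLinearMap k g)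
    (h₁ : ∀ y p q, IsLinearMap k fun x => f x y p q) (h₂ : ∀ x p q, IsLinearMap k fun y => f x y p q)
    (h₃ : ∀ x y q, IsLinearMap k fun p => f x y p q)
    (h₄ : ∀ x y p, IsLinearMap k fun q => f x y p q) :
    (sw (comul (R := k) c) fun x z => sw (g z) fun p q => sw (comul (R := k) x) fun u v =>
      f u v p q) =
      sw (comul (R := k) c) fun x y => sw (comul (R := k) y) fun u v => sw (g v) fun p q =>
        f x u p q := by
  rw [← sw_coassoc c (fun x u v => sw (g v) fun p q => f x u p q) (by fun_prop) (by fun_prop)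
    (by fun_prop)]
  congr! 3
  rw [sw_comm]

theorem sw_counit_left (c : C) (f : C → P) (hf : IsLinearMap k f) :
    (sw (comul (R := k) c) fun x y => counit (R := k) x • f y) = f c := by
  have e := congrArg (TensorProduct.lid k C) (rTensor_counit_comul (R := k) c)
  rw [map_eq_sw (counit.rTensor C)] at e
  simp only [map_sw, LinearMap.rTensor_tmul, TensorProduct.lid_tmul, one_smul] at e
  have e' := congrArg hf.mk' e
  simpa only [map_sw, map_smul, IsLinearMap.mk'_apply] using e'

theorem sw_counit_right (c : C) (f : C → P) (hf : IsLinearMap k f) :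
    (sw (comul (R := k) c) fun x y => counit (R := k) y • f x) = f c := by
  have e := congrArg (TensorProduct.rid k C) (lTensor_counit_comul (R := k) c)
  rw [map_eq_sw (counit.lTensor C)] at e
  simp only [map_sw, LinearMap.lTensor_tmul, TensorProduct.rid_tmul, one_smul] at e
  have e' := congrArg hf.mk' e
  simpa only [map_sw, map_smul, IsLinearMap.mk'_apply] using e'

end

section

variable {A : Type*} [Ring A] [HopfAlgebra k A]

theorem sw_comul_mul (a b : A) (f : A → A → P)
    (h₁ : ∀ y, IsLinearMap k fun x => f x y) (h₂ : ∀ x, IsLinearMap k fun y => f x y) :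
    sw (comul (R := k) (a * b)) f = sw (comul (R := k) a) fun a₁ a₂ =>
      sw (comul (R := k) b) fun b₁ b₂ => f (a₁ * b₁) (a₂ * b₂) := by
  rw [Bialgebra.comul_mul]
  conv_lhs => rw [← sw_tmul_eq (comul a), ← sw_tmul_eq (comul b)]
  simp only [sw_mul, mul_sw, Algebra.TensorProduct.tmul_mul_tmul]
  rw [sw_comm]
  simp (disch := fun_prop) only [sw_sw, sw_pure]

theorem sw_comul_one (f : A → A → P)
    (h₁ : ∀ y, IsLinearMap k fun x => f x y) (h₂ : ∀ x, IsLinearMap k fun y => f x y) :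
    sw (comul (R := k) (1 : A)) f = f 1 1 := by
  rw [Bialgebra.comul_one, Algebra.TensorProduct.one_def]
  exact sw_pure _ _ _ h₁ h₂

theorem sw_antipode_left (a : A) (f : A → P) (hf : IsLinearMap k f) :
    (sw (comul (R := k) a) fun x y => f (antipode k x * y)) = counit (R := k) a • f 1 := by
  have e := mul_antipode_rTensor_comul_apply (R := k) a
  rw [map_eq_sw (LinearMap.rTensor A (antipode k : A →ₗ[k] A)) (comul (R := k) a)] at e
  simp only [map_sw, LinearMap.rTensor_tmul, LinearMap.mul'_apply] at e
  have e' := congrArg hf.mk' e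
  rwa [map_sw, Algebra.algebraMap_eq_smul_one, map_smul] at e'

theorem sw_antipode_right (a : A) (f : A → P) (hf : IsLinearMap k f) :
    (sw (comul (R := k) a) fun x y => f (x * antipode k y)) = counit (R := k) a • f 1 := by
  have e := mul_antipode_lTensor_comul_apply (R := k) a
  rw [map_eq_sw (LinearMap.lTensor A (antipode k : A →ₗ[k] A)) (comul (R := k) a)] at e
  simp only [map_sw, LinearMap.lTensor_tmul, LinearMap.mul'_apply] at e
  have e' := congrArg hf.mk' e
  rwa [map_sw, Algebra.algebraMap_eq_smul_one, map_smul] at e'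

/-- Inverses in a convolution algebra are unique: `G` is a left inverse and Δ ∘ S a right inverse of
Δ in Hom(A, A ⊗ A). -/
theorem comul_antipode (a : A) : comul (R := k) (antipode k a) =
    sw (comul (R := k) a) fun x y => antipode k y ⊗ₜ[k] antipode k x := by
  let G : A →ₗ[k] A ⊗[k] A :=
    TensorProduct.map (antipode k) (antipode k) ∘ₗ (TensorProduct.comm k A A).toLinearMap ∘ₗ comul
  have hG (x : A) : G x = sw (comul (R := k) x) fun u v => antipode k v ⊗ₜ[k] antipode k u := by
    change (TensorProduct.map _ _ ∘ₗ (TensorProduct.comm k A A).toLinearMap) (comul x) = _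
    rw [map_eq_sw (TensorProduct.map _ _ ∘ₗ _)]
    rfl
  have h : WithConv.toConv G * WithConv.toConv comul = 1 := by
    ext c
    rw [LinearMap.convMul_apply, map_eq_sw (TensorProduct.map _ _), map_sw]
    simp only [LinearMap.convOne_apply, TensorProduct.map_tmul,
      LinearMap.mul'_apply, hG]
    calc (sw (comul (R := k) c) fun x y =>
          (sw (comul (R := k) x) fun u v => antipode k v ⊗ₜ[k] antipode k u) * comul (R := k) y)
        = sw (comul (R := k) c) fun x y => sw (comul (R := k) x) fun u v =>
            sw (comul (R := k) y) fun p q => (antipode k v * p) ⊗ₜ[k] (antipode k u * q) := by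
          refine sw_congr _ fun x y => ?_
          conv_lhs => rw [← sw_tmul_eq (comul y)]
          simp only [sw_mul, mul_sw, Algebra.TensorProduct.tmul_mul_tmul]
          rw [sw_comm]
      _ = sw (comul (R := k) c) fun u w => sw (comul (R := k) w) fun t q =>
            sw (comul (R := k) t) fun v p => (antipode k v * p) ⊗ₜ[k] (antipode k u * q) := by
          simp (disch := fun_prop) only [sw_coassoc]
      _ = algebraMap k (A ⊗[k] A) (counit c) := by
          have e₁ (u w : A) : (sw (comul (R := k) w) fun t q => sw (comul (R := k) t) fun v p =>
              (antipode k v * p) ⊗ₜ[k] (antipode k u * q)) = 1 ⊗ₜ[k] (antipode k u * w) := by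
            rw [← sw_counit_left w (fun q => (1 : A) ⊗ₜ[k] (antipode k u * q)) (by fun_prop)]
            exact sw_congr _ fun t q =>
              sw_antipode_left t (fun z => z ⊗ₜ[k] (antipode k u * q)) (by fun_prop)
          simp only [e₁]
          rw [sw_antipode_left _ (fun z => (1 : A) ⊗ₜ[k] z) (by fun_prop),
            Algebra.algebraMap_eq_smul_one, Algebra.TensorProduct.one_def]
  have e := left_inv_eq_right_inv h LinearMap.comul_right_inv
  rw [← hG]
  exact (LinearMap.congr_fun (congrArg WithConv.ofConv e) a).symm

theorem sw_comul_antipode (a : A) (f : A → A → P)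
    (h₁ : ∀ y, IsLinearMap k fun x => f x y) (h₂ : ∀ x, IsLinearMap k fun y => f x y) :
    sw (comul (R := k) (antipode k a)) f =
      sw (comul (R := k) a) fun x y => f (antipode k y) (antipode k x) := by
  rw [comul_antipode]
  simp (disch := fun_prop) only [sw_sw, sw_pure]

end

end Coalgebra

/-! ### Twisted tensor products of algebras. -/

section Twisted

variable {k : Type*} [Field k]

theorem eq_of_eq_tmul {M N P : Type*} [AddCommGroup M] [Module k M] [AddCommGroup N] [Module k N]
    [AddCommGroup P] [Module k P] {f g : M ⊗[k] N → P} (hf : IsLinearMap k f)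
    (hg : IsLinearMap k g) (h : ∀ m n, f (m ⊗ₜ n) = g (m ⊗ₜ n)) (t : M ⊗[k] N) : f t = g t := by
  have e : hf.mk' = hg.mk' := TensorProduct.ext' h
  exact LinearMap.congr_fun e t

variable {M N : Type*} [Ring M] [Algebra k M] [Ring N] [Algebra k N]

/-- The product `(m ⊗ n)(m' ⊗ n') = m τ(n ⊗ m') n'` on `M ⊗ N` defined by an exchange map `τ`. -/
def twistedMul (τ : N ⊗[k] M →ₗ[k] M ⊗[k] N) :
    (M ⊗[k] N) ⊗[k] (M ⊗[k] N) →ₗ[k] M ⊗[k] N :=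
  TensorProduct.map (LinearMap.mul' k M) (LinearMap.mul' k N) ∘ₗ
    (TensorProduct.assoc k M M (N ⊗[k] N)).symm.toLinearMap ∘ₗ
    ((TensorProduct.assoc k M N N).toLinearMap ∘ₗ τ.rTensor N ∘ₗ
      (TensorProduct.assoc k N M N).symm.toLinearMap).lTensor M ∘ₗ
    (TensorProduct.assoc k M N (M ⊗[k] N)).toLinearMap

theorem twistedMul_tmul (τ : N ⊗[k] M →ₗ[k] M ⊗[k] N) (m m' : M) (n n' : N) :
    twistedMul τ ((m ⊗ₜ n) ⊗ₜ (m' ⊗ₜ n')) =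
      sw (τ (n ⊗ₜ m')) fun x y => (m * x) ⊗ₜ[k] (y * n') := by
  simp only [twistedMul, LinearMap.comp_apply, LinearEquiv.coe_coe, TensorProduct.assoc_tmul,
    LinearMap.lTensor_tmul, TensorProduct.assoc_symm_tmul, LinearMap.rTensor_tmul]
  conv_lhs => rw [← sw_tmul_eq (τ (n ⊗ₜ m'))]
  simp only [sw_tmul, tmul_sw, map_sw, TensorProduct.assoc_tmul, TensorProduct.assoc_symm_tmul,
    TensorProduct.map_tmul, LinearMap.mul'_apply]

/-- A twisted tensor product is associative and unital if the exchange map is compatible with the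
products and units of both factors. -/
theorem twistedMul_isUnitalAssoc (τ : N ⊗[k] M →ₗ[k] M ⊗[k] N)
    (hM : ∀ n m m', τ (n ⊗ₜ (m * m')) = sw (τ (n ⊗ₜ m)) fun x y =>
      sw (τ (y ⊗ₜ m')) fun u v => (x * u) ⊗ₜ[k] v)
    (hN : ∀ n n' m, τ ((n * n') ⊗ₜ m) = sw (τ (n' ⊗ₜ m)) fun x y =>
      sw (τ (n ⊗ₜ x)) fun u v => u ⊗ₜ[k] (v * y))
    (h1M : ∀ m, τ (1 ⊗ₜ m) = m ⊗ₜ 1) (h1N : ∀ n, τ (n ⊗ₜ 1) = 1 ⊗ₜ n) :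
    IsUnitalAssoc (twistedMul τ) ((1 : M) ⊗ₜ (1 : N)) where
  mul_assoc a b c := by
    revert a
    refine eq_of_eq_tmul (k := k) (by fun_prop) (by fun_prop) fun m n => ?_
    revert b
    refine eq_of_eq_tmul (k := k) (by fun_prop) (by fun_prop) fun m' n' => ?_
    revert c
    refine eq_of_eq_tmul (k := k) (by fun_prop) (by fun_prop) fun m'' n'' => ?_
    -- Both bracketings become ∑ m x u ⊗ v q n'', where x ⊗ y runs over τ(n ⊗ m'), p ⊗ q over τ(n' ⊗
    -- m'') and u ⊗ v over τ(y ⊗ p). Only the order of the first two sums differs.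
    simp only [twistedMul_tmul, map_sw, sw_tmul, tmul_sw, hM, hN]
    simp (disch := fun_prop) only [sw_sw, sw_pure, mul_assoc]
    rw [sw_comm]
  one_mul a := by
    revert a
    refine eq_of_eq_tmul (k := k) (by fun_prop) (by fun_prop) fun m n => ?_
    rw [twistedMul_tmul, h1M]
    simp (disch := fun_prop) only [sw_pure, one_mul]
  mul_one a := by
    revert a
    refine eq_of_eq_tmul (k := k) (by fun_prop) (by fun_prop) fun m n => ?_
    rw [twistedMul_tmul, h1N]
    simp (disch := fun_prop) only [sw_pure, mul_one]

end Twisted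


/-! ### The exchange map of the quantum double and associativity. -/

section Double

open Coalgebra HopfAlgebra TensorProduct

variable {k : Type*} [Field k] {A B : Type*} [Ring A] [HopfAlgebra k A] [Ring B] [HopfAlgebra k B]
  (φ : A →ₗ[k] B →ₗ[k] k)

theorem exchange_tmul (a : A) (b : B) :
    exchange (HopfOps.of k A) (HopfOps.of k B) φ (b ⊗ₜ a) =
      sw (comul (R := k) a) fun a₁ s => sw (comul (R := k) s) fun a₂ a₃ =>
      sw (comul (R := k) b) fun b₁ t => sw (comul (R := k) t) fun b₂ b₃ =>
        (φ a₁ (antipode k b₁) * φ a₃ b₃) • (a₂ ⊗ₜ[k] b₂) := by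
  simp only [exchange, tensorComul, HopfOps.of, pairingInv, LinearMap.comp_apply,
    LinearEquiv.coe_coe, TensorProduct.comm_tmul, TensorProduct.map_tmul]
  conv_lhs => rw [← sw_tmul_eq (comul a), ← sw_tmul_eq (comul b)]
  simp only [sw_tmul, tmul_sw, map_sw, TensorProduct.tensorTensorTensorComm_tmul,
    TensorProduct.map_tmul, LinearMap.comp_apply]
  rw [sw_comm]
  congr! 3 with a₁ s 
  conv_rhs => rw [sw_comm]
  congr! 3 with b₁ t
  conv_lhs => rw [← sw_tmul_eq (comul s), ← sw_tmul_eq (comul t)]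
  simp only [sw_tmul, tmul_sw, map_sw, TensorProduct.tensorTensorTensorComm_tmul, LinearEquiv.coe_coe,
    LinearMap.lTensor_tmul, TensorProduct.lift.tmul,
    TensorProduct.lid_tmul, TensorProduct.rid_tmul, mul_smul]
  rw [sw_comm]

variable {φ} (hφ : IsHopfPairing (HopfOps.of k A) (HopfOps.of k B) φ)
include hφ

theorem pairing_mul_right (a : A) (b b' : B) :
    φ a (b * b') = sw (comul (R := k) a) fun a₁ a₂ => φ a₁ b * φ a₂ b' := by
  have := hφ.right_mul a b b'
  simp only [HopfOps.of, LinearMap.mul'_apply] at this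
  rw [this, map_eq_sw (TensorProduct.map _ _)]
  simp [map_sw]

theorem pairing_mul_left (a a' : A) (b : B) :
    φ (a * a') b = sw (comul (R := k) b) fun b₁ b₂ => φ a b₂ * φ a' b₁ := by
  have := hφ.left_mul a a' b
  simp only [HopfOps.of, LinearMap.mul'_apply] at this
  rw [this, map_eq_sw (TensorProduct.map _ _)]
  simp [map_sw, mul_comm]

theorem pairing_one_right (a : A) : φ a 1 = counit (R := k) a := hφ.right_one a

theorem pairing_one_left (b : B) : φ 1 b = counit (R := k) b := hφ.left_one b

/-- The pairing reverses the coproduct of `b`, and so does the antipode. The two reversals cancel.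
-/
theorem pairing_mul_left_antipode (a a' : A) (b : B) :
    φ (a * a') (antipode k b) = sw (comul (R := k) b) fun b₁ b₂ =>
      φ a (antipode k b₁) * φ a' (antipode k b₂) := by
  rw [pairing_mul_left hφ, sw_comul_antipode b _ (by fun_prop) (by fun_prop)]

/-- Both sides run over five legs of `a`: `b'` is paired with the outer two and `b` with the next
two. On the left this nesting comes from S(b b') = S(b') S(b). -/
theorem exchange_mul_right (a : A) (b b' : B) :
    exchange (HopfOps.of k A) (HopfOps.of k B) φ ((b * b') ⊗ₜ a) =
      sw (exchange (HopfOps.of k A) (HopfOps.of k B) φ (b' ⊗ₜ a)) fun x y =>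
        sw (exchange (HopfOps.of k A) (HopfOps.of k B) φ (b ⊗ₜ x)) fun u v =>
          u ⊗ₜ[k] (v * y) := by
  -- Restricted to these types, exchanging two sums is an oriented rule: sums over `A` move outwards
  -- and `simp` cannot loop.
  have hc := fun (t : B ⊗[k] B) (u : A ⊗[k] A) (f : B → B → A → A → A ⊗[k] B) => sw_comm t u f
  simp only [exchange_tmul]
  simp (disch := fun_prop) only [sw_sw, sw_comul_mul, pairing_mul_right hφ,
    antipode_mul_antidistrib, sw_smul, smul_sw, mul_sw, sw_mul, sw_pure, smul_tensor_sw, smul_smul]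
  simp (disch := fun_prop) only [hc, sw_coassoc, sw_coassoc_across]
  refine sw_congr _ fun a₁ _ => sw_congr _ fun a₂ _ => sw_congr _ fun a₃ _ => sw_congr _ fun a₄ a₅ => ?_
  rw [sw_comm (comul b)]
  refine sw_congr _ fun b'₁ t' => ?_
  simp only [sw_comm _ (comul t')]
  refine sw_congr _ fun b'₂ b'₃ => sw_congr _ fun b₁ _ => sw_congr _ fun b₂ b₃ => ?_
  congr 1
  ring

/-- Here five legs of `b` nest: `a` takes the outer pair and `a'` the inner one. The order reversal
in the first variable of the pairing produces this nesting at the right end, and `S` restores the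
order at the left end. -/
theorem exchange_mul_left (a a' : A) (b : B) :
    exchange (HopfOps.of k A) (HopfOps.of k B) φ (b ⊗ₜ (a * a')) =
      sw (exchange (HopfOps.of k A) (HopfOps.of k B) φ (b ⊗ₜ a)) fun x y =>
        sw (exchange (HopfOps.of k A) (HopfOps.of k B) φ (y ⊗ₜ a')) fun u v =>
          (x * u) ⊗ₜ[k] v := by
  have hc := fun (t : A ⊗[k] A) (u : B ⊗[k] B) (f : A → A → B → B → A ⊗[k] B) => sw_comm t u f
  simp only [exchange_tmul]
  simp (disch := fun_prop) only [sw_sw, sw_comul_mul, pairing_mul_left hφ,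
    sw_smul, smul_sw, mul_sw, sw_mul, sw_pure, smul_tensor_sw, smul_smul]
  simp (disch := fun_prop) only [hc, sw_comul_antipode, sw_coassoc, sw_coassoc_across]
  refine sw_congr _ fun b₁ _ => sw_congr _ fun b₂ _ => sw_congr _ fun b₃ _ => sw_congr _ fun b₄ b₅ => ?_
  simp only [sw_comm (comul a')]
  refine sw_congr _ fun a₁ _ => sw_congr _ fun a₂ a₃ => sw_congr _ fun a'₁ _ => sw_congr _ fun a'₂ a'₃ => ?_
  congr 1
  ring

theorem exchange_one_left (a : A) :
    exchange (HopfOps.of k A) (HopfOps.of k B) φ (1 ⊗ₜ a) = a ⊗ₜ 1 := by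
  simp only [exchange_tmul]
  simp (disch := fun_prop) only [sw_comul_one, antipode_one, pairing_one_right hφ, mul_smul,
    sw_counit_right, sw_counit_left, ← smul_sw]

theorem exchange_one_right (b : B) :
    exchange (HopfOps.of k A) (HopfOps.of k B) φ (b ⊗ₜ 1) = 1 ⊗ₜ b := by
  simp only [exchange_tmul]
  simp (disch := fun_prop) only [sw_comul_one, pairing_one_left hφ, counit_antipode, mul_smul,
    sw_counit_right, sw_counit_left, ← smul_sw]

theorem double_isUnitalAssoc : IsUnitalAssoc
    (double (HopfOps.of k A) (HopfOps.of k B) φ).mul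
    (double (HopfOps.of k A) (HopfOps.of k B) φ).one :=
  twistedMul_isUnitalAssoc (exchange (HopfOps.of k A) (HopfOps.of k B) φ)
    (fun _ _ _ => exchange_mul_left hφ _ _ _) (fun _ _ _ => exchange_mul_right hφ _ _ _)
    (exchange_one_left hφ) (exchange_one_right hφ)

end Double

/-! ### The Hopf algebra structure of the quantum double. -/

section DoubleHopf

open Coalgebra HopfAlgebra TensorProduct

variable {k : Type*} [Field k] {A B : Type*} [Ring A] [HopfAlgebra k A] [Ring B] [HopfAlgebra k B]
  (φ : A →ₗ[k] B →ₗ[k] k)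

/-- The coalgebra of the double is the tensor product coalgebra instance, so its coalgebra axioms
need no proof. -/
theorem tensorComul_of : tensorComul (HopfOps.of k A) (HopfOps.of k B) =
    (comul : A ⊗[k] B →ₗ[k] _) := rfl

theorem double_counit_of : (double (HopfOps.of k A) (HopfOps.of k B) φ).counit =
    (counit : A ⊗[k] B →ₗ[k] _) := by
  ext a b
  simp [double, HopfOps.of, mul_comm]

/-- The exchange map conjugates by the pairing: `c ↦ ∑ ψ(c₁) φ(c₃) c₂`, with `ψ` the inverse
of `φ`. -/
theorem exchange_comm (c : A ⊗[k] B) :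
    exchange (HopfOps.of k A) (HopfOps.of k B) φ (TensorProduct.comm k A B c) =
      sw (comul (R := k) c) fun c₁ s => sw (comul (R := k) s) fun c₂ c₃ =>
        (pairingInv (HopfOps.of k B) φ c₁ * TensorProduct.lift φ c₃) • c₂ := by
  simp only [exchange, tensorComul_of, LinearMap.comp_apply, LinearEquiv.coe_coe,
    comm_comm]
  rw [map_eq_sw (TensorProduct.map _ _) (comul c), map_sw]
  refine sw_congr _ fun c₁ s => ?_
  simp only [TensorProduct.map_tmul, LinearMap.comp_apply, TensorProduct.lid_tmul]
  rw [map_eq_sw (LinearMap.lTensor _ _) (comul s), map_sw, smul_sw]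
  refine sw_congr _ fun c₂ c₃ => ?_
  simp [mul_smul]

variable {φ} (hφ : IsHopfPairing (HopfOps.of k A) (HopfOps.of k B) φ)

theorem sw_comul_tmul {P : Type*} [AddCommGroup P] [Module k P] (a : A) (b : B)
    (f : A ⊗[k] B → A ⊗[k] B → P)
    (h₁ : ∀ y, IsLinearMap k fun x => f x y) (h₂ : ∀ x, IsLinearMap k fun y => f x y) :
    sw (comul (R := k) (a ⊗ₜ[k] b)) f = sw (comul (R := k) a) fun a₁ a₂ =>
      sw (comul (R := k) b) fun b₁ b₂ => f (a₁ ⊗ₜ b₁) (a₂ ⊗ₜ b₂) := by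
  rw [TensorProduct.comul_tmul]
  conv_lhs => rw [← sw_tmul_eq (comul a), ← sw_tmul_eq (comul b)]
  simp only [sw_tmul, tmul_sw, map_sw, AlgebraTensorModule.tensorTensorTensorComm_tmul]
  rw [sw_comm]
  simp (disch := fun_prop) only [sw_sw, sw_pure]

include hφ

/-- ∑ φ(a₁, b₁) φ(a₂, S(b₂)) = ∑ φ(a, b₁ S(b₂)), and the antipode axiom of `B` collapses the right
side. -/
theorem pairing_mul_pairingInv (c : A ⊗[k] B) : (sw (comul (R := k) c) fun x y =>
    TensorProduct.lift φ x * pairingInv (HopfOps.of k B) φ y) = counit (R := k) c := by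
  revert c
  refine eq_of_eq_tmul (k := k) (by fun_prop) (by fun_prop) fun a b => ?_
  rw [sw_comul_tmul _ _ _ (by fun_prop) (by fun_prop), sw_comm]
  simp only [pairingInv, HopfOps.of, LinearMap.comp_apply, LinearMap.lTensor_tmul,
    TensorProduct.lift.tmul, ← pairing_mul_right hφ]
  rw [sw_antipode_right _ (fun z => φ a z) (by fun_prop), pairing_one_right hφ]
  simp

theorem sw_pairing_mul_pairingInv {P : Type*} [AddCommGroup P] [Module k P] (c : A ⊗[k] B)
    (f : A ⊗[k] B → P) (hf : IsLinearMap k f) :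
    (sw (comul (R := k) c) fun x s => sw (comul (R := k) s) fun y t =>
      (TensorProduct.lift φ x * pairingInv (HopfOps.of k B) φ y) • f t) = f c := by
  rw [← sw_coassoc c (fun x y t => (TensorProduct.lift φ x * pairingInv (HopfOps.of k B) φ y) • f t)
    (by fun_prop) (by fun_prop) (by fun_prop)]
  simp only [← sw_smul, pairing_mul_pairingInv hφ]
  exact sw_counit_left c f hf

theorem pairingInv_mul_pairing (c : A ⊗[k] B) : (sw (comul (R := k) c) fun x y =>
    pairingInv (HopfOps.of k B) φ x * TensorProduct.lift φ y) = counit (R := k) c := by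
  revert c
  refine eq_of_eq_tmul (k := k) (by fun_prop) (by fun_prop) fun a b => ?_
  rw [sw_comul_tmul _ _ _ (by fun_prop) (by fun_prop), sw_comm]
  simp only [pairingInv, HopfOps.of, LinearMap.comp_apply, LinearMap.lTensor_tmul,
    TensorProduct.lift.tmul, ← pairing_mul_right hφ]
  rw [sw_antipode_left _ (fun z => φ a z) (by fun_prop), pairing_one_right hφ]
  simp

theorem sw_pairingInv_mul_pairing {P : Type*} [AddCommGroup P] [Module k P] (c : A ⊗[k] B)
    (f : A ⊗[k] B → P) (hf : IsLinearMap k f) :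
    (sw (comul (R := k) c) fun x s => sw (comul (R := k) s) fun y t =>
      (pairingInv (HopfOps.of k B) φ x * TensorProduct.lift φ y) • f t) = f c := by
  rw [← sw_coassoc c (fun x y t => (pairingInv (HopfOps.of k B) φ x * TensorProduct.lift φ y) • f t)
    (by fun_prop) (by fun_prop) (by fun_prop)]
  simp only [← sw_smul, pairingInv_mul_pairing hφ]
  exact sw_counit_left c f hf

/-- Conjugation by a convolution-invertible functional is comultiplicative: between the two halves
of the middle leg, insert ε as the product of φ and its inverse ψ. -/
theorem comul_exchange_comm (c : A ⊗[k] B) :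
    comul (R := k) (exchange (HopfOps.of k A) (HopfOps.of k B) φ (TensorProduct.comm k A B c)) =
      sw (comul (R := k) c) fun x y =>
        exchange (HopfOps.of k A) (HopfOps.of k B) φ (TensorProduct.comm k A B x) ⊗ₜ[k]
          exchange (HopfOps.of k A) (HopfOps.of k B) φ (TensorProduct.comm k A B y) := by
  simp only [exchange_comm, map_sw, map_smul, sw_tmul]
  simp only [tmul_sw, ← smul_tmul', tmul_smul, smul_smul]
  trans sw (comul (R := k) c) fun x y => sw (comul (R := k) y) fun u v => 
    (pairingInv (HopfOps.of k B) φ x * TensorProduct.lift φ v) • sw (comul (R := k) u) fun p q =>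
      p ⊗ₜ[k] q
  · simp only [sw_tmul_eq]
  simp only [smul_sw]
  simp (disch := fun_prop) only [sw_coassoc]
  refine sw_congr _ fun x y => sw_congr _ fun x' w => ?_
  -- The inserted factor φψ closes the first conjugate and opens the second.
  rw [← sw_pairing_mul_pairingInv hφ w (fun t => sw (comul (R := k) t) fun u v =>
    (pairingInv (HopfOps.of k B) φ x * TensorProduct.lift φ v) • x' ⊗ₜ[k] u) (by fun_prop)]
  simp only [smul_sw, smul_smul]
  refine sw_congr _ fun _ _ => sw_congr _ fun _ _ => sw_congr _ fun _ _ => ?_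
  congr 1
  ring

theorem counit_exchange_comm (c : A ⊗[k] B) :
    counit (R := k) (exchange (HopfOps.of k A) (HopfOps.of k B) φ (TensorProduct.comm k A B c)) =
      counit (R := k) c := by
  simp only [exchange_comm, map_sw, map_smul, smul_eq_mul]
  rw [← sw_pairingInv_mul_pairing hφ c counit (by fun_prop)]
  refine sw_congr _ fun x y => ?_
  trans (pairingInv (HopfOps.of k B) φ x * TensorProduct.lift φ y)
  · rw [← sw_counit_left y (fun z => pairingInv (HopfOps.of k B) φ x * TensorProduct.lift φ z)
      (by fun_prop)]
    refine sw_congr _ fun _ _ => ?_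
    rw [smul_eq_mul, mul_comm]
  · rw [← sw_counit_right y (fun z => pairingInv (HopfOps.of k B) φ x * TensorProduct.lift φ z)
      (by fun_prop)]
    refine sw_congr _ fun _ _ => ?_
    simp only [smul_eq_mul]
    ring

omit hφ in
-- The products on the right are the componentwise ones of the algebra instance on A ⊗ B. This
-- reduces comultiplicativity of the twisted product to that of the ordinary tensor product
-- bialgebra and of the exchange map.
theorem doubleMul_of_tmul (a a' : A) (b b' : B) :
    doubleMul (HopfOps.of k A) (HopfOps.of k B) φ ((a ⊗ₜ b) ⊗ₜ (a' ⊗ₜ b')) =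
      (a ⊗ₜ 1) * exchange (HopfOps.of k A) (HopfOps.of k B) φ (b ⊗ₜ a') * (1 ⊗ₜ b') := by
  refine (twistedMul_tmul (exchange (HopfOps.of k A) (HopfOps.of k B) φ) a a' b b').trans ?_
  conv_rhs => rw [← sw_tmul_eq (exchange (HopfOps.of k A) (HopfOps.of k B) φ (b ⊗ₜ a'))]
  simp only [mul_sw, sw_mul, Algebra.TensorProduct.tmul_mul_tmul, mul_one, one_mul]

theorem double_mul_left (a a' : A) (b : B) :
    (double (HopfOps.of k A) (HopfOps.of k B) φ).mul ((a ⊗ₜ 1) ⊗ₜ (a' ⊗ₜ b)) = (a * a') ⊗ₜ b := by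
  rw [double, doubleMul_of_tmul, exchange_one_left hφ]
  simp

theorem double_mul_right (a : A) (b b' : B) :
    (double (HopfOps.of k A) (HopfOps.of k B) φ).mul ((a ⊗ₜ b) ⊗ₜ (1 ⊗ₜ b')) = a ⊗ₜ (b * b') := by
  rw [double, doubleMul_of_tmul, exchange_one_right hφ]
  simp

theorem double_comul_mul (x y : A ⊗[k] B) :
    comul (R := k) (doubleMul (HopfOps.of k A) (HopfOps.of k B) φ (x ⊗ₜ y)) =
    TensorProduct.map (doubleMul (HopfOps.of k A) (HopfOps.of k B) φ)
      (doubleMul (HopfOps.of k A) (HopfOps.of k B) φ)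
      (TensorProduct.tensorTensorTensorComm k _ _ _ _ (comul (R := k) x ⊗ₜ comul (R := k) y)) := by
  revert x
  refine eq_of_eq_tmul (k := k) (by fun_prop) (by fun_prop) fun a b => ?_
  revert y
  refine eq_of_eq_tmul (k := k) (by fun_prop) (by fun_prop) fun a' b' => ?_
  have e : (b ⊗ₜ[k] a') = TensorProduct.comm k A B (a' ⊗ₜ[k] b) := rfl
  rw [doubleMul_of_tmul, Bialgebra.comul_mul, Bialgebra.comul_mul, e, comul_exchange_comm hφ]
  rw [sw_comul_tmul _ _ _ (by fun_prop) (by fun_prop)]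
  conv_rhs => rw [← sw_tmul_eq (comul (a ⊗ₜ[k] b)), ← sw_tmul_eq (comul (a' ⊗ₜ[k] b'))]
  simp (disch := fun_prop) only [sw_comul_tmul]
  conv_lhs => rw [← sw_tmul_eq (comul (a ⊗ₜ[k] (1 : B))), ← sw_tmul_eq (comul ((1 : A) ⊗ₜ[k] b'))]
  simp (disch := fun_prop) only [sw_comul_tmul, sw_comul_one]
  simp only [sw_tmul, tmul_sw, map_sw, mul_sw, sw_mul, TensorProduct.tensorTensorTensorComm_tmul,
    TensorProduct.map_tmul, doubleMul_of_tmul, Algebra.TensorProduct.tmul_mul_tmul,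
    TensorProduct.comm_tmul]
  simp only [sw_comm (comul b) (comul a)]
  rw [sw_comm (comul b')]

theorem double_counit_mul (x y : A ⊗[k] B) :
    counit (R := k) (doubleMul (HopfOps.of k A) (HopfOps.of k B) φ (x ⊗ₜ y)) =
      counit (R := k) x * counit (R := k) y := by
  revert x
  refine eq_of_eq_tmul (k := k) (by fun_prop) (by fun_prop) fun a b => ?_
  revert y
  refine eq_of_eq_tmul (k := k) (by fun_prop) (by fun_prop) fun a' b' => ?_
  have e : (b ⊗ₜ[k] a') = TensorProduct.comm k A B (a' ⊗ₜ[k] b) := rfl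
  rw [doubleMul_of_tmul, Bialgebra.counit_mul, Bialgebra.counit_mul, e, counit_exchange_comm hφ]
  simp only [TensorProduct.counit_tmul, Bialgebra.counit_one, smul_eq_mul]
  ring

omit hφ in
theorem double_antipode_tmul (a : A) (b : B) :
    (double (HopfOps.of k A) (HopfOps.of k B) φ).antipode (a ⊗ₜ b) =
      (double (HopfOps.of k A) (HopfOps.of k B) φ).mul
        ((1 ⊗ₜ antipode k b) ⊗ₜ (antipode k a ⊗ₜ 1)) := rfl

/-- The quantum double is a Hopf algebra. -/
theorem double_of_isHopf : (double (HopfOps.of k A) (HopfOps.of k B) φ).IsHopf where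
  algebra := double_isUnitalAssoc hφ
  coassoc := coassoc_apply (R := k) (A := A ⊗[k] B)
  counit_comul c := by
    rw [double_counit_of]
    exact congrArg (TensorProduct.lid k _) (rTensor_counit_comul (R := k) c) |>.trans (by simp)
  comul_counit c := by
    rw [double_counit_of]
    exact congrArg (TensorProduct.rid k _) (lTensor_counit_comul (R := k) c) |>.trans (by simp)
  comul_one := Bialgebra.comul_one (R := k) (A := A ⊗[k] B)
  comul_mul := double_comul_mul hφ
  counit_one := by
    rw [double_counit_of]
    exact Bialgebra.counit_one (R := k) (A := A ⊗[k] B)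
  counit_mul x y := by
    rw [double_counit_of]
    exact double_counit_mul hφ x y
  antipode_left := by
    have assoc := (double_isUnitalAssoc hφ).mul_assoc
    refine eq_of_eq_tmul (k := k) (by fun_prop) (by fun_prop) fun a b => ?_
    rw [show (double (HopfOps.of k A) (HopfOps.of k B) φ).comul = comul from rfl]
    rw [map_eq_sw (LinearMap.rTensor (A ⊗[k] B) _) (comul (R := k) _), map_sw,
      sw_comul_tmul _ _ _ (by fun_prop) (by fun_prop)]
    -- S(a₁ ⊗ b₁)(a₂ ⊗ b₂) = (1 ⊗ S(b₁))(S(a₁) a₂ ⊗ b₂), so the sum over `a` collapses first and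
    -- that over `b` afterwards.
    simp only [LinearMap.rTensor_tmul, double_antipode_tmul, assoc, double_mul_left hφ]
    rw [sw_comm]
    trans sw (comul (R := k) b) fun b₁ b₂ => counit (R := k) a • (1 ⊗ₜ (antipode k b₁ * b₂))
    · refine sw_congr _ fun b₁ b₂ => ?_
      rw [sw_antipode_left a (fun z => (double (HopfOps.of k A) (HopfOps.of k B) φ).mul
        ((1 ⊗ₜ antipode k b₁) ⊗ₜ (z ⊗ₜ b₂))) (by fun_prop), double_mul_right hφ]
    · rw [sw_antipode_left b (fun z => counit (R := k) a • (1 ⊗ₜ[k] z)) (by fun_prop), smul_smul,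
        double_counit_of, TensorProduct.counit_tmul]
      rfl
  antipode_right := by
    have assoc := (double_isUnitalAssoc hφ).mul_assoc
    refine eq_of_eq_tmul (k := k) (by fun_prop) (by fun_prop) fun a b => ?_
    rw [show (double (HopfOps.of k A) (HopfOps.of k B) φ).comul = comul from rfl]
    rw [map_eq_sw (LinearMap.lTensor (A ⊗[k] B) _) (comul (R := k) _), map_sw,
      sw_comul_tmul _ _ _ (by fun_prop) (by fun_prop)]
    -- On this side the factors of `B` are adjacent, so `b` collapses before `a`.
    simp only [LinearMap.lTensor_tmul, double_antipode_tmul, ← assoc, double_mul_right hφ]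
    trans sw (comul (R := k) a) fun a₁ a₂ => counit (R := k) b • ((a₁ * antipode k a₂) ⊗ₜ 1)
    · refine sw_congr _ fun a₁ a₂ => ?_
      rw [sw_antipode_right b (fun z => (double (HopfOps.of k A) (HopfOps.of k B) φ).mul
        ((a₁ ⊗ₜ z) ⊗ₜ (antipode k a₂ ⊗ₜ 1))) (by fun_prop), double_mul_left hφ]
    · rw [sw_antipode_right a (fun z => counit (R := k) b • (z ⊗ₜ[k] 1)) (by fun_prop), smul_smul,
        double_counit_of, TensorProduct.counit_tmul, mul_comm]
      rfl

end DoubleHopf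

/-! ### Yetter-Drinfeld structure maps on pure tensors. -/

section YetterDrinfeldFormulas

open TensorProduct

variable {k A M N : Type*} [Field k] [AddCommGroup A] [Module k A]
  [AddCommGroup M] [Module k M] [AddCommGroup N] [Module k N]

theorem ydLeft_tmul (O : HopfOps k A) (Y : YDOps k A M) (h : A) (m : M) :
    ydLeft O Y (h ⊗ₜ m) = sw (O.comul h) fun h₁ h₂ => sw (Y.coact m) fun u n =>
      O.mul (h₁ ⊗ₜ u) ⊗ₜ[k] Y.act (h₂ ⊗ₜ n) := by
  simp only [ydLeft, LinearMap.comp_apply, TensorProduct.map_tmul, LinearEquiv.coe_coe]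
  conv_lhs => rw [← sw_tmul_eq (O.comul h), ← sw_tmul_eq (Y.coact m)]
  simp only [sw_tmul, map_sw]
  simp only [tmul_sw, map_sw, tensorTensorTensorComm_tmul, TensorProduct.map_tmul]

theorem ydRight_tmul (O : HopfOps k A) (Y : YDOps k A M) (h : A) (m : M) :
    ydRight O Y (h ⊗ₜ m) = sw (O.comul h) fun h₁ h₂ => sw (Y.coact (Y.act (h₁ ⊗ₜ m))) fun u n =>
      O.mul (u ⊗ₜ h₂) ⊗ₜ[k] n := by
  simp only [ydRight, LinearMap.comp_apply, LinearMap.rTensor_tmul, LinearEquiv.coe_coe]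
  conv_lhs => rw [← sw_tmul_eq (O.comul h)]
  simp only [sw_tmul, map_sw, rightComm_tmul, LinearMap.rTensor_tmul]
  refine sw_congr _ fun h₁ h₂ => ?_
  conv_lhs => rw [← sw_tmul_eq (Y.coact _)]
  simp only [sw_tmul, map_sw, rightComm_tmul, LinearMap.rTensor_tmul]

theorem tensor_act_tmul (O : HopfOps k A) (Y : YDOps k A M) (Z : YDOps k A N) (h : A) (m : M)
    (n : N) : (Y.tensor O Z).act (h ⊗ₜ (m ⊗ₜ n)) =
      sw (O.comul h) fun h₁ h₂ => Y.act (h₁ ⊗ₜ m) ⊗ₜ[k] Z.act (h₂ ⊗ₜ n) := by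
  simp only [YDOps.tensor, LinearMap.comp_apply, LinearMap.rTensor_tmul, LinearEquiv.coe_coe]
  conv_lhs => rw [← sw_tmul_eq (O.comul h)]
  simp only [sw_tmul, map_sw, tensorTensorTensorComm_tmul, TensorProduct.map_tmul]

theorem tensor_coact_tmul (O : HopfOps k A) (Y : YDOps k A M) (Z : YDOps k A N) (m : M) (n : N) :
    (Y.tensor O Z).coact (m ⊗ₜ n) = sw (Y.coact m) fun u m₀ => sw (Z.coact n) fun v n₀ =>
      O.mul (u ⊗ₜ v) ⊗ₜ[k] (m₀ ⊗ₜ[k] n₀) := by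
  simp only [YDOps.tensor, LinearMap.comp_apply, TensorProduct.map_tmul, LinearEquiv.coe_coe]
  conv_lhs => rw [← sw_tmul_eq (Y.coact m), ← sw_tmul_eq (Z.coact n)]
  simp only [sw_tmul, map_sw]
  simp only [tmul_sw, map_sw, tensorTensorTensorComm_tmul, LinearMap.rTensor_tmul]

theorem braiding_tmul (Y : YDOps k A M) (Z : YDOps k A N) (m : M) (n : N) :
    braiding Y Z (m ⊗ₜ n) = sw (Y.coact m) fun u m₀ => Z.act (u ⊗ₜ n) ⊗ₜ[k] m₀ := by
  simp only [braiding, LinearMap.comp_apply, LinearMap.rTensor_tmul, LinearEquiv.coe_coe]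
  conv_lhs => rw [← sw_tmul_eq (Y.coact m)]
  simp only [sw_tmul, map_sw, rightComm_tmul, LinearMap.rTensor_tmul]

end YetterDrinfeldFormulas

/-! ### The adjoint action of a Hopf algebra. -/

section Adjoint

open Coalgebra HopfAlgebra TensorProduct

variable {k : Type*} [Field k] {A : Type*} [Ring A] [HopfAlgebra k A]

theorem adjoint_tmul (a x : A) : (HopfOps.of k A).adjoint (a ⊗ₜ x) =
    sw (comul (R := k) a) fun a₁ a₂ => a₁ * x * antipode k a₂ := by
  simp only [HopfOps.adjoint, HopfOps.of, LinearMap.comp_apply, LinearMap.rTensor_tmul,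
    LinearEquiv.coe_coe]
  conv_lhs => rw [← sw_tmul_eq (comul a)]
  simp only [sw_tmul, map_sw, rightComm_tmul, TensorProduct.map_tmul, LinearMap.mul'_apply]

theorem adjoint_one (x : A) : (HopfOps.of k A).adjoint (1 ⊗ₜ x) = x := by
  rw [adjoint_tmul, sw_comul_one _ (by fun_prop) (by fun_prop)]
  simp

theorem adjoint_mul (a a' x : A) : (HopfOps.of k A).adjoint ((a * a') ⊗ₜ x) =
    (HopfOps.of k A).adjoint (a ⊗ₜ (HopfOps.of k A).adjoint (a' ⊗ₜ x)) := by
  simp only [adjoint_tmul]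
  simp (disch := fun_prop) only [sw_comul_mul, antipode_mul_antidistrib, mul_sw, sw_mul, mul_assoc]

theorem adjoint_apply_one (a : A) : (HopfOps.of k A).adjoint (a ⊗ₜ 1) =
    counit (R := k) a • (1 : A) := by
  simp only [adjoint_tmul, mul_one]
  exact sw_antipode_right a (fun z => z) (by fun_prop)

/-- a₁ x y S(a₂) = a₁ x S(a₂) a₃ y S(a₄), since S(a₂) a₃ collapses to a counit. -/
theorem adjoint_apply_mul (a x y : A) : (HopfOps.of k A).adjoint (a ⊗ₜ (x * y)) =
    sw (comul (R := k) a) fun a₁ a₂ => (HopfOps.of k A).adjoint (a₁ ⊗ₜ x) *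
      (HopfOps.of k A).adjoint (a₂ ⊗ₜ y) := by
  simp only [adjoint_tmul, sw_mul]
  simp only [mul_sw]
  simp (disch := fun_prop) only [sw_coassoc]
  refine sw_congr _ fun a₁ t => ?_
  rw [← sw_counit_left (k := k) t (fun z => a₁ * (x * y) * antipode k z) (by fun_prop)]
  simp only [← sw_coassoc (k := k) t (fun u v w => a₁ * x * antipode k u * (v * y * antipode k w))
    (by fun_prop) (by fun_prop) (by fun_prop)]
  refine sw_congr _ fun u v => ?_
  have e := sw_antipode_left (k := k) u (fun z => a₁ * x * z * y * antipode k v) (by fun_prop)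
  simp only [mul_assoc, one_mul] at e ⊢
  exact e.symm

/-- The adjoint action and the coproduct satisfy the Yetter-Drinfeld compatibility. -/
theorem adjoint_compat {P : Type*} [AddCommGroup P] [Module k P] (a x : A) (f : A → A → P)
    (h₁ : ∀ y, IsLinearMap k fun x => f x y) (h₂ : ∀ x, IsLinearMap k fun y => f x y) :
    (sw (comul (R := k) a) fun a₁ a₂ =>
      sw (comul (R := k) ((HopfOps.of k A).adjoint (a₁ ⊗ₜ x))) fun u v => f (u * a₂) v) =
      sw (comul (R := k) a) fun a₁ a₂ => sw (comul (R := k) x) fun x₁ x₂ =>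
        f (a₁ * x₁) ((HopfOps.of k A).adjoint (a₂ ⊗ₜ x₂)) := by
  simp only [adjoint_tmul, map_sw]
  simp (disch := fun_prop) only [sw_sw, sw_comul_mul, sw_comul_antipode]
  have e (u : A) (t : A ⊗[k] A) (g : A → A → A) :
      f u (sw t g) = sw t fun x y => f u (g x y) := map_sw (h₂ u).mk' t g
  simp only [e, sw_comm (comul x), mul_assoc]
  simp (disch := fun_prop) only [sw_coassoc]
  refine sw_congr _ fun a₁ t => sw_congr _ fun a₂ s => ?_
  -- The first leg now ends in S(a₄) a₅. `G a₃ z` is the summand with that factor replaced by `z`,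
  -- so the antipode axiom applies to `G a₃`.
  let G (a₃ z : A) : P := sw (comul (R := k) x) fun x₁ x₂ =>
    f (a₁ * (x₁ * z)) (a₂ * (x₂ * antipode k a₃))
  trans G s 1
  · rw [← sw_counit_right (k := k) s (fun z => G z 1) (by fun_prop)]
    exact sw_congr _ fun a₃ w => sw_antipode_left (k := k) w (G a₃) (by fun_prop)
  · simp only [G, mul_one]
end Adjoint

/-! ### The two Schrödinger actions of the double. -/

section Schroedinger
open Coalgebra HopfAlgebra TensorProduct

variable {k : Type*} [Field k] {A B : Type*} [Ring A] [HopfAlgebra k A] [Ring B] [HopfAlgebra k B]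
  (φ : A →ₗ[k] B →ₗ[k] k)

theorem contractPlus_tmul (b : B) (x : A) :
    contractPlus (HopfOps.of k A) (HopfOps.of k B) φ (b ⊗ₜ x) =
      sw (comul (R := k) x) fun x₁ x₂ => φ x₁ (antipode k b) • x₂ := by
  simp only [contractPlus, pairingInv, HopfOps.of, LinearMap.comp_apply, LinearMap.lTensor_tmul,
    LinearEquiv.coe_coe]
  conv_lhs => rw [← sw_tmul_eq (comul x)]
  simp only [tmul_sw, map_sw, TensorProduct.assoc_symm_tmul, LinearMap.rTensor_tmul, LinearMap.comp_apply,
    LinearEquiv.coe_coe, comm_tmul, LinearMap.lTensor_tmul, TensorProduct.lid_tmul, lift.tmul]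

theorem contractMinus_tmul (a : A) (y : B) :
    contractMinus (HopfOps.of k B) φ (a ⊗ₜ y) =
      sw (comul (R := k) y) fun y₁ y₂ => φ a y₁ • y₂ := by
  simp only [contractMinus, HopfOps.of, LinearMap.comp_apply, LinearMap.lTensor_tmul,
    LinearEquiv.coe_coe]
  conv_lhs => rw [← sw_tmul_eq (comul y)]
  simp only [tmul_sw, map_sw, TensorProduct.assoc_symm_tmul, LinearMap.rTensor_tmul,
    TensorProduct.lid_tmul, lift.tmul]

variable {φ} (hφ : IsHopfPairing (HopfOps.of k A) (HopfOps.of k B) φ)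
include hφ

/-- With ψ the form `pairingInv`, φ ∘ (S ⊗ S) is a left inverse of ψ, because ∑ φ(S(a₁), S(b₁))
φ(a₂, S(b₂)) = ∑ φ(S(a₁) a₂, S(b)), and φ is a right inverse. Hence they agree, without inverting an
antipode. -/
theorem pairing_antipode_antipode (a : A) (b : B) : φ (antipode k a) (antipode k b) = φ a b := by
  let g : A ⊗[k] B →ₗ[k] k := lift φ ∘ₗ TensorProduct.map (antipode k) (antipode k)
  have h (c : A ⊗[k] B) : (sw (comul (R := k) c) fun x y =>
      g x * pairingInv (HopfOps.of k B) φ y) = counit (R := k) c := by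
    revert c
    refine eq_of_eq_tmul (k := k) (by fun_prop) (by fun_prop) fun a b => ?_
    rw [sw_comul_tmul _ _ _ (by fun_prop) (by fun_prop)]
    simp only [g, pairingInv, HopfOps.of, LinearMap.comp_apply, LinearMap.lTensor_tmul,
      TensorProduct.map_tmul, TensorProduct.lift.tmul, ← pairing_mul_left_antipode hφ]
    rw [sw_antipode_left _ (fun z => φ z (antipode k b)) (by fun_prop), pairing_one_left hφ]
    simp [mul_comm]
  change g (a ⊗ₜ b) = lift φ (a ⊗ₜ b)
  generalize a ⊗ₜ[k] b = c
  rw [← sw_counit_left c (lift φ) (LinearMap.isLinear _),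
    ← sw_counit_right c g (LinearMap.isLinear _)]
  conv_lhs => simp only [← pairingInv_mul_pairing hφ, sw_smul]
  conv_rhs => simp only [← h, sw_smul]
  simp (disch := fun_prop) only [sw_coassoc]
  refine sw_congr _ fun _ _ => sw_congr _ fun _ _ => ?_
  simp only [smul_eq_mul]
  ring

theorem contractPlus_mul (b b' : B) (x : A) :
    contractPlus (HopfOps.of k A) (HopfOps.of k B) φ ((b * b') ⊗ₜ x) =
      contractPlus (HopfOps.of k A) (HopfOps.of k B) φ
        (b ⊗ₜ contractPlus (HopfOps.of k A) (HopfOps.of k B) φ (b' ⊗ₜ x)) := by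
  simp only [contractPlus_tmul, antipode_mul_antidistrib, pairing_mul_right hφ, map_sw, tmul_sw,
    tmul_smul, map_smul, sw_smul, smul_sw, smul_smul]
  simp (disch := fun_prop) only [sw_coassoc]

/-- The commutation rule that makes `A` a module over the double. The first leg of the coproduct of
a₁ x S(a₂) is a₁ x₁ S(a₄). Pairing it with S(b) gives φ(a₁, S(b₁)) φ(x₁, S(b₂)) φ(S(a₄), S(b₃)),
whose last factor is φ(a₄, b₃). -/
theorem contractPlus_adjoint (a x : A) (b : B) :
    contractPlus (HopfOps.of k A) (HopfOps.of k B) φ (b ⊗ₜ (HopfOps.of k A).adjoint (a ⊗ₜ x)) =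
      sw (exchange (HopfOps.of k A) (HopfOps.of k B) φ (b ⊗ₜ a)) fun p q =>
        (HopfOps.of k A).adjoint
          (p ⊗ₜ contractPlus (HopfOps.of k A) (HopfOps.of k B) φ (q ⊗ₜ x)) := by
  have hc := fun (t : A ⊗[k] A) (u : B ⊗[k] B) (f : A → A → B → B → A) => sw_comm t u f
  simp only [contractPlus_tmul, adjoint_tmul, map_sw, exchange_tmul]
  simp (disch := fun_prop) only [sw_sw, sw_comul_mul, sw_comul_antipode, smul_tensor_sw, sw_pure]
  simp only [pairing_mul_left_antipode hφ, pairing_antipode_antipode hφ,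
    sw_mul, mul_sw, sw_smul, smul_sw]
  simp (disch := fun_prop) only [hc, sw_coassoc]
  simp only [sw_comm (comul x), mul_smul_comm, smul_mul_assoc, smul_smul]
  refine sw_congr _ fun b₁ _ => sw_congr _ fun b₂ b₃ => sw_congr _ fun a₁ _ => sw_congr _ fun a₂ _ =>
    sw_congr _ fun a₃ a₄ => sw_congr _ fun x₁ x₂ => ?_
  congr 1
  ring

theorem contractMinus_mul (a a' : A) (y : B) :
    contractMinus (HopfOps.of k B) φ ((a * a') ⊗ₜ y) =
      contractMinus (HopfOps.of k B) φ (a ⊗ₜ contractMinus (HopfOps.of k B) φ (a' ⊗ₜ y)) := by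
  simp only [contractMinus_tmul, pairing_mul_left hφ, map_sw, tmul_sw,
    tmul_smul, map_smul, sw_smul, smul_sw, smul_smul]
  simp (disch := fun_prop) only [sw_coassoc]
  simp only [mul_comm]

/-- The three pairings on the right merge to φ(a, S(b₁)(b₂ • y)₁ b₃). By `adjoint_compat` the factor
(b₂ • y)₁ b₃ turns into b₂ y₁, and then S(b₁) b₂ cancels. -/
theorem adjoint_contractMinus (a : A) (b y : B) :
    (HopfOps.of k B).adjoint (b ⊗ₜ contractMinus (HopfOps.of k B) φ (a ⊗ₜ y)) =
      sw (exchange (HopfOps.of k A) (HopfOps.of k B) φ (b ⊗ₜ a)) fun p q =>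
        contractMinus (HopfOps.of k B) φ (p ⊗ₜ (HopfOps.of k B).adjoint (q ⊗ₜ y)) := by
  have hc := fun (t : A ⊗[k] A) (u : B ⊗[k] B) (f : A → A → B → B → B) => sw_comm t u f
  simp only [contractMinus_tmul, exchange_tmul]
  simp (disch := fun_prop) only [sw_sw, smul_tensor_sw, sw_pure]
  simp only [map_sw, tmul_sw, tmul_smul, map_smul, smul_sw, smul_smul, hc]
  have ea (u v w z : B) : (sw (comul (R := k) a) fun a₁ s => sw (comul (R := k) s) fun a₂ a₃ =>
      (φ a₁ u * φ a₃ w * φ a₂ v) • z) = φ a (u * (v * w)) • z := by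
    simp only [pairing_mul_right hφ, mul_sw, sw_smul]
    refine sw_congr _ fun _ _ => sw_congr _ fun _ _ => ?_
    congr 1
    ring
  simp only [ea]
  trans sw (comul (R := k) b) fun b₁ s => sw (comul (R := k) s) fun b₂ b₃ =>
    sw (comul (R := k) y) fun y₁ y₂ =>
      φ a (antipode k b₁ * (b₂ * y₁)) • (HopfOps.of k B).adjoint (b₃ ⊗ₜ y₂)
  · rw [← sw_coassoc (k := k) b (fun b₁ b₂ b₃ => sw (comul (R := k) y) fun y₁ y₂ =>
      φ a (antipode k b₁ * (b₂ * y₁)) • (HopfOps.of k B).adjoint (b₃ ⊗ₜ y₂))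
      (by fun_prop) (by fun_prop) (by fun_prop), ← sw_counit_left (k := k) b (fun z =>
      sw (comul (R := k) y) fun y₁ y₂ => φ a y₁ • (HopfOps.of k B).adjoint (z ⊗ₜ y₂)) (by fun_prop)]
    refine sw_congr _ fun u v => ?_
    have e := sw_antipode_left (k := k) u (fun z => sw (comul (R := k) y) fun y₁ y₂ =>
      φ a (z * y₁) • (HopfOps.of k B).adjoint (v ⊗ₜ y₂)) (by fun_prop)
    simp only [one_mul, mul_assoc] at e
    exact e.symm
  · exact sw_congr _ fun b₁ s => (adjoint_compat s y
      (fun u v => φ a (antipode k b₁ * u) • v) (by fun_prop) (by fun_prop)).symm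

variable (φ) in
omit hφ in
theorem schroedingerPlus_act_tmul (a : A) (b : B) (x : A) :
    (schroedingerPlus (HopfOps.of k A) (HopfOps.of k B) φ).act ((a ⊗ₜ b) ⊗ₜ x) =
      (HopfOps.of k A).adjoint
        (a ⊗ₜ contractPlus (HopfOps.of k A) (HopfOps.of k B) φ (b ⊗ₜ x)) := rfl

variable (φ) in
omit hφ in
theorem schroedingerMinus_act_tmul (a : A) (b : B) (y : B) :
    (schroedingerMinus (HopfOps.of k A) (HopfOps.of k B) φ).act ((a ⊗ₜ b) ⊗ₜ y) =
      contractMinus (HopfOps.of k B) φ (a ⊗ₜ (HopfOps.of k B).adjoint (b ⊗ₜ y)) := rfl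

variable (φ) in
omit hφ in
theorem schroedingerPlus_coact (x : A) :
    (schroedingerPlus (HopfOps.of k A) (HopfOps.of k B) φ).coact x =
      sw (comul (R := k) x) fun x₁ x₂ => (x₁ ⊗ₜ[k] (1 : B)) ⊗ₜ[k] x₂ := by
  change LinearMap.rTensor _ _ (comul (R := k) x) = _
  rw [map_eq_sw (LinearMap.rTensor _ _)]
  rfl

variable (φ) in
omit hφ in
theorem schroedingerMinus_coact (y : B) :
    (schroedingerMinus (HopfOps.of k A) (HopfOps.of k B) φ).coact y =
      sw (comul (R := k) y) fun y₁ y₂ => ((1 : A) ⊗ₜ[k] y₁) ⊗ₜ[k] y₂ := by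
  change LinearMap.rTensor _ _ (comul (R := k) y) = _
  rw [map_eq_sw (LinearMap.rTensor _ _)]
  rfl

theorem contractPlus_one (x : A) :
    contractPlus (HopfOps.of k A) (HopfOps.of k B) φ (1 ⊗ₜ x) = x := by
  simp only [contractPlus_tmul, antipode_one, pairing_one_right hφ]
  exact sw_counit_left x (fun z => z) (by fun_prop)

theorem contractMinus_one (y : B) : contractMinus (HopfOps.of k B) φ (1 ⊗ₜ y) = y := by
  simp only [contractMinus_tmul, pairing_one_left hφ]
  exact sw_counit_left y (fun z => z) (by fun_prop)

theorem contractPlus_apply_one (b : B) :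
    contractPlus (HopfOps.of k A) (HopfOps.of k B) φ (b ⊗ₜ 1) = counit (R := k) b • (1 : A) := by
  rw [contractPlus_tmul, sw_comul_one _ (by fun_prop) (by fun_prop), pairing_one_left hφ,
    counit_antipode]

theorem contractMinus_apply_one (a : A) :
    contractMinus (HopfOps.of k B) φ (a ⊗ₜ 1) = counit (R := k) a • (1 : B) := by
  rw [contractMinus_tmul, sw_comul_one _ (by fun_prop) (by fun_prop), pairing_one_right hφ]

/-- By `pairing_mul_left_antipode` the form φ(·, S(·)) splits a product x y along b₁, b₂ in the
order a module algebra requires. -/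
theorem contractPlus_apply_mul (b : B) (x y : A) :
    contractPlus (HopfOps.of k A) (HopfOps.of k B) φ (b ⊗ₜ (x * y)) =
      sw (comul (R := k) b) fun b₁ b₂ =>
        contractPlus (HopfOps.of k A) (HopfOps.of k B) φ (b₁ ⊗ₜ x) *
        contractPlus (HopfOps.of k A) (HopfOps.of k B) φ (b₂ ⊗ₜ y) := by
  have hc := fun (t : A ⊗[k] A) (u : B ⊗[k] B) (f : A → A → B → B → A) => sw_comm t u f
  simp only [contractPlus_tmul]
  simp (disch := fun_prop) only [sw_comul_mul]
  simp only [pairing_mul_left_antipode hφ, sw_smul, sw_mul]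
  simp only [mul_sw, hc, smul_mul_smul_comm]

theorem contractMinus_apply_mul (a : A) (x y : B) :
    contractMinus (HopfOps.of k B) φ (a ⊗ₜ (x * y)) =
      sw (comul (R := k) a) fun a₁ a₂ => contractMinus (HopfOps.of k B) φ (a₁ ⊗ₜ x) *
        contractMinus (HopfOps.of k B) φ (a₂ ⊗ₜ y) := by
  have hc := fun (t : B ⊗[k] B) (u : A ⊗[k] A) (f : B → B → A → A → B) => sw_comm t u f
  simp only [contractMinus_tmul]
  simp (disch := fun_prop) only [sw_comul_mul]
  simp only [pairing_mul_right hφ, sw_smul, sw_mul]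
  simp only [mul_sw, hc, smul_mul_smul_comm]

end Schroedinger

/-! ### Yetter-Drinfeld module algebras over the double. -/

section SchroedingerAlgebra

open Coalgebra HopfAlgebra TensorProduct

variable {k : Type*} [Field k] {A B : Type*} [Ring A] [HopfAlgebra k A] [Ring B] [HopfAlgebra k B]
  {φ : A →ₗ[k] B →ₗ[k] k}

theorem double_mul_tmul (a a' : A) (b b' : B) :
    (double (HopfOps.of k A) (HopfOps.of k B) φ).mul ((a ⊗ₜ b) ⊗ₜ (a' ⊗ₜ b')) =
      sw (exchange (HopfOps.of k A) (HopfOps.of k B) φ (b ⊗ₜ a')) fun p q =>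
        (a * p) ⊗ₜ[k] (q * b') :=
  twistedMul_tmul (exchange (HopfOps.of k A) (HopfOps.of k B) φ) a a' b b'

theorem double_comul_of :
    (double (HopfOps.of k A) (HopfOps.of k B) φ).comul = (comul : A ⊗[k] B →ₗ[k] _) := rfl

theorem comul_tmul_one (a : A) : comul (R := k) (a ⊗ₜ[k] (1 : B)) =
    sw (comul (R := k) a) fun a₁ a₂ => (a₁ ⊗ₜ[k] (1 : B)) ⊗ₜ[k] (a₂ ⊗ₜ[k] (1 : B)) := by
  conv_lhs => rw [← sw_tmul_eq (comul _)]
  simp (disch := fun_prop) only [sw_comul_tmul, sw_comul_one]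

theorem comul_one_tmul (b : B) : comul (R := k) ((1 : A) ⊗ₜ[k] b) =
    sw (comul (R := k) b) fun b₁ b₂ => ((1 : A) ⊗ₜ[k] b₁) ⊗ₜ[k] ((1 : A) ⊗ₜ[k] b₂) := by
  conv_lhs => rw [← sw_tmul_eq (comul _)]
  simp (disch := fun_prop) only [sw_comul_tmul, sw_comul_one]

variable (hφ : IsHopfPairing (HopfOps.of k A) (HopfOps.of k B) φ)
include hφ

/-- In terms of c = x ⊗ b this is ∑ ψ(c₁) c₂ φ(c₃) ψ(c₄) = ∑ ψ(c₁) c₂: the contraction cancels the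
right half of the conjugation. -/
theorem exchange_contractPlus {P : Type*} [AddCommGroup P] [Module k P] (b : B) (x : A)
    (f : A → B → A → P) (h₁ : ∀ y z, IsLinearMap k fun x => f x y z)
    (h₂ : ∀ x z, IsLinearMap k fun y => f x y z) (h₃ : ∀ x y, IsLinearMap k fun z => f x y z) :
    (sw (comul (R := k) b) fun b₁ b₂ => sw (comul (R := k) x) fun x₁ x₂ =>
      sw (exchange (HopfOps.of k A) (HopfOps.of k B) φ (b₁ ⊗ₜ x₁)) fun p q =>
        f p q (contractPlus (HopfOps.of k A) (HopfOps.of k B) φ (b₂ ⊗ₜ x₂))) =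
    sw (comul (R := k) b) fun b₁ b₂ => sw (comul (R := k) x) fun x₁ t =>
      sw (comul (R := k) t) fun x₂ x₃ => φ x₁ (antipode k b₁) • f x₂ b₂ x₃ := by
  have key (c : A ⊗[k] B) (g : A ⊗[k] B → P) (hg : IsLinearMap k g) :
      (sw (comul (R := k) c) fun c₁ c₂ => pairingInv (HopfOps.of k B) φ c₂ •
        g (exchange (HopfOps.of k A) (HopfOps.of k B) φ (TensorProduct.comm k A B c₁))) =
      sw (comul (R := k) c) fun c₁ c₂ => pairingInv (HopfOps.of k B) φ c₁ • g c₂ := by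
    have e (t : (A ⊗[k] B) ⊗[k] (A ⊗[k] B)) (f : A ⊗[k] B → A ⊗[k] B → A ⊗[k] B) :
      g (sw t f) = sw t fun x y => g (f x y) := map_sw hg.mk' t f
    simp only [exchange_comm, e, hg.map_smul, smul_sw, smul_smul]
    simp (disch := fun_prop) only [sw_coassoc]
    refine sw_congr _ fun c₁ t => ?_
    rw [← sw_counit_right (k := k) t (fun z => pairingInv (HopfOps.of k B) φ c₁ • g z)
      (by fun_prop)]
    refine sw_congr _ fun c₂ w => ?_
    rw [← pairing_mul_pairingInv hφ w, sw_smul]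
    simp only [smul_smul]
    refine sw_congr _ fun _ _ => ?_
    congr 1
    ring
  have hc := fun (t : B ⊗[k] B) (u : A ⊗[k] A) (f : B → B → A → A → P) => sw_comm t u f
  have e (p : A) (q : B) (t : A ⊗[k] A) (g : A → A → A) :
    f p q (sw t g) = sw t fun x y => f p q (g x y) := map_sw (h₃ p q).mk' t g
  have hc' := fun (t : A ⊗[k] B) (u : A ⊗[k] A) (f : A → B → A → A → P) => sw_comm t u f
  simp only [contractPlus_tmul, e, (h₃ _ _).map_smul, hc', hc]
  rw [← sw_coassoc (k := k) x (fun x₁ x₂ x₃ => sw (comul (R := k) b) fun b₁ b₂ =>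
      φ x₁ (antipode k b₁) • f x₂ b₂ x₃) (by fun_prop) (by fun_prop) (by fun_prop),
    ← sw_coassoc (k := k) x (fun x₁ x₂ x₃ => sw (comul (R := k) b) fun b₁ b₂ =>
      sw (exchange (HopfOps.of k A) (HopfOps.of k B) φ (b₁ ⊗ₜ x₁))
        fun p q => φ x₂ (antipode k b₂) • f p q x₃) (by fun_prop) (by fun_prop) (by fun_prop)]
  refine sw_congr _ fun s x₃ => ?_
  have := key (s ⊗ₜ b) (fun t => sw t fun p q => f p q x₃) (by fun_prop)
  rw [sw_comul_tmul _ _ _ (by fun_prop) (by fun_prop),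
    sw_comul_tmul _ _ _ (by fun_prop) (by fun_prop)] at this
  simp (disch := fun_prop) only [sw_pure, smul_sw] at this
  exact this

/-- The mirror cancellation: ∑ φ(c₁) ψ(c₂) c₃ φ(c₄) = ∑ c₁ φ(c₂), so the left half of the
conjugation disappears. -/
theorem contractMinus_exchange {P : Type*} [AddCommGroup P] [Module k P] (a : A) (z : B)
    (f : A → B → B → P) (h₁ : ∀ y z, IsLinearMap k fun x => f x y z)
    (h₂ : ∀ x z, IsLinearMap k fun y => f x y z) (h₃ : ∀ x y, IsLinearMap k fun z => f x y z) :
    (sw (comul (R := k) a) fun a₁ a₂ => sw (comul (R := k) z) fun z₁ t =>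
      sw (comul (R := k) t) fun z₂ z₃ => φ a₁ z₁ •
        sw (exchange (HopfOps.of k A) (HopfOps.of k B) φ (z₂ ⊗ₜ a₂)) fun p q => f p q z₃) =
    sw (comul (R := k) a) fun a₁ a₂ => sw (comul (R := k) z) fun z₁ t =>
      f a₁ z₁ (contractMinus (HopfOps.of k B) φ (a₂ ⊗ₜ t)) := by
  have key (c : A ⊗[k] B) (g : A ⊗[k] B → P) (hg : IsLinearMap k g) :
      (sw (comul (R := k) c) fun c₁ c₂ => lift φ c₁ •
        g (exchange (HopfOps.of k A) (HopfOps.of k B) φ (TensorProduct.comm k A B c₂))) =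
      sw (comul (R := k) c) fun c₁ c₂ => lift φ c₂ • g c₁ := by
    have e (t : (A ⊗[k] B) ⊗[k] (A ⊗[k] B)) (f : A ⊗[k] B → A ⊗[k] B → A ⊗[k] B) :
      g (sw t f) = sw t fun x y => g (f x y) := map_sw hg.mk' t f
    simp only [exchange_comm, e, hg.map_smul, smul_sw, smul_smul]
    rw [← sw_pairing_mul_pairingInv hφ c (fun t => sw (comul (R := k) t) fun u v =>
      lift φ v • g u) (by fun_prop)]
    simp only [smul_sw, smul_smul, mul_assoc]
  have e (p : A) (q : B) (t : B ⊗[k] B) (g : B → B → B) :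
    f p q (sw t g) = sw t fun x y => f p q (g x y) := map_sw (h₃ p q).mk' t g
  have hc := fun (t : A ⊗[k] A) (u : B ⊗[k] B) (f : A → A → B → B → P) => sw_comm t u f
  simp only [contractMinus_tmul, e, (h₃ _ _).map_smul, hc]
  rw [← sw_coassoc (k := k) z (fun z₁ z₂ z₃ => sw (comul (R := k) a) fun a₁ a₂ =>
      φ a₂ z₂ • f a₁ z₁ z₃) (by fun_prop) (by fun_prop) (by fun_prop),
    ← sw_coassoc (k := k) z (fun z₁ z₂ z₃ => sw (comul (R := k) a) fun a₁ a₂ =>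
      φ a₁ z₁ • sw (exchange (HopfOps.of k A) (HopfOps.of k B) φ (z₂ ⊗ₜ a₂))
        fun p q => f p q z₃) (by fun_prop) (by fun_prop) (by fun_prop)]
  refine sw_congr _ fun s z₃ => ?_
  have := key (a ⊗ₜ s) (fun t => sw t fun p q => f p q z₃) (by fun_prop)
  rw [sw_comul_tmul _ _ _ (by fun_prop) (by fun_prop),
    sw_comul_tmul _ _ _ (by fun_prop) (by fun_prop), hc, hc] at this
  simp (disch := fun_prop) only [sw_pure] at this
  exact this

theorem schroedingerPlus_isYetterDrinfeld :
    IsYetterDrinfeld (double (HopfOps.of k A) (HopfOps.of k B) φ)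
      (schroedingerPlus (HopfOps.of k A) (HopfOps.of k B) φ) where
  module :=
    { one_act := fun x => by
        change (schroedingerPlus (HopfOps.of k A) (HopfOps.of k B) φ).act ((1 ⊗ₜ 1) ⊗ₜ x) = x
        rw [schroedingerPlus_act_tmul, contractPlus_one hφ, adjoint_one]
      mul_act := fun c d x => by
        revert c
        refine eq_of_eq_tmul (k := k) (by fun_prop) (by fun_prop) fun a b => ?_
        revert d
        refine eq_of_eq_tmul (k := k) (by fun_prop) (by fun_prop) fun a' b' => ?_
        simp only [double_mul_tmul, sw_tmul, map_sw, schroedingerPlus_act_tmul, adjoint_mul,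
          contractPlus_mul hφ, contractPlus_adjoint hφ, tmul_sw] }
  counit_coact x := by
    rw [schroedingerPlus_coact, double_counit_of]
    simp only [map_sw, LinearMap.rTensor_tmul, TensorProduct.counit_tmul,
      TensorProduct.lid_tmul, Bialgebra.counit_one, one_smul]
    exact sw_counit_left x (fun z => z) (by fun_prop)
  coassoc x := by
    rw [double_comul_of]
    simp only [schroedingerPlus_coact, map_sw, LinearMap.rTensor_tmul, LinearMap.lTensor_tmul,
      comul_tmul_one, sw_tmul, tmul_sw, TensorProduct.assoc_tmul]
    simp (disch := fun_prop) only [sw_coassoc]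
  compat h x := by
    revert h
    refine eq_of_eq_tmul (k := k) (by fun_prop) (by fun_prop) fun a b => ?_
    rw [ydLeft_tmul, ydRight_tmul, double_comul_of, sw_comul_tmul _ _ _ (by fun_prop) (by fun_prop),
      sw_comul_tmul _ _ _ (by fun_prop) (by fun_prop)]
    simp only [schroedingerPlus_coact]
    simp (disch := fun_prop) only [sw_sw, sw_pure]
    simp only [schroedingerPlus_act_tmul, double_mul_tmul, exchange_one_left hφ, sw_tmul]
    simp (disch := fun_prop) only [sw_pure, mul_one, one_mul]
    -- A common form of both sides: the exchange cancellation leads to it from the left, the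
    -- compatibility of the adjoint action from the right.
    trans sw (comul (R := k) b) fun b₁ b₂ => sw (comul (R := k) x) fun x₁ t =>
      φ x₁ (antipode k b₁) • sw (comul (R := k) a) fun a₁ a₂ => sw (comul (R := k) t) fun x₂ x₃ =>
        ((a₁ * x₂) ⊗ₜ[k] b₂) ⊗ₜ[k] (HopfOps.of k A).adjoint (a₂ ⊗ₜ x₃)
    · simp only [sw_comm (comul a)]
      rw [exchange_contractPlus hφ b x (fun p q z => sw (comul (R := k) a) fun a₁ a₂ =>
        ((a₁ * p) ⊗ₜ[k] q) ⊗ₜ[k] (HopfOps.of k A).adjoint (a₂ ⊗ₜ z)) (by fun_prop) (by fun_prop)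
        (by fun_prop)]
      simp only [smul_sw]
    · have e (x₂ : A) (b₂ : B) := adjoint_compat (k := k) a x₂ (fun u v => (u ⊗ₜ[k] b₂) ⊗ₜ[k] v)
        (by fun_prop) (by fun_prop)
      simp only [← e, contractPlus_tmul, tmul_sw, tmul_smul, map_sw, map_smul]
      simp (disch := fun_prop) only [sw_sw, smul_tensor_sw]
      simp only [sw_comm (comul a), smul_sw]

theorem schroedingerMinus_isYetterDrinfeld :
    IsYetterDrinfeld (double (HopfOps.of k A) (HopfOps.of k B) φ)
      (schroedingerMinus (HopfOps.of k A) (HopfOps.of k B) φ) where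
  module :=
    { one_act := fun x => by
        change (schroedingerMinus (HopfOps.of k A) (HopfOps.of k B) φ).act ((1 ⊗ₜ 1) ⊗ₜ x) = x
        rw [schroedingerMinus_act_tmul, contractMinus_one hφ, adjoint_one]
      mul_act := fun c d x => by
        revert c
        refine eq_of_eq_tmul (k := k) (by fun_prop) (by fun_prop) fun a b => ?_
        revert d
        refine eq_of_eq_tmul (k := k) (by fun_prop) (by fun_prop) fun a' b' => ?_
        simp only [double_mul_tmul, sw_tmul, map_sw, schroedingerMinus_act_tmul, adjoint_mul,
          contractMinus_mul hφ, adjoint_contractMinus hφ, tmul_sw] }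
  counit_coact x := by
    rw [schroedingerMinus_coact, double_counit_of]
    simp only [map_sw, LinearMap.rTensor_tmul, TensorProduct.counit_tmul, smul_eq_mul, mul_one,
      TensorProduct.lid_tmul, Bialgebra.counit_one]
    exact sw_counit_left x (fun z => z) (by fun_prop)
  coassoc x := by
    rw [double_comul_of]
    simp only [schroedingerMinus_coact, map_sw, LinearMap.rTensor_tmul, LinearMap.lTensor_tmul,
      comul_one_tmul, sw_tmul, tmul_sw, TensorProduct.assoc_tmul]
    simp (disch := fun_prop) only [sw_coassoc]
  compat h y := by
    revert h
    refine eq_of_eq_tmul (k := k) (by fun_prop) (by fun_prop) fun a b => ?_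
    rw [ydLeft_tmul, ydRight_tmul, double_comul_of, sw_comul_tmul _ _ _ (by fun_prop) (by fun_prop),
      sw_comul_tmul _ _ _ (by fun_prop) (by fun_prop)]
    simp only [schroedingerMinus_coact]
    simp (disch := fun_prop) only [sw_sw, sw_pure]
    simp only [schroedingerMinus_act_tmul, double_mul_right hφ, double_mul_tmul]
    have e (a₁ a₂ : A) := adjoint_compat (k := k) b y (fun u v =>
      (a₁ ⊗ₜ[k] u) ⊗ₜ[k] contractMinus (HopfOps.of k B) φ (a₂ ⊗ₜ v)) (by fun_prop) (by fun_prop)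
    simp only [← e, sw_comm (comul a)]
    refine sw_congr _ fun b₁ b₂ => ?_
    -- After `adjoint_compat` both sides depend on `y` only through b₁ • y, and the remaining
    -- identity holds for every element `z`.
    generalize (HopfOps.of k B).adjoint (b₁ ⊗ₜ y) = z
    rw [sw_comm, ← contractMinus_exchange hφ a z (fun p q z => (p ⊗ₜ[k] (q * b₂)) ⊗ₜ[k] z)
      (by fun_prop) (by fun_prop) (by fun_prop)]
    refine sw_congr _ fun a₁ a₂ => ?_
    simp only [contractMinus_tmul, map_sw, map_smul]
    simp (disch := fun_prop) only [sw_sw, smul_tensor_sw]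
    simp only [sw_tmul, one_mul, smul_sw]

theorem schroedingerPlus_isYDAlgebra :
    IsYDAlgebra (double (HopfOps.of k A) (HopfOps.of k B) φ)
      (schroedingerPlus (HopfOps.of k A) (HopfOps.of k B) φ) where
  yd := schroedingerPlus_isYetterDrinfeld hφ
  mul_hom :=
    { map_act := fun h m => by
        revert h
        refine eq_of_eq_tmul (k := k) (by fun_prop) (by fun_prop) fun a b => ?_
        revert m
        refine eq_of_eq_tmul (k := k) (by fun_prop) (by fun_prop) fun x y => ?_
        rw [tensor_act_tmul, double_comul_of, sw_comul_tmul _ _ _ (by fun_prop) (by fun_prop)]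
        simp only [map_sw, LinearMap.mul'_apply, schroedingerPlus_act_tmul,
          contractPlus_apply_mul hφ, tmul_sw, adjoint_apply_mul]
        rw [sw_comm]
      map_coact := by
        refine eq_of_eq_tmul (k := k) (by fun_prop) (by fun_prop) fun x y => ?_
        rw [tensor_coact_tmul, LinearMap.mul'_apply]
        simp only [schroedingerPlus_coact]
        simp (disch := fun_prop) only [sw_comul_mul, sw_sw, sw_pure]
        simp only [map_sw, LinearMap.lTensor_tmul, LinearMap.mul'_apply, double_mul_left hφ] }
  one_hom :=
    { map_act := fun h c => by
        revert h
        refine eq_of_eq_tmul (k := k) (by fun_prop) (by fun_prop) fun a b => ?_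
        rw [YDOps.unit, double_counit_of]
        simp only [schroedingerPlus_act_tmul, LinearMap.comp_apply, LinearMap.rTensor_tmul,
          LinearMap.mul'_apply, TensorProduct.counit_tmul, Algebra.linearMap_apply,
          Algebra.algebraMap_eq_smul_one, tmul_smul, map_smul, contractPlus_apply_one hφ,
          adjoint_apply_one, smul_smul, smul_eq_mul]
        congr 1
        ring
      map_coact := fun c => by
        simp only [Algebra.linearMap_apply, Algebra.algebraMap_eq_smul_one, map_smul,
          schroedingerPlus_coact]
        rw [sw_comul_one _ (by fun_prop) (by fun_prop)]
        simp only [YDOps.unit, TensorProduct.mk_apply, LinearMap.lTensor_tmul,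
          Algebra.linearMap_apply, Algebra.algebraMap_eq_smul_one, tmul_smul]
        rfl }

theorem schroedingerMinus_isYDAlgebra :
    IsYDAlgebra (double (HopfOps.of k A) (HopfOps.of k B) φ)
      (schroedingerMinus (HopfOps.of k A) (HopfOps.of k B) φ) where
  yd := schroedingerMinus_isYetterDrinfeld hφ
  mul_hom :=
    { map_act := fun h m => by
        revert h
        refine eq_of_eq_tmul (k := k) (by fun_prop) (by fun_prop) fun a b => ?_
        revert m
        refine eq_of_eq_tmul (k := k) (by fun_prop) (by fun_prop) fun x y => ?_
        rw [tensor_act_tmul, double_comul_of, sw_comul_tmul _ _ _ (by fun_prop) (by fun_prop)]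
        simp only [map_sw, LinearMap.mul'_apply, schroedingerMinus_act_tmul,
          adjoint_apply_mul, tmul_sw, contractMinus_apply_mul hφ]
        rw [sw_comm]
      map_coact := by
        refine eq_of_eq_tmul (k := k) (by fun_prop) (by fun_prop) fun x y => ?_
        rw [tensor_coact_tmul, LinearMap.mul'_apply]
        simp only [schroedingerMinus_coact]
        simp (disch := fun_prop) only [sw_comul_mul, sw_sw, sw_pure]
        simp only [map_sw, LinearMap.lTensor_tmul, LinearMap.mul'_apply, double_mul_right hφ] }
  one_hom :=
    { map_act := fun h c => by
        revert h
        refine eq_of_eq_tmul (k := k) (by fun_prop) (by fun_prop) fun a b => ?_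
        rw [YDOps.unit, double_counit_of]
        simp only [schroedingerMinus_act_tmul, LinearMap.comp_apply, LinearMap.rTensor_tmul,
          LinearMap.mul'_apply, TensorProduct.counit_tmul, Algebra.linearMap_apply,
          Algebra.algebraMap_eq_smul_one, tmul_smul, map_smul, contractMinus_apply_one hφ,
          adjoint_apply_one, smul_smul, smul_eq_mul]
        congr 1
        ring
      map_coact := fun c => by
        simp only [Algebra.linearMap_apply, Algebra.algebraMap_eq_smul_one, map_smul,
          schroedingerMinus_coact]
        rw [sw_comul_one _ (by fun_prop) (by fun_prop)]
        simp only [YDOps.unit, TensorProduct.mk_apply, LinearMap.lTensor_tmul,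
          Algebra.linearMap_apply, Algebra.algebraMap_eq_smul_one, tmul_smul]
        rfl }

end SchroedingerAlgebra

/-! ### Sweedler forms of the Yetter-Drinfeld axioms. -/

section Coaction

variable {k A M N P : Type*} [Field k] [AddCommGroup A] [Module k A]
  [AddCommGroup M] [Module k M] [AddCommGroup N] [Module k N] [AddCommGroup P] [Module k P]

theorem IsYetterDrinfeld.sw_coassoc {O : HopfOps k A} {Y : YDOps k A M} (hY : IsYetterDrinfeld O Y)
    (m : M) (f : A → A → M → P)
    (h₁ : ∀ y z, IsLinearMap k fun x => f x y z) (h₂ : ∀ x z, IsLinearMap k fun y => f x y z)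
    (h₃ : ∀ x y, IsLinearMap k fun z => f x y z) :
    (sw (Y.coact m) fun x z => sw (O.comul x) fun u v => f u v z) =
      sw (Y.coact m) fun x y => sw (Y.coact y) fun u v => f x u v :=
  sw_coassoc_of (hY.coassoc m) f h₁ h₂ h₃

theorem IsYetterDrinfeld.sw_counit {O : HopfOps k A} {Y : YDOps k A M} (hY : IsYetterDrinfeld O Y)
    (m : M) (f : M → P) (hf : IsLinearMap k f) :
    (sw (Y.coact m) fun u m₀ => O.counit u • f m₀) = f m := by
  have e := hY.counit_coact m
  rw [map_eq_sw (LinearMap.rTensor _ _)] at e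
  simp only [map_sw, LinearMap.rTensor_tmul, TensorProduct.lid_tmul] at e
  have e' := congrArg hf.mk' e
  simpa only [map_sw, map_smul, IsLinearMap.mk'_apply] using e'

theorem IsYetterDrinfeld.sw_compat {O : HopfOps k A} {Y : YDOps k A M} (hY : IsYetterDrinfeld O Y)
    (h : A) (m : M) (f : A → M → P)
    (h₁ : ∀ y, IsLinearMap k fun x => f x y) (h₂ : ∀ x, IsLinearMap k fun y => f x y) :
    (sw (O.comul h) fun a₁ a₂ => sw (Y.coact (Y.act (a₁ ⊗ₜ m))) fun u n =>
      f (O.mul (u ⊗ₜ a₂)) n) =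
    sw (O.comul h) fun a₁ a₂ => sw (Y.coact m) fun u n =>
      f (O.mul (a₁ ⊗ₜ u)) (Y.act (a₂ ⊗ₜ n)) := by
  have e := congrArg (fun t => sw t f) (hY.compat h m)
  simp only [ydLeft_tmul, ydRight_tmul] at e
  simp (disch := fun_prop) only [sw_sw, sw_pure] at e
  exact e.symm

end Coaction

/-! ### Sweedler forms of the braided Hopf algebra axioms. -/

section Braided

open Coalgebra HopfAlgebra TensorProduct

variable {k H : Type*} [Field k] [Ring H] [HopfAlgebra k H]
  {R : Type*} [Ring R] [Algebra k R] {Y : YDOps k H R}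
  {P : Type*} [AddCommGroup P] [Module k P]

theorem braidedMul_tmul {A M N : Type*} [AddCommGroup A] [Module k A] [Ring M] [Algebra k M]
    [Ring N] [Algebra k N] (Y : YDOps k A M) (Z : YDOps k A N) (m m' : M) (n n' : N) :
    braidedMul Y Z ((m ⊗ₜ n) ⊗ₜ (m' ⊗ₜ n')) =
      sw (Z.coact n) fun u n₀ => (m * Y.act (u ⊗ₜ m')) ⊗ₜ[k] (n₀ * n') := by
  refine (twistedMul_tmul (braiding Z Y) m m' n n').trans ?_
  rw [braiding_tmul]
  simp (disch := fun_prop) only [sw_sw, sw_pure]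

namespace IsYDAlgebra

variable {A M : Type*} [AddCommGroup A] [Module k A] [Ring M] [Algebra k M] {O : HopfOps k A}
  {Z : YDOps k A M} (hZ : IsYDAlgebra O Z)
include hZ

theorem act_mul (h : A) (x y : M) : Z.act (h ⊗ₜ (x * y)) =
    sw (O.comul h) fun h₁ h₂ => Z.act (h₁ ⊗ₜ x) * Z.act (h₂ ⊗ₜ y) := by
  have e := hZ.mul_hom.map_act h (x ⊗ₜ y)
  rw [tensor_act_tmul, map_sw] at e
  exact e.symm

theorem act_one (h : A) : Z.act (h ⊗ₜ 1) = O.counit h • (1 : M) := by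
  have e := hZ.one_hom.map_act h 1
  simpa [YDOps.unit, Algebra.algebraMap_eq_smul_one] using e.symm

theorem coact_mul (x y : M) : Z.coact (x * y) = sw (Z.coact x) fun u x₀ =>
    sw (Z.coact y) fun v y₀ => O.mul (u ⊗ₜ v) ⊗ₜ[k] (x₀ * y₀) := by
  have e := hZ.mul_hom.map_coact (x ⊗ₜ y)
  rw [tensor_coact_tmul] at e
  simpa only [map_sw, LinearMap.lTensor_tmul, LinearMap.mul'_apply] using e

theorem coact_one : Z.coact 1 = O.one ⊗ₜ 1 := by
  have e := hZ.one_hom.map_coact 1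
  simpa [YDOps.unit] using e

end IsYDAlgebra

variable [Coalgebra k R] {S : R →ₗ[k] R}

namespace IsBraidedHopf

variable (hY : IsBraidedHopf Y S)
include hY

theorem act_mul (h : H) (x y : R) : Y.act (h ⊗ₜ (x * y)) =
    sw (comul (R := k) h) fun h₁ h₂ => Y.act (h₁ ⊗ₜ x) * Y.act (h₂ ⊗ₜ y) :=
  hY.algebra.act_mul h x y

theorem act_one (h : H) : Y.act (h ⊗ₜ 1) = counit (R := k) h • (1 : R) :=
  hY.algebra.act_one h

theorem mul_act (g h : H) (x : R) : Y.act ((g * h) ⊗ₜ x) = Y.act (g ⊗ₜ Y.act (h ⊗ₜ x)) :=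
  hY.algebra.yd.module.mul_act g h x

theorem one_act (x : R) : Y.act (1 ⊗ₜ x) = x :=
  hY.algebra.yd.module.one_act x

theorem sw_coact_mul (x y : R) (f : H → R → P)
    (h₁ : ∀ y, IsLinearMap k fun x => f x y) (h₂ : ∀ x, IsLinearMap k fun y => f x y) :
    sw (Y.coact (x * y)) f = sw (Y.coact x) fun u x₀ => sw (Y.coact y) fun v y₀ =>
      f (u * v) (x₀ * y₀) := by
  rw [hY.algebra.coact_mul]
  simp (disch := fun_prop) only [sw_sw, sw_pure]
  rfl

theorem sw_coact_one (f : H → R → P)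
    (h₁ : ∀ y, IsLinearMap k fun x => f x y) (h₂ : ∀ x, IsLinearMap k fun y => f x y) :
    sw (Y.coact 1) f = f 1 1 := by
  rw [hY.algebra.coact_one]
  exact sw_pure _ _ _ h₁ h₂

theorem sw_coact_coassoc (m : R) (f : H → H → R → P)
    (h₁ : ∀ y z, IsLinearMap k fun x => f x y z) (h₂ : ∀ x z, IsLinearMap k fun y => f x y z)
    (h₃ : ∀ x y, IsLinearMap k fun z => f x y z) :
    (sw (Y.coact m) fun x z => sw (comul (R := k) x) fun u v => f u v z) =
      sw (Y.coact m) fun x y => sw (Y.coact y) fun u v => f x u v :=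
  hY.algebra.yd.sw_coassoc m f h₁ h₂ h₃

theorem sw_counit_coact (m : R) (f : R → P) (hf : IsLinearMap k f) :
    (sw (Y.coact m) fun u m₀ => counit (R := k) u • f m₀) = f m :=
  hY.algebra.yd.sw_counit m f hf

theorem sw_compat (h : H) (m : R) (f : H → R → P)
    (h₁ : ∀ y, IsLinearMap k fun x => f x y) (h₂ : ∀ x, IsLinearMap k fun y => f x y) :
    (sw (comul (R := k) h) fun a₁ a₂ => sw (Y.coact (Y.act (a₁ ⊗ₜ m))) fun u n => f (u * a₂) n) =
    sw (comul (R := k) h) fun a₁ a₂ => sw (Y.coact m) fun u n => f (a₁ * u) (Y.act (a₂ ⊗ₜ n)) :=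
  hY.algebra.yd.sw_compat h m f h₁ h₂

theorem sw_comul_act (h : H) (x : R) (f : R → R → P)
    (h₁ : ∀ y, IsLinearMap k fun x => f x y) (h₂ : ∀ x, IsLinearMap k fun y => f x y) :
    sw (comul (R := k) (Y.act (h ⊗ₜ x))) f = sw (comul (R := k) h) fun a₁ a₂ =>
      sw (comul (R := k) x) fun x₁ x₂ => f (Y.act (a₁ ⊗ₜ x₁)) (Y.act (a₂ ⊗ₜ x₂)) := by
  rw [hY.comul_hom.map_act]
  conv_lhs => rw [← sw_tmul_eq (comul x)]
  simp only [tmul_sw, map_sw, tensor_act_tmul]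
  simp (disch := fun_prop) only [sw_sw, sw_pure]
  rw [sw_comm]
  rfl

theorem sw_comul_coact (x : R) (f : H → R → R → P)
    (h₁ : ∀ y z, IsLinearMap k fun x => f x y z) (h₂ : ∀ x z, IsLinearMap k fun y => f x y z)
    (h₃ : ∀ x y, IsLinearMap k fun z => f x y z) :
    (sw (Y.coact x) fun u x₀ => sw (comul (R := k) x₀) fun x₁ x₂ => f u x₁ x₂) =
      sw (comul (R := k) x) fun x₁ x₂ => sw (Y.coact x₁) fun u y₁ => sw (Y.coact x₂) fun v y₂ =>
        f (u * v) y₁ y₂ := by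
  have hF : IsLinearMap k fun t : H ⊗[k] (R ⊗[k] R) => sw t fun u s => sw s fun y z => f u y z := by
    fun_prop
  have e := congrArg hF.mk' (hY.comul_hom.map_coact x)
  rw [map_eq_sw (LinearMap.lTensor _ _)] at e
  conv_lhs at e => rw [← sw_tmul_eq (comul x)]
  simp only [map_sw, tensor_coact_tmul, LinearMap.lTensor_tmul, IsLinearMap.mk'_apply] at e
  simp (disch := fun_prop) only [sw_pure] at e
  exact e.symm

theorem counit_act (h : H) (x : R) :
    counit (R := k) (Y.act (h ⊗ₜ x)) = counit (R := k) h * counit (R := k) x :=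
  hY.counit_hom.map_act h x

theorem sw_coact_counit (x : R) (f : H → P) (hf : IsLinearMap k f) :
    (sw (Y.coact x) fun u x₀ => counit (R := k) x₀ • f u) = counit (R := k) x • f 1 := by
  have e := hY.counit_hom.map_coact x
  rw [map_eq_sw (LinearMap.lTensor _ _)] at e
  have e' := congrArg (fun t : H ⊗[k] k => (IsLinearMap.mk' f hf) (TensorProduct.rid k H t)) e
  simp only [YDOps.unit, TensorProduct.mk_apply, map_sw, LinearMap.lTensor_tmul,
    TensorProduct.rid_tmul, map_smul] at e'
  exact e'.symm

theorem sw_comul_mul (x y : R) (f : R → R → P)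
    (h₁ : ∀ y, IsLinearMap k fun x => f x y) (h₂ : ∀ x, IsLinearMap k fun y => f x y) :
    sw (comul (R := k) (x * y)) f = sw (comul (R := k) x) fun x₁ x₂ =>
      sw (Y.coact x₂) fun u x₃ => sw (comul (R := k) y) fun y₁ y₂ =>
        f (x₁ * Y.act (u ⊗ₜ y₁)) (x₃ * y₂) := by
  have e : comul (R := k) (x * y) = sw (comul (R := k) x) fun x₁ x₂ =>
      sw (comul (R := k) y) fun y₁ y₂ => sw (Y.coact x₂) fun u x₃ =>
        (x₁ * Y.act (u ⊗ₜ y₁)) ⊗ₜ[k] (x₃ * y₂) := by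
    rw [hY.comul_mul]
    conv_lhs => rw [← sw_tmul_eq (comul (R := k) x), ← sw_tmul_eq (comul (R := k) y)]
    simp only [sw_tmul]
    simp only [tmul_sw, map_sw, braidedMul_tmul]
  rw [e]
  simp (disch := fun_prop) only [sw_sw, sw_pure]
  refine sw_congr _ fun x₁ x₂ => ?_
  rw [sw_comm]

theorem sw_comul_one (f : R → R → P)
    (h₁ : ∀ y, IsLinearMap k fun x => f x y) (h₂ : ∀ x, IsLinearMap k fun y => f x y) :
    sw (comul (R := k) (1 : R)) f = f 1 1 := by
  rw [hY.comul_one]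
  exact sw_pure _ _ _ h₁ h₂

theorem sw_antipode_left (a : R) (f : R → P) (hf : IsLinearMap k f) :
    (sw (comul (R := k) a) fun x y => f (S x * y)) = counit (R := k) a • f 1 := by
  have e := hY.antipode_left a
  rw [map_eq_sw (LinearMap.rTensor R S) (comul (R := k) a)] at e
  simp only [map_sw, LinearMap.rTensor_tmul, LinearMap.mul'_apply] at e
  have e' := congrArg hf.mk' e
  rwa [map_sw, Algebra.algebraMap_eq_smul_one, map_smul] at e'

theorem sw_antipode_right (a : R) (f : R → P) (hf : IsLinearMap k f) :
    (sw (comul (R := k) a) fun x y => f (x * S y)) = counit (R := k) a • f 1 := by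
  have e := hY.antipode_right a
  rw [map_eq_sw (LinearMap.lTensor R S) (comul (R := k) a)] at e
  simp only [map_sw, LinearMap.lTensor_tmul, LinearMap.mul'_apply] at e
  have e' := congrArg hf.mk' e
  rwa [map_sw, Algebra.algebraMap_eq_smul_one, map_smul] at e'

end IsBraidedHopf

end Braided

/-! ### The biproduct on pure tensors, as a twisted tensor product. -/

section Biproduct

open Coalgebra HopfAlgebra TensorProduct

variable {k H : Type*} [Field k] [Ring H] [HopfAlgebra k H]
  {R : Type*} [Ring R] [Algebra k R] (Y : YDOps k H R)

theorem biproductMul_tmul (a a' : R) (h h' : H) :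
    biproductMul Y ((a ⊗ₜ h) ⊗ₜ (a' ⊗ₜ h')) = sw (comul (R := k) h) fun h₁ h₂ =>
      (a * Y.act (h₁ ⊗ₜ a')) ⊗ₜ[k] (h₂ * h') := by
  simp only [biproductMul, LinearMap.comp_apply, LinearMap.rTensor_tmul, LinearMap.lTensor_tmul]
  conv_lhs => rw [← sw_tmul_eq (comul h)]
  simp only [tmul_sw, sw_tmul, map_sw, LinearEquiv.coe_coe, TensorProduct.assoc_symm_tmul,
    tensorTensorTensorComm_tmul, TensorProduct.map_tmul, LinearMap.comp_apply,
    TensorProduct.assoc_tmul, LinearMap.lTensor_tmul, LinearMap.mul'_apply]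

/-- The exchange map `h ⊗ a ↦ ∑ h₁ • a ⊗ h₂` of the biproduct. -/
def smash : H ⊗[k] R →ₗ[k] R ⊗[k] H :=
  Y.act.rTensor H ∘ₗ (TensorProduct.rightComm k H H R).toLinearMap ∘ₗ
    (comul (R := k) (A := H)).rTensor R

theorem smash_tmul (h : H) (a : R) : smash Y (h ⊗ₜ a) = sw (comul (R := k) h) fun h₁ h₂ =>
    Y.act (h₁ ⊗ₜ a) ⊗ₜ[k] h₂ := by
  simp only [smash, LinearMap.comp_apply, LinearMap.rTensor_tmul]
  conv_lhs => rw [← sw_tmul_eq (comul h)]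
  simp only [sw_tmul, map_sw, LinearEquiv.coe_coe, rightComm_tmul, LinearMap.rTensor_tmul]

theorem biproductMul_eq : biproductMul Y = twistedMul (smash Y) := by
  ext a h a' h'
  simp only [AlgebraTensorModule.curry_apply, curry_apply, LinearMap.restrictScalars_self,
    biproductMul_tmul, twistedMul_tmul, smash_tmul]
  simp (disch := fun_prop) only [sw_sw, sw_pure]

variable [Coalgebra k R]

theorem biproductComul_tmul (a : R) (h : H) :
    biproductComul Y (a ⊗ₜ h) = sw (comul (R := k) a) fun a₁ a₂ => sw (Y.coact a₂) fun u a₃ =>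
      sw (comul (R := k) h) fun h₁ h₂ => (a₁ ⊗ₜ[k] (u * h₁)) ⊗ₜ[k] (a₃ ⊗ₜ[k] h₂) := by
  simp only [biproductComul, LinearMap.comp_apply, TensorProduct.map_tmul, LinearMap.rTensor_tmul]
  conv_lhs => rw [← sw_tmul_eq (comul a), ← sw_tmul_eq (comul h)]
  simp only [sw_tmul, map_sw, LinearMap.lTensor_tmul]
  refine sw_congr _ fun a₁ a₂ => ?_
  conv_lhs => rw [← sw_tmul_eq (Y.coact a₂)]
  simp only [tmul_sw, sw_tmul, map_sw, LinearEquiv.coe_coe, TensorProduct.assoc_symm_tmul]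
  simp only [tensorTensorTensorComm_tmul, LinearMap.rTensor_tmul,
    LinearMap.comp_apply, LinearEquiv.coe_coe, TensorProduct.assoc_tmul, LinearMap.lTensor_tmul,
    LinearMap.mul'_apply]
  rw [sw_comm]

variable (S : R →ₗ[k] R)

omit [Coalgebra k R] in
theorem biproductAntipode_tmul (a : R) (h : H) :
    biproductAntipode Y S (a ⊗ₜ h) = sw (Y.coact a) fun u a₀ =>
      biproductMul Y ((1 ⊗ₜ (antipode k h * antipode k u)) ⊗ₜ (S a₀ ⊗ₜ 1)) := by
  simp only [biproductAntipode, LinearMap.comp_apply, LinearMap.rTensor_tmul]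
  conv_lhs => rw [← sw_tmul_eq (Y.coact a)]
  simp only [sw_tmul, map_sw, LinearEquiv.coe_coe, TensorProduct.comm_tmul,
    TensorProduct.assoc_symm_tmul, TensorProduct.map_tmul, LinearMap.comp_apply,
    LinearMap.mul'_apply, TensorProduct.mk_apply, LinearMap.flip_apply]

end Biproduct

/-! ### The biproduct is a Hopf algebra. -/

section BiproductAxioms

open Coalgebra HopfAlgebra TensorProduct

variable {k H : Type*} [Field k] [Ring H] [HopfAlgebra k H]
  {R : Type*} [Ring R] [Algebra k R] [Coalgebra k R] {Y : YDOps k H R} {S : R →ₗ[k] R}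
  {P : Type*} [AddCommGroup P] [Module k P]
variable (hY : IsBraidedHopf Y S)
include hY

theorem biproduct_isUnitalAssoc : IsUnitalAssoc (biproductMul Y) ((1 : R) ⊗ₜ (1 : H)) := by
  rw [biproductMul_eq]
  -- The four conditions on the exchange map say that `H` acts on products by its coproduct, that
  -- the action is multiplicative, that 1 acts as identity, and that `H` acts on 1 by the counit.
  refine twistedMul_isUnitalAssoc _ (fun h a a' => ?_) (fun h h' a => ?_) (fun a => ?_) fun h => ?_
  · simp only [smash_tmul, hY.act_mul, sw_tmul]
    simp (disch := fun_prop) only [sw_sw, sw_pure]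
    exact sw_coassoc h (fun x y z => (Y.act (x ⊗ₜ a) * Y.act (y ⊗ₜ a')) ⊗ₜ[k] z) (by fun_prop)
      (by fun_prop) (by fun_prop)
  · simp only [smash_tmul]
    simp (disch := fun_prop) only [sw_sw, sw_pure, sw_comul_mul, hY.mul_act]
    rw [sw_comm]
  · rw [smash_tmul]
    simp (disch := fun_prop) only [sw_comul_one, hY.one_act]
  · simp only [smash_tmul, hY.act_one, smul_tmul, tmul_smul]
    simp (disch := fun_prop) only [sw_counit_left]

theorem biproductMul_left (a a' : R) (h : H) :
    biproductMul Y ((a ⊗ₜ 1) ⊗ₜ (a' ⊗ₜ h)) = (a * a') ⊗ₜ h := by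
  rw [biproductMul_tmul]
  simp (disch := fun_prop) only [sw_comul_one, hY.one_act, one_mul]

theorem biproductMul_right (a : R) (h h' : H) :
    biproductMul Y ((a ⊗ₜ h) ⊗ₜ (1 ⊗ₜ h')) = a ⊗ₜ (h * h') := by
  simp only [biproductMul_tmul, hY.act_one, mul_smul_comm, mul_one]
  simp only [← smul_tmul']
  exact sw_counit_left h (fun z => a ⊗ₜ[k] (z * h')) (by fun_prop)

omit hY in
@[fun_prop]
theorem isLinearMap_assoc {L M N Q : Type*} [AddCommGroup L] [Module k L] [AddCommGroup M]
    [Module k M] [AddCommGroup N] [Module k N] [AddCommGroup Q] [Module k Q]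
    {f : L → (M ⊗[k] N) ⊗[k] Q} (hf : IsLinearMap k f) :
    IsLinearMap k fun x => TensorProduct.assoc k M N Q (f x) :=
  ((TensorProduct.assoc k M N Q).toLinearMap ∘ₗ hf.mk').isLinear

/-- Colinearity of the coproduct of `R` moves the coaction past it. What remains is coassociativity
of `R`, of `H` and of the coaction. -/
theorem biproduct_coassoc (c : R ⊗[k] H) :
    TensorProduct.assoc k _ _ _ ((biproductComul Y).rTensor _ (biproductComul Y c)) =
      (biproductComul Y).lTensor _ (biproductComul Y c) := by
  revert c
  refine eq_of_eq_tmul (k := k) (by fun_prop) (by fun_prop) fun a h => ?_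
  simp only [biproductComul_tmul, map_sw, LinearMap.rTensor_tmul, LinearMap.lTensor_tmul,
    sw_tmul, tmul_sw, TensorProduct.assoc_tmul]
  simp (disch := fun_prop) only [sw_comul_mul]
  simp only [sw_comm (comul h)]
  simp (disch := fun_prop) only [sw_coassoc, sw_coassoc_across, hY.sw_comul_coact]
  refine sw_congr _ fun a₁ b => sw_congr _ fun a₂ a₃ => ?_
  rw [sw_comm]
  refine sw_congr _ fun v p => ?_
  simp (disch := fun_prop) only [← hY.sw_coact_coassoc]
  simp only [mul_assoc]

/-- The Yetter-Drinfeld condition applied to the two middle legs of a fourfold coproduct of `h`,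
with the outer legs as spectators. This is the step of `biproduct_comul_mul` that depends on it. -/
theorem IsBraidedHopf.sw_coact_act (h : H) (b : R) (G : H → H → R → H → P)
    (h₁ : ∀ y z w, IsLinearMap k fun x => G x y z w)
    (h₂ : ∀ x z w, IsLinearMap k fun y => G x y z w)
    (h₃ : ∀ x y w, IsLinearMap k fun z => G x y z w)
    (h₄ : ∀ x y z, IsLinearMap k fun w => G x y z w) :
    (sw (comul (R := k) h) fun x y => sw (comul (R := k) x) fun g₁ g₂ =>
      sw (Y.coact (Y.act (g₂ ⊗ₜ b))) fun v y₀ => sw (comul (R := k) y) fun g₃ g₄ =>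
        G g₁ (v * g₃) y₀ g₄) =
    sw (comul (R := k) h) fun x y => sw (comul (R := k) x) fun g₁ g₂ =>
      sw (Y.coact b) fun v b₀ => sw (comul (R := k) y) fun g₃ g₄ =>
        G g₁ (g₂ * v) (Y.act (g₃ ⊗ₜ b₀)) g₄ := by
  simp (disch := fun_prop) only [sw_coassoc]
  refine sw_congr _ fun g₁ t => ?_
  have e₁ := sw_coassoc (k := k) t (fun p q r => sw (Y.coact (Y.act (p ⊗ₜ b))) fun v y₀ =>
    G g₁ (v * q) y₀ r) (by fun_prop) (by fun_prop) (by fun_prop)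
  have e₂ := sw_coassoc (k := k) t (fun p q r => sw (Y.coact b) fun v y₀ =>
    G g₁ (p * v) (Y.act (q ⊗ₜ y₀)) r) (by fun_prop) (by fun_prop) (by fun_prop)
  have e₃ (p r : H) := hY.sw_compat p b (fun u n => G g₁ u n r) (by fun_prop) (by fun_prop)
  simp only [e₃] at e₁
  rw [e₁] at e₂
  have hc (u : H ⊗[k] R) (v : H) (f : H → R → H → H → P) := sw_comm u (comul (R := k) v) f
  simp only [hc]
  exact e₂

theorem biproduct_comul_mul (x y : R ⊗[k] H) :
    biproductComul Y (biproductMul Y (x ⊗ₜ y)) =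
    TensorProduct.map (biproductMul Y) (biproductMul Y)
      (TensorProduct.tensorTensorTensorComm k _ _ _ _
        (biproductComul Y x ⊗ₜ biproductComul Y y)) := by
  revert x
  refine eq_of_eq_tmul (k := k) (by fun_prop) (by fun_prop) fun a h => ?_
  revert y
  refine eq_of_eq_tmul (k := k) (by fun_prop) (by fun_prop) fun a' h' => ?_
  simp only [biproductMul_tmul, map_sw, biproductComul_tmul, sw_tmul]
  simp only [tmul_sw, map_sw, tensorTensorTensorComm_tmul, TensorProduct.map_tmul,
    biproductMul_tmul, sw_tmul]
  simp (disch := fun_prop) only [sw_comul_mul, hY.sw_comul_mul, hY.sw_coact_mul, hY.sw_comul_act]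
  calc _ = sw (comul (R := k) a) fun a₁ x => sw (Y.coact x) fun u y => sw (Y.coact y) fun w a₂ =>
        sw (comul (R := k) a') fun b₁ b₂ => sw (comul (R := k) h) fun x y =>
          sw (comul (R := k) x) fun g₁ g₂ => sw (Y.coact (Y.act (g₂ ⊗ₜ b₂))) fun v b₀ =>
            sw (comul (R := k) y) fun g₃ g₄ => sw (comul (R := k) h') fun h₁ h₂ =>
              ((a₁ * Y.act (u ⊗ₜ Y.act (g₁ ⊗ₜ b₁))) ⊗ₜ[k] (w * (v * g₃) * h₁)) ⊗ₜ[k]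
                ((a₂ * b₀) ⊗ₜ[k] (g₄ * h₂)) := by
        simp only [sw_comm (comul h)]
        refine sw_congr _ fun a₁ x => sw_congr _ fun u y => ?_
        simp only [sw_comm (Y.coact y), sw_comm (comul a'), mul_assoc]
    _ = sw (comul (R := k) a) fun a₁ x => sw (Y.coact x) fun u y => sw (Y.coact y) fun w a₂ =>
        sw (comul (R := k) a') fun b₁ b₂ => sw (comul (R := k) h) fun x y =>
          sw (comul (R := k) x) fun g₁ g₂ => sw (Y.coact b₂) fun v b₀ =>
            sw (comul (R := k) y) fun g₃ g₄ => sw (comul (R := k) h') fun h₁ h₂ =>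
              ((a₁ * Y.act (u ⊗ₜ Y.act (g₁ ⊗ₜ b₁))) ⊗ₜ[k] (w * (g₂ * v) * h₁)) ⊗ₜ[k]
                ((a₂ * Y.act (g₃ ⊗ₜ b₀)) ⊗ₜ[k] (g₄ * h₂)) := by
        refine sw_congr _ fun a₁ x => sw_congr _ fun u y => sw_congr _ fun w a₂ =>
          sw_congr _ fun b₁ b₂ => ?_
        exact hY.sw_coact_act h b₂ (fun g₁ p q r => sw (comul (R := k) h') fun h₁ h₂ =>
          ((a₁ * Y.act (u ⊗ₜ Y.act (g₁ ⊗ₜ b₁))) ⊗ₜ[k] (w * p * h₁)) ⊗ₜ[k]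
                ((a₂ * q) ⊗ₜ[k] (r * h₂))) (by fun_prop) (by fun_prop) (by fun_prop) (by fun_prop)
    _ = _ := by
        simp (disch := fun_prop) only [← hY.sw_coact_coassoc]
        refine sw_congr _ fun a₁ x => sw_congr _ fun x y => ?_
        have hc (t : H ⊗[k] H) (b : R) (f : H → H → H → R → (R ⊗[k] H) ⊗[k] (R ⊗[k] H)) :=
          sw_comm t (Y.coact b) f
        simp only [sw_comm (comul x)]
        simp only [hc]
        simp only [sw_comm (comul h')]
        simp only [sw_comm (comul h)]
        refine sw_congr _ fun b₁ b₂ => sw_congr _ fun v b₀ => sw_congr _ fun g g' => ?_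
        rw [sw_comm]
        simp only [sw_comm (comul x)]
        simp only [sw_comm (comul h'), hY.mul_act, mul_assoc]

/-- The summand is S_H((a₁)₋₁ (a₂)₋₁ h₁) times S((a₁)₀)(a₂)₀ ⊗ h₂. Colinearity of the coproduct
combines the two coactions into one of `a`, so the braided antipode axiom applies. Colinearity of
the counit and the antipode of `H` finish. -/
theorem biproduct_antipode_left (x : R ⊗[k] H) :
    biproductMul Y ((biproductAntipode Y S).rTensor _ (biproductComul Y x)) =
      (biproduct Y S).counit x • ((1 : R) ⊗ₜ[k] (1 : H)) := by
  revert x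
  refine eq_of_eq_tmul (k := k) (by fun_prop) (by fun_prop) fun a h => ?_
  have e (u v g h : H) (b c : R) : biproductMul Y (biproductMul Y
      ((1 ⊗ₜ (antipode k (v * g) * antipode k u)) ⊗ₜ (b ⊗ₜ 1)) ⊗ₜ (c ⊗ₜ h)) =
      biproductMul Y ((1 ⊗ₜ antipode k (u * v * g)) ⊗ₜ ((b * c) ⊗ₜ h)) := by
    rw [(biproduct_isUnitalAssoc hY).mul_assoc, biproductMul_left hY, mul_assoc u,
      HopfAlgebra.antipode_mul_antidistrib u]
  simp only [biproductComul_tmul, map_sw, LinearMap.rTensor_tmul, biproductAntipode_tmul,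
    sw_tmul, e, sw_comm (comul h)]
  calc _ = sw (comul (R := k) a) fun x y => sw (Y.coact x) fun u b => sw (Y.coact y) fun v c =>
        sw (comul (R := k) h) fun h₁ h₂ =>
          biproductMul Y ((1 ⊗ₜ antipode k (u * v * h₁)) ⊗ₜ ((S b * c) ⊗ₜ h₂)) :=
        sw_congr _ fun x y => sw_comm _ _ _
    _ = sw (Y.coact a) fun u a₀ => counit (R := k) a₀ • sw (comul (R := k) h) fun h₁ h₂ =>
          biproductMul Y ((1 ⊗ₜ antipode k (u * h₁)) ⊗ₜ (1 ⊗ₜ h₂)) := by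
        rw [← hY.sw_comul_coact a (fun u b c => sw (comul (R := k) h) fun h₁ h₂ =>
          biproductMul Y ((1 ⊗ₜ antipode k (u * h₁)) ⊗ₜ ((S b * c) ⊗ₜ h₂))) (by fun_prop)
          (by fun_prop) (by fun_prop)]
        exact sw_congr _ fun u a₀ => hY.sw_antipode_left a₀ (fun z => sw (comul (R := k) h)
          fun h₁ h₂ => biproductMul Y ((1 ⊗ₜ antipode k (u * h₁)) ⊗ₜ (z ⊗ₜ h₂))) (by fun_prop)
    _ = _ := by
        rw [hY.sw_coact_counit a (fun u => sw (comul (R := k) h) fun h₁ h₂ =>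
          biproductMul Y ((1 ⊗ₜ antipode k (u * h₁)) ⊗ₜ (1 ⊗ₜ h₂))) (by fun_prop)]
        simp only [biproductMul_right hY, one_mul]
        rw [sw_antipode_left h (fun z => (1 : R) ⊗ₜ[k] z) (by fun_prop), smul_smul]
        rfl

/-- Cancellation runs from the inside outwards: first h₁ S(h₂), then the two legs of the coaction by
its coassociativity, and last the braided antipode. -/
theorem biproduct_antipode_right (x : R ⊗[k] H) :
    biproductMul Y ((biproductAntipode Y S).lTensor _ (biproductComul Y x)) =
      (biproduct Y S).counit x • ((1 : R) ⊗ₜ[k] (1 : H)) := by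
  revert x
  refine eq_of_eq_tmul (k := k) (by fun_prop) (by fun_prop) fun a h => ?_
  have e (u v g h : H) (b c : R) : biproductMul Y ((b ⊗ₜ (u * g)) ⊗ₜ biproductMul Y
      ((1 ⊗ₜ (antipode k h * antipode k v)) ⊗ₜ (c ⊗ₜ 1))) =
      biproductMul Y ((b ⊗ₜ (u * (g * antipode k h) * antipode k v)) ⊗ₜ (c ⊗ₜ 1)) := by
    rw [← (biproduct_isUnitalAssoc hY).mul_assoc, biproductMul_right hY]
    simp only [mul_assoc]
  simp only [biproductComul_tmul, map_sw, LinearMap.lTensor_tmul, biproductAntipode_tmul,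
    tmul_sw, e, sw_comm (comul h)]
  calc _ = sw (comul (R := k) a) fun x y => sw (Y.coact y) fun u b => sw (Y.coact b) fun v c =>
        counit (R := k) h • biproductMul Y ((x ⊗ₜ (u * antipode k v)) ⊗ₜ (S c ⊗ₜ 1)) := by
        refine sw_congr _ fun x y => sw_congr _ fun u b => sw_congr _ fun v c => ?_
        rw [sw_antipode_right h (fun z => biproductMul Y
          ((x ⊗ₜ (u * z * antipode k v)) ⊗ₜ (S c ⊗ₜ 1))) (by fun_prop), mul_one]
    _ = sw (comul (R := k) a) fun x y => counit (R := k) h • ((x * S y) ⊗ₜ 1) := by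
        refine sw_congr _ fun x y => ?_
        rw [← hY.sw_coact_coassoc y (fun u v c => counit (R := k) h •
          biproductMul Y ((x ⊗ₜ (u * antipode k v)) ⊗ₜ (S c ⊗ₜ 1))) (by fun_prop) (by fun_prop)
          (by fun_prop), ← biproductMul_left hY, ← hY.sw_counit_coact y (fun c =>
          counit (R := k) h • biproductMul Y ((x ⊗ₜ 1) ⊗ₜ (S c ⊗ₜ 1))) (by fun_prop)]
        exact sw_congr _ fun u c => sw_antipode_right u (fun z => counit (R := k) h •
          biproductMul Y ((x ⊗ₜ z) ⊗ₜ (S c ⊗ₜ 1))) (by fun_prop)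
    _ = _ := by
        rw [hY.sw_antipode_right a (fun z => counit (R := k) h • z ⊗ₜ[k] (1 : H)) (by fun_prop),
          smul_smul]
        rfl

theorem biproduct_isHopf : (biproduct Y S).IsHopf where
  algebra := biproduct_isUnitalAssoc hY
  coassoc := biproduct_coassoc hY
  counit_comul c := by
    revert c
    refine eq_of_eq_tmul (k := k) (by fun_prop) (by fun_prop) fun a h => ?_
    simp only [biproduct, biproductComul_tmul, map_sw, LinearMap.rTensor_tmul,
      LinearMap.comp_apply, TensorProduct.map_tmul, LinearMap.mul'_apply, TensorProduct.lid_tmul,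
      Bialgebra.counit_mul, mul_smul]
    have e (b : R) := sw_counit_left h (fun z => b ⊗ₜ[k] z) (by fun_prop)
    have e' (b : R) := hY.sw_counit_coact b (fun z => z ⊗ₜ[k] h) (by fun_prop)
    simp only [← smul_sw, e, e']
    exact sw_counit_left a (fun z => z ⊗ₜ[k] h) (by fun_prop)
  comul_counit c := by
    revert c
    refine eq_of_eq_tmul (k := k) (by fun_prop) (by fun_prop) fun a h => ?_
    simp only [biproduct, biproductComul_tmul, map_sw, LinearMap.lTensor_tmul,
      LinearMap.comp_apply, TensorProduct.map_tmul, LinearMap.mul'_apply, TensorProduct.rid_tmul, mul_smul]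
    have e (u : H) (b : R) := sw_counit_right h (fun z => b ⊗ₜ[k] (u * z)) (by fun_prop)
    have e' (b c : R) := hY.sw_coact_counit b (fun z => c ⊗ₜ[k] (z * h)) (by fun_prop)
    simp only [← smul_sw, e, e', one_mul]
    exact sw_counit_right a (fun z => z ⊗ₜ[k] h) (by fun_prop)
  comul_one := by
    simp only [biproduct, biproductComul_tmul]
    simp (disch := fun_prop) only [sw_comul_one, hY.sw_comul_one, hY.sw_coact_one, one_mul]
  comul_mul := biproduct_comul_mul hY
  counit_one := by simp [biproduct, hY.counit_one]
  counit_mul x y := by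
    revert x
    refine eq_of_eq_tmul (k := k) (by fun_prop) (by fun_prop) fun a h => ?_
    revert y
    refine eq_of_eq_tmul (k := k) (by fun_prop) (by fun_prop) fun a' h' => ?_
    simp only [biproduct, biproductMul_tmul, map_sw,
      LinearMap.comp_apply, TensorProduct.map_tmul, LinearMap.mul'_apply, hY.counit_mul,
      Bialgebra.counit_mul, hY.counit_act]
    rw [← sw_counit_left h (fun z => counit (R := k) a * counit (R := k) z *
      (counit (R := k) a' * counit (R := k) h')) (by fun_prop)]
    refine sw_congr _ fun x y => ?_
    rw [smul_eq_mul]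
    ring
  antipode_left := biproduct_antipode_left hY
  antipode_right := biproduct_antipode_right hY

end BiproductAxioms

/-! ### From instance Hopf algebras to bare structure maps. -/

section Transfer

universe u v

variable {k : Type u} [Field k]

/-- A property of Hopf algebras of the library holds for all structure maps that satisfy the
axioms of a Hopf algebra. -/
theorem HopfOps.IsHopf.transfer
    {C : ∀ (A : Type v) [AddCommGroup A] [Module k A], HopfOps k A → Prop}
    (h : ∀ (A : Type v) [Ring A] [HopfAlgebra k A], C A (HopfOps.of k A))
    {A : Type v} [inst : AddCommGroup A] [instM : Module k A] {O : HopfOps k A} (hO : O.IsHopf) :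
    C A O := by
  let ring : Ring A :=
    { inst with
      mul := fun a b => O.mul (a ⊗ₜ b)
      one := O.one
      mul_assoc := hO.algebra.mul_assoc
      one_mul := hO.algebra.one_mul
      mul_one := hO.algebra.mul_one
      left_distrib := fun a b c => by
        change O.mul (a ⊗ₜ (b + c)) = O.mul (a ⊗ₜ b) + O.mul (a ⊗ₜ c)
        rw [TensorProduct.tmul_add, map_add]
      right_distrib := fun a b c => by
        change O.mul ((a + b) ⊗ₜ c) = O.mul (a ⊗ₜ c) + O.mul (b ⊗ₜ c)
        rw [TensorProduct.add_tmul, map_add]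
      zero_mul := fun a => by
        change O.mul (0 ⊗ₜ a) = 0
        rw [TensorProduct.zero_tmul, map_zero]
      mul_zero := fun a => by
        change O.mul (a ⊗ₜ 0) = 0
        rw [TensorProduct.tmul_zero, map_zero] }
  let alg : Algebra k A := @Algebra.ofModule k A _ _ instM
    (fun c a b => by
      change O.mul ((c • a) ⊗ₜ b) = c • O.mul (a ⊗ₜ b)
      rw [← TensorProduct.smul_tmul', map_smul])
    (fun c a b => by
      change O.mul (a ⊗ₜ (c • b)) = c • O.mul (a ⊗ₜ b)
      rw [TensorProduct.tmul_smul, map_smul])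
  let coalg : Coalgebra k A :=
    { comul := O.comul
      counit := O.counit
      coassoc := LinearMap.ext hO.coassoc
      rTensor_counit_comp_comul := LinearMap.ext fun a => by
        apply (TensorProduct.lid k A).injective
        refine (hO.counit_comul a).trans ?_
        simp
      lTensor_counit_comp_comul := LinearMap.ext fun a => by
        apply (TensorProduct.rid k A).injective
        refine (hO.comul_counit a).trans ?_
        simp }
  have hmul : O.mul = LinearMap.mul' k A := TensorProduct.ext' fun a b => rfl
  have hcm (a b : A) : O.comul (a * b) = O.comul a * O.comul b := by
    refine (hO.comul_mul a b).trans ?_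
    conv_lhs => rw [← sw_tmul_eq (O.comul a), ← sw_tmul_eq (O.comul b)]
    conv_rhs => rw [← sw_tmul_eq (O.comul a), ← sw_tmul_eq (O.comul b)]
    simp only [sw_tmul, sw_mul]
    simp only [tmul_sw, map_sw, mul_sw, TensorProduct.tensorTensorTensorComm_tmul,
      TensorProduct.map_tmul, Algebra.TensorProduct.tmul_mul_tmul]
    rfl
  let bialg : Bialgebra k A := Bialgebra.mk' k A hO.counit_one (fun {a b} => hO.counit_mul a b)
    hO.comul_one (fun {a b} => hcm a b)
  let hopf : HopfAlgebra k A :=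
    { bialg with
      antipode := O.antipode
      mul_antipode_rTensor_comul := LinearMap.ext fun a => by
        rw [← hmul]
        refine (hO.antipode_left a).trans ?_
        exact (Algebra.algebraMap_eq_smul_one _).symm
      mul_antipode_lTensor_comul := LinearMap.ext fun a => by
        rw [← hmul]
        refine (hO.antipode_right a).trans ?_
        exact (Algebra.algebraMap_eq_smul_one _).symm }
  -- The local instances extend the given additive group and module, so reading the operations back
  -- gives `O` itself.
  have e : HopfOps.of k A = O := by
    cases O
    simp only [HopfOps.of, HopfOps.mk.injEq]
    exact ⟨hmul.symm, rfl, rfl, rfl, rfl⟩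
  have hA := h A
  rw [e] at hA
  exact hA

end Transfer

/-! ### The results on the double for bare structure maps. -/

section Raw

/-- Multiplication `mul` and unit `one` make the Yetter-Drinfeld module `Z` an algebra in the
category of Yetter-Drinfeld modules. -/
structure IsYDMonoid {k D N : Type*} [Field k] [AddCommGroup D] [Module k D] [AddCommGroup N]
    [Module k N] (O : HopfOps k D) (Z : YDOps k D N) (mul : N ⊗[k] N →ₗ[k] N) (one : N) :
    Prop where
  yd : IsYetterDrinfeld O Z
  mul_hom : IsYDHom (Z.tensor O Z) Z mul
  one_hom : IsYDHom (YDOps.unit O) Z (LinearMap.toSpanSingleton k N one)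

theorem IsYDAlgebra.isYDMonoid {k D N : Type*} [Field k] [AddCommGroup D] [Module k D] [Ring N]
    [Algebra k N] {O : HopfOps k D} {Z : YDOps k D N} (hZ : IsYDAlgebra O Z) :
    IsYDMonoid O Z (LinearMap.mul' k N) 1 where
  yd := hZ.yd
  mul_hom := hZ.mul_hom
  one_hom := by
    have e : LinearMap.toSpanSingleton k N 1 = Algebra.linearMap k N := by ext; simp
    rw [e]
    exact hZ.one_hom

universe u v w

variable {k : Type u} [Field k] {A : Type v} [AddCommGroup A] [Module k A] {B : Type w}
  [AddCommGroup B] [Module k B] {O : HopfOps k A} {P : HopfOps k B} {φ : A →ₗ[k] B →ₗ[k] k}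

/-- A property of pairings of Hopf algebras of the library holds for all pairings. -/
theorem IsHopfPairing.transfer
    {C : ∀ (A : Type v) [AddCommGroup A] [Module k A] (B : Type w) [AddCommGroup B] [Module k B],
      HopfOps k A → HopfOps k B → (A →ₗ[k] B →ₗ[k] k) → Prop}
    (h : ∀ (A : Type v) [Ring A] [HopfAlgebra k A] (B : Type w) [Ring B] [HopfAlgebra k B]
      (φ : A →ₗ[k] B →ₗ[k] k), IsHopfPairing (HopfOps.of k A) (HopfOps.of k B) φ →
      C A B (HopfOps.of k A) (HopfOps.of k B) φ)
    (hO : O.IsHopf) (hP : P.IsHopf) (hφ : IsHopfPairing O P φ) : C A B O P φ := by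
  -- The two algebras are replaced one at a time. The predicate quantifies over `φ`, whose type
  -- changes with them.
  have h₁ : ∀ (A : Type v) [Ring A] [HopfAlgebra k A] (φ : A →ₗ[k] B →ₗ[k] k),
      IsHopfPairing (HopfOps.of k A) P φ → C A B (HopfOps.of k A) P φ := fun A _ _ =>
    HopfOps.IsHopf.transfer (C := fun B _ _ P => ∀ φ : A →ₗ[k] B →ₗ[k] k,
      IsHopfPairing (HopfOps.of k A) P φ → C A B (HopfOps.of k A) P φ) (fun B _ _ => h A B) hP
  exact HopfOps.IsHopf.transfer (C := fun A _ _ O => ∀ φ : A →ₗ[k] B →ₗ[k] k,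
    IsHopfPairing O P φ → C A B O P φ) (fun A _ _ => h₁ A) hO φ hφ

theorem double_isHopf (hO : O.IsHopf) (hP : P.IsHopf) (hφ : IsHopfPairing O P φ) :
    (double O P φ).IsHopf :=
  hφ.transfer (C := fun _ _ _ _ _ _ O P φ => (double O P φ).IsHopf)
    (fun _ _ _ _ _ _ _ hφ => double_of_isHopf hφ) hO hP

theorem schroedingerPlus_isYDMonoid (hO : O.IsHopf) (hP : P.IsHopf) (hφ : IsHopfPairing O P φ) :
    IsYDMonoid (double O P φ) (schroedingerPlus O P φ) O.mul O.one :=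
  hφ.transfer (C := fun _ _ _ _ _ _ O P φ =>
    IsYDMonoid (double O P φ) (schroedingerPlus O P φ) O.mul O.one)
    (fun _ _ _ _ _ _ _ hφ => (schroedingerPlus_isYDAlgebra hφ).isYDMonoid) hO hP

theorem schroedingerMinus_isYDMonoid (hO : O.IsHopf) (hP : P.IsHopf) (hφ : IsHopfPairing O P φ) :
    IsYDMonoid (double O P φ) (schroedingerMinus O P φ) P.mul P.one :=
  hφ.transfer (C := fun _ _ _ _ _ _ O P φ =>
    IsYDMonoid (double O P φ) (schroedingerMinus O P φ) P.mul P.one)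
    (fun _ _ _ _ _ _ _ hφ => (schroedingerMinus_isYDAlgebra hφ).isYDMonoid) hO hP

theorem double_mul_tmul_one (hO : O.IsHopf) (hP : P.IsHopf) (hφ : IsHopfPairing O P φ) (a a' : A) :
    (double O P φ).mul ((a ⊗ₜ P.one) ⊗ₜ (a' ⊗ₜ P.one)) = O.mul (a ⊗ₜ a') ⊗ₜ P.one :=
  hφ.transfer (C := fun A _ _ _ _ _ O P φ => ∀ a a' : A,
    (double O P φ).mul ((a ⊗ₜ P.one) ⊗ₜ (a' ⊗ₜ P.one)) = O.mul (a ⊗ₜ a') ⊗ₜ P.one)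
    (fun _ _ _ _ _ _ _ hφ a a' => double_mul_left hφ a a' 1) hO hP a a'

theorem HopfOps.IsHopf.adjoint_mul (hO : O.IsHopf) (a a' x : A) :
    O.adjoint (O.mul (a ⊗ₜ a') ⊗ₜ x) = O.adjoint (a ⊗ₜ O.adjoint (a' ⊗ₜ x)) :=
  hO.transfer (C := fun A _ _ O => ∀ a a' x : A,
    O.adjoint (O.mul (a ⊗ₜ a') ⊗ₜ x) = O.adjoint (a ⊗ₜ O.adjoint (a' ⊗ₜ x)))
    (fun _ _ _ => NicholsDouble.adjoint_mul) a a' x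

theorem HopfOps.IsHopf.adjoint_one (hO : O.IsHopf) (x : A) : O.adjoint (O.one ⊗ₜ x) = x :=
  hO.transfer (C := fun A _ _ O => ∀ x : A, O.adjoint (O.one ⊗ₜ x) = x)
    (fun _ _ _ => NicholsDouble.adjoint_one) x

/-- A left coideal of `A` stays one in the double under a ↦ a ⊗ 1. With `i` the inclusion of `R`,
the tensor `t` becomes the coaction on `R`. -/
theorem double_comul_tmul_one (hP : P.IsHopf) {N : Type*} [AddCommGroup N] [Module k N]
    (i : N →ₗ[k] A) (t : A ⊗[k] N) (a : A) (h : O.comul a = i.lTensor A t) :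
    (double O P φ).comul (a ⊗ₜ P.one) = ((TensorProduct.mk k A B).flip P.one ∘ₗ i).lTensor _
      (((TensorProduct.mk k A B).flip P.one).rTensor N t) := by
  simp only [double, tensorComul, LinearMap.comp_apply, TensorProduct.map_tmul, hP.comul_one, h]
  conv_lhs => rw [← sw_tmul_eq t]
  conv_rhs => rw [← sw_tmul_eq t]
  simp only [sw_tmul, map_sw, LinearEquiv.coe_coe, TensorProduct.tensorTensorTensorComm_tmul,
    LinearMap.lTensor_tmul, LinearMap.rTensor_tmul]
  rfl

theorem HopfOps.adjoint_eq_sw (O : HopfOps k A) (a x : A) : O.adjoint (a ⊗ₜ x) =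
    sw (O.comul a) fun a₁ a₂ => O.mul (O.mul (a₁ ⊗ₜ x) ⊗ₜ O.antipode a₂) := by
  simp only [HopfOps.adjoint, LinearMap.comp_apply, LinearMap.rTensor_tmul, LinearEquiv.coe_coe]
  conv_lhs => rw [← sw_tmul_eq (O.comul a)]
  simp only [sw_tmul, map_sw, TensorProduct.rightComm_tmul, TensorProduct.map_tmul]

theorem contractPlus_eq_sw (b : B) (x : A) : contractPlus O P φ (b ⊗ₜ x) =
    sw (O.comul x) fun x₁ x₂ => φ x₁ (P.antipode b) • x₂ := by
  simp only [contractPlus, LinearMap.comp_apply, LinearMap.lTensor_tmul, LinearEquiv.coe_coe]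
  conv_lhs => rw [← sw_tmul_eq (O.comul x)]
  simp only [tmul_sw, map_sw, TensorProduct.assoc_symm_tmul, LinearMap.rTensor_tmul,
    LinearMap.comp_apply, LinearEquiv.coe_coe, TensorProduct.comm_tmul, TensorProduct.lid_tmul,
    pairingInv, LinearMap.lTensor_tmul, TensorProduct.lift.tmul]

theorem contractMinus_eq_sw (a : A) (y : B) : contractMinus P φ (a ⊗ₜ y) =
    sw (P.comul y) fun y₁ y₂ => φ a y₁ • y₂ := by
  simp only [contractMinus, LinearMap.comp_apply, LinearMap.lTensor_tmul, LinearEquiv.coe_coe]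
  conv_lhs => rw [← sw_tmul_eq (P.comul y)]
  simp only [tmul_sw, map_sw, TensorProduct.assoc_symm_tmul, LinearMap.rTensor_tmul,
    TensorProduct.lid_tmul, TensorProduct.lift.tmul]

end Raw

/-! ### Restriction of Yetter-Drinfeld module algebras. -/

section Restrict

variable {k D M N : Type*} [Field k] [AddCommGroup D] [Module k D]
  [Ring M] [Algebra k M] [AddCommGroup N] [Module k N]
  {i : M →ₗ[k] N} {Y : YDOps k D M} {Z : YDOps k D N}

theorem IsRestriction.sw_coact {P : Type*} [AddCommGroup P] [Module k P] (h : IsRestriction i Y Z)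
    (m : M) (f : D → N → P)
    (h₁ : ∀ y, IsLinearMap k fun x => f x y) (h₂ : ∀ x, IsLinearMap k fun y => f x y) :
    sw (Z.coact (i m)) f = sw (Y.coact m) fun u n => f u (i n) := by
  rw [← h.coact_eq, map_eq_sw (LinearMap.lTensor _ _)]
  simp (disch := fun_prop) only [LinearMap.lTensor_tmul, sw_sw, sw_pure]

/-- A restriction of an algebra in the category of Yetter-Drinfeld modules to a subalgebra. -/
theorem IsRestriction.isYDAlgebra (h : IsRestriction i Y Z) (hi : Function.Injective i)
    {O : HopfOps k D} {mul : N ⊗[k] N →ₗ[k] N} {one : N} (hZ : IsYDMonoid O Z mul one)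
    (hmul : ∀ x y, i (x * y) = mul (i x ⊗ₜ i y)) (hone : i 1 = one) : IsYDAlgebra O Y := by
  -- Over a field every module is flat, so equations in `M`, D ⊗ M and D ⊗ (D ⊗ M) may all be
  -- checked after applying `i` to the last factor.
  have hD : Function.Injective (i.lTensor D) :=
    Module.Flat.lTensor_preserves_injective_linearMap i hi
  have hDD : Function.Injective ((i.lTensor D).lTensor D) :=
    Module.Flat.lTensor_preserves_injective_linearMap _ hD
  refine ⟨⟨⟨fun m => hi ?_, fun a b m => hi ?_⟩, fun m => hi ?_, fun m => hDD ?_, fun d m => hD ?_⟩,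
    ⟨fun d t => hi ?_, fun t => hD ?_⟩, ⟨fun d c => hi ?_, fun c => hD ?_⟩⟩
  · rw [h.act_eq, hZ.yd.module.one_act]
  · simp only [h.act_eq, hZ.yd.module.mul_act]
  · refine Eq.trans ?_ (hZ.yd.counit_coact (i m))
    rw [map_eq_sw (LinearMap.rTensor M O.counit), map_eq_sw (LinearMap.rTensor N O.counit),
      h.sw_coact _ _ (by fun_prop) (by fun_prop)]
    simp only [map_sw, LinearMap.rTensor_tmul, TensorProduct.lid_tmul, map_smul]
  · have e := hZ.yd.coassoc (i m)
    rw [map_eq_sw (LinearMap.rTensor N O.comul), map_eq_sw (LinearMap.lTensor D Z.coact),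
      h.sw_coact _ _ (by fun_prop) (by fun_prop), h.sw_coact _ _ (by fun_prop) (by fun_prop)] at e
    rw [map_eq_sw (LinearMap.rTensor M O.comul), map_eq_sw (LinearMap.lTensor D Y.coact)]
    simp only [map_sw, LinearMap.rTensor_tmul, LinearMap.lTensor_tmul, h.coact_eq] at e ⊢
    rw [← e]
    refine sw_congr _ fun d n => ?_
    conv_lhs => rw [← sw_tmul_eq (O.comul d)]
    conv_rhs => rw [← sw_tmul_eq (O.comul d)]
    simp only [sw_tmul, map_sw, TensorProduct.assoc_tmul, LinearMap.lTensor_tmul]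
  · have e := hZ.yd.compat d (i m)
    simp only [ydLeft_tmul, ydRight_tmul, ← h.act_eq] at e ⊢
    simp (disch := fun_prop) only [h.sw_coact] at e
    simpa only [map_sw, LinearMap.lTensor_tmul, h.act_eq] using e
  · revert t
    refine eq_of_eq_tmul (k := k) (by fun_prop) (by fun_prop) fun x y => ?_
    have e := hZ.mul_hom.map_act d (i x ⊗ₜ i y)
    rw [tensor_act_tmul] at e ⊢
    simpa only [map_sw, LinearMap.mul'_apply, h.act_eq, hmul] using e
  · revert t
    refine eq_of_eq_tmul (k := k) (by fun_prop) (by fun_prop) fun x y => ?_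
    have e := hZ.mul_hom.map_coact (i x ⊗ₜ i y)
    rw [tensor_coact_tmul] at e ⊢
    simp (disch := fun_prop) only [h.sw_coact] at e
    simpa only [map_sw, LinearMap.mul'_apply, h.coact_eq, hmul, LinearMap.lTensor_tmul] using e
  · have e := hZ.one_hom.map_act d c
    rw [h.act_eq]
    simpa [Algebra.algebraMap_eq_smul_one, hone] using e
  · have e := hZ.one_hom.map_coact c
    rw [h.coact_eq]
    simpa [Algebra.algebraMap_eq_smul_one, hone, YDOps.unit] using e

end Restrict

/-! ### Braided products and their modules. -/

section Product

variable {k D M N : Type*} [Field k] [AddCommGroup D] [Module k D]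
  [Ring M] [Algebra k M] [Ring N] [Algebra k N]
  {O : HopfOps k D} {Y : YDOps k D M} {Z : YDOps k D N}

/-- The braiding respects products of `M` because `M` is a module algebra and the coaction on `N` is
coassociative. It respects products of `N` because that coaction is multiplicative and the action on
`M` is a module structure. -/
theorem braidedMul_isUnitalAssoc (hY : IsYDAlgebra O Y) (hZ : IsYDAlgebra O Z) :
    IsUnitalAssoc (braidedMul Y Z) ((1 : M) ⊗ₜ[k] (1 : N)) := by
  change IsUnitalAssoc (twistedMul (braiding Z Y)) _
  refine twistedMul_isUnitalAssoc _ (fun n m m' => ?_) (fun n n' m => ?_) (fun m => ?_) fun n => ?_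
  · simp only [braiding_tmul, hY.act_mul, sw_tmul]
    simp (disch := fun_prop) only [sw_sw, sw_pure]
    exact hZ.yd.sw_coassoc n (fun u v z => (Y.act (u ⊗ₜ m) * Y.act (v ⊗ₜ m')) ⊗ₜ[k] z) (by fun_prop)
      (by fun_prop) (by fun_prop)
  · simp only [braiding_tmul, hZ.coact_mul]
    simp (disch := fun_prop) only [sw_sw, sw_pure, hY.yd.module.mul_act]
    rw [sw_comm]
  · rw [braiding_tmul, hZ.coact_one, sw_pure _ _ _ (by fun_prop) (by fun_prop),
      hY.yd.module.one_act]
  · simp only [braiding_tmul, hY.act_one, ← TensorProduct.smul_tmul']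
    exact hZ.yd.sw_counit n (fun z => (1 : M) ⊗ₜ[k] z) (by fun_prop)

/-- A braided product `M ⊗ N` acts on `M`, if `N` acts through a morphism `j` to the Hopf algebra
that turns the coaction on `N` into the coproduct. -/
theorem braidedMul_isLeftModule (hY : IsYDAlgebra O Y) (j : N →ₗ[k] D) (hj : j 1 = O.one)
    (hmul : ∀ x y, j (x * y) = O.mul (j x ⊗ₜ j y))
    (hcomul : ∀ x, O.comul (j x) = j.lTensor D (Z.coact x))
    (act : (M ⊗[k] N) ⊗[k] M →ₗ[k] M)
    (hact : ∀ y x z, act ((y ⊗ₜ x) ⊗ₜ z) = y * Y.act (j x ⊗ₜ z)) :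
    IsLeftModule (braidedMul Y Z) ((1 : M) ⊗ₜ[k] (1 : N)) act where
  one_act m := by rw [hact, hj, hY.yd.module.one_act, one_mul]
  mul_act a b m := by
    revert a
    refine eq_of_eq_tmul (k := k) (by fun_prop) (by fun_prop) fun y x => ?_
    revert b
    refine eq_of_eq_tmul (k := k) (by fun_prop) (by fun_prop) fun y' x' => ?_
    -- Acting by `j x` on a product uses the coproduct of `j x`. `hcomul` turns it into x₋₁ ⊗ j(x₀),
    -- which is the braided product formula.
    simp only [braidedMul_tmul, sw_tmul, map_sw, hact, hY.act_mul, hcomul, hmul,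
      hY.yd.module.mul_act]
    rw [map_eq_sw (LinearMap.lTensor _ _)]
    simp (disch := fun_prop) only [sw_sw, sw_pure, LinearMap.lTensor_tmul, mul_sw, mul_assoc]

end Product

/-! ### The subalgebra R of its biproduct. -/

section Subalgebra

open Coalgebra HopfAlgebra TensorProduct

variable {k H : Type*} [Field k] [Ring H] [HopfAlgebra k H]
  {R : Type*} [Ring R] [Algebra k R] [Coalgebra k R] {Y : YDOps k H R} {S : R →ₗ[k] R}

/-- The retraction `a ⊗ h ↦ ε(h) a` of the inclusion of `R` into the biproduct. -/
def retract (k R H : Type*) [Field k] [Ring R] [Algebra k R] [Ring H] [HopfAlgebra k H] :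
    R ⊗[k] H →ₗ[k] R :=
  (TensorProduct.rid k R).toLinearMap ∘ₗ (counit (R := k) (A := H)).lTensor R

omit [Coalgebra k R] in
theorem incl_apply (x : R) : incl k R H x = x ⊗ₜ 1 := rfl

omit [Coalgebra k R] in
theorem retract_incl (x : R) : retract k R H (incl k R H x) = x := by
  simp [retract, incl_apply]

omit [Coalgebra k R] in
theorem incl_injective : Function.Injective (incl k R H) :=
  Function.LeftInverse.injective (g := retract k R H) retract_incl

omit [Coalgebra k R] in
theorem incl_retract {t : R ⊗[k] H} (ht : t ∈ LinearMap.range (incl k R H)) :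
    incl k R H (retract k R H t) = t := by
  obtain ⟨x, rfl⟩ := ht
  rw [retract_incl]

theorem sw_mem {M N P : Type*} [AddCommGroup M] [Module k M] [AddCommGroup N]
    [Module k N] [AddCommGroup P] [Module k P] (p : Submodule k P) (t : M ⊗[k] N) (f : M → N → P)
    (h : ∀ x y, f x y ∈ p) : sw t f ∈ p := by
  refine multiset_sum_mem _ fun z hz => ?_
  obtain ⟨q, -, rfl⟩ := Multiset.mem_map.1 hz
  exact h _ _

/-- The second leg stays in `R`: a left coideal. This lets the coaction restrict and keeps `R`
stable under contractions of the first leg. -/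
theorem biproductComul_incl (x : R) : biproductComul Y (incl k R H x) =
    sw (comul (R := k) x) fun x₁ x₂ => sw (Y.coact x₂) fun u y =>
      (x₁ ⊗ₜ[k] u) ⊗ₜ[k] incl k R H y := by
  rw [incl_apply, biproductComul_tmul]
  simp (disch := fun_prop) only [sw_comul_one, mul_one, incl_apply]

variable (hY : IsBraidedHopf Y S)
include hY

theorem biproductMul_incl (x y : R) :
    incl k R H (x * y) = biproductMul Y (incl k R H x ⊗ₜ incl k R H y) :=
  (biproductMul_left hY x y 1).symm

theorem biproductAntipode_one_tmul (h : H) :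
    biproductAntipode Y S (1 ⊗ₜ h) = 1 ⊗ₜ antipode k h := by
  have h1 : S 1 = 1 := by
    have e := hY.sw_antipode_left 1 (fun z => z) (by fun_prop)
    rw [hY.sw_comul_one _ (by fun_prop) (by fun_prop), mul_one, hY.counit_one, one_smul] at e
    exact e
  rw [biproductAntipode_tmul, hY.sw_coact_one _ (by fun_prop) (by fun_prop), h1,
    biproductMul_right hY]
  simp

/-- Moving `r` to the left of h₁ lets the action appear on it. The legs of `h` left behind cancel
with the antipode. -/
theorem biproduct_conj (h : H) (r : R) :
    (sw (comul (R := k) h) fun h₁ h₂ => biproductMul Y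
      (biproductMul Y ((1 ⊗ₜ h₁) ⊗ₜ (r ⊗ₜ 1)) ⊗ₜ ((1 : R) ⊗ₜ[k] antipode k h₂))) =
      Y.act (h ⊗ₜ r) ⊗ₜ 1 := by
  have e (h₁ h₂ : H) : biproductMul Y
      (biproductMul Y ((1 ⊗ₜ h₁) ⊗ₜ (r ⊗ₜ 1)) ⊗ₜ ((1 : R) ⊗ₜ[k] h₂)) =
      sw (comul (R := k) h₁) fun p q => Y.act (p ⊗ₜ r) ⊗ₜ[k] (q * h₂) := by
    rw [biproductMul_tmul]
    simp only [sw_tmul, map_sw, biproductMul_right hY, mul_one, one_mul]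
  simp only [e]
  rw [sw_coassoc h (fun x y z => Y.act (x ⊗ₜ r) ⊗ₜ[k] (y * antipode k z)) (by fun_prop)
    (by fun_prop) (by fun_prop), ← sw_counit_right h (fun z => Y.act (z ⊗ₜ r) ⊗ₜ[k] (1 : H))
    (by fun_prop)]
  exact sw_congr _ fun x y => sw_antipode_right y (fun z => Y.act (x ⊗ₜ r) ⊗ₜ[k] z) (by fun_prop)

theorem adjoint_one_tmul_incl (h : H) (r : R) :
    (biproduct Y S).adjoint ((1 ⊗ₜ h) ⊗ₜ incl k R H r) = incl k R H (Y.act (h ⊗ₜ r)) := by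
  have e : (biproduct Y S).comul (1 ⊗ₜ h) = sw (comul (R := k) h) fun h₁ h₂ =>
      ((1 : R) ⊗ₜ[k] h₁) ⊗ₜ[k] ((1 : R) ⊗ₜ[k] h₂) := by
    change biproductComul Y (1 ⊗ₜ h) = _
    rw [biproductComul_tmul]
    simp (disch := fun_prop) only [hY.sw_comul_one, hY.sw_coact_one, one_mul]
  rw [HopfOps.adjoint_eq_sw, e]
  simp (disch := fun_prop) only [sw_sw, sw_pure]
  refine Eq.trans ?_ (biproduct_conj hY h r)
  refine sw_congr _ fun h₁ h₂ => ?_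
  rw [← biproductAntipode_one_tmul hY h₂]
  rfl

/-- The result is the braided adjoint action. The biproduct antipode of (a₂)₀ contributes an
antipode of `H`, which together with the leg from the coproduct conjugates `r`. `biproduct_conj`
turns this into the action of (a₂)₋₁. -/
theorem adjoint_tmul_one_incl (a r : R) :
    (biproduct Y S).adjoint ((a ⊗ₜ 1) ⊗ₜ incl k R H r) = incl k R H (
      sw (comul (R := k) a) fun a₁ a₂ => sw (Y.coact a₂) fun u a₃ =>
        a₁ * Y.act (u ⊗ₜ r) * S a₃) := by
  have hA := biproduct_isUnitalAssoc hY
  have e : (biproduct Y S).comul (a ⊗ₜ 1) = sw (comul (R := k) a) fun a₁ a₂ =>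
      sw (Y.coact a₂) fun u a₃ => (a₁ ⊗ₜ[k] u) ⊗ₜ[k] (a₃ ⊗ₜ[k] (1 : H)) :=
    biproductComul_incl a
  rw [HopfOps.adjoint_eq_sw, e]
  simp (disch := fun_prop) only [sw_sw, sw_pure, map_sw]
  refine sw_congr _ fun a₁ a₂ => ?_
  have e₁ (u v : H) (b : R) : biproductMul Y (biproductMul Y ((a₁ ⊗ₜ u) ⊗ₜ (r ⊗ₜ 1)) ⊗ₜ
      biproductMul Y ((1 ⊗ₜ (antipode k (1 : H) * antipode k v)) ⊗ₜ (S b ⊗ₜ 1))) =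
      biproductMul Y (biproductMul Y ((a₁ ⊗ₜ 1) ⊗ₜ (biproductMul Y (biproductMul Y
        ((1 ⊗ₜ u) ⊗ₜ (r ⊗ₜ 1)) ⊗ₜ (1 ⊗ₜ antipode k v)))) ⊗ₜ (S b ⊗ₜ (1 : H))) := by
    simp only [← hA.mul_assoc, biproductMul_left hY, antipode_one, one_mul, mul_one]
  calc _ = sw (Y.coact a₂) fun u b => sw (Y.coact b) fun v c =>
        biproductMul Y (biproductMul Y ((a₁ ⊗ₜ 1) ⊗ₜ (biproductMul Y (biproductMul Y
        ((1 ⊗ₜ u) ⊗ₜ (r ⊗ₜ 1)) ⊗ₜ (1 ⊗ₜ antipode k v)))) ⊗ₜ (S c ⊗ₜ (1 : H))) := by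
        refine sw_congr _ fun u b => ?_
        simp only [← e₁]
        change biproductMul Y (biproductMul Y ((a₁ ⊗ₜ u) ⊗ₜ (r ⊗ₜ 1)) ⊗ₜ
          biproductAntipode Y S (b ⊗ₜ 1)) = _
        rw [biproductAntipode_tmul, tmul_sw, map_sw]
    _ = _ := by
        rw [← hY.sw_coact_coassoc a₂ (fun u v c =>
          biproductMul Y (biproductMul Y ((a₁ ⊗ₜ 1) ⊗ₜ (biproductMul Y (biproductMul Y
          ((1 ⊗ₜ u) ⊗ₜ (r ⊗ₜ 1)) ⊗ₜ (1 ⊗ₜ antipode k v)))) ⊗ₜ (S c ⊗ₜ (1 : H)))) (by fun_prop)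
          (by fun_prop) (by fun_prop)]
        refine sw_congr _ fun u c => ?_
        simp only [biproductMul_incl hY, incl_apply, ← biproduct_conj hY, map_sw, tmul_sw, sw_tmul]

/-- Since a ⊗ h = (a ⊗ 1)(1 ⊗ h), the adjoint action by `H` and then by `R` suffices. -/
theorem adjoint_incl_mem (t : R ⊗[k] H) (r : R) :
    (biproduct Y S).adjoint (t ⊗ₜ incl k R H r) ∈ LinearMap.range (incl k R H) := by
  induction t using TensorProduct.induction_on with
  | zero => rw [zero_tmul, map_zero]; exact Submodule.zero_mem _
  | add x y hx hy => rw [add_tmul, map_add]; exact Submodule.add_mem _ hx hy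
  | tmul a h =>
    have e : a ⊗ₜ[k] h = (biproduct Y S).mul ((a ⊗ₜ 1) ⊗ₜ (1 ⊗ₜ h)) := by
      refine Eq.trans ?_ (biproductMul_right hY a 1 h).symm
      rw [one_mul]
    rw [e, (biproduct_isHopf hY).adjoint_mul, adjoint_one_tmul_incl hY, adjoint_tmul_one_incl hY]
    exact LinearMap.mem_range_self _ _

omit hY in
theorem contractPlus_incl_mem {B : Type*} [AddCommGroup B] [Module k B] (P : HopfOps k B)
    (φ : R ⊗[k] H →ₗ[k] B →ₗ[k] k) (b : B) (r : R) :
    contractPlus (biproduct Y S) P φ (b ⊗ₜ incl k R H r) ∈ LinearMap.range (incl k R H) := by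
  rw [contractPlus_eq_sw]
  change sw (biproductComul Y _) _ ∈ _
  rw [biproductComul_incl]
  simp (disch := fun_prop) only [sw_sw, sw_pure]
  exact sw_mem _ _ _ fun _ _ => sw_mem _ _ _ fun _ _ =>
    Submodule.smul_mem _ _ (LinearMap.mem_range_self _ _)

omit hY in
theorem contractMinus_incl_mem {B : Type*} [AddCommGroup B] [Module k B]
    (φ : B →ₗ[k] R ⊗[k] H →ₗ[k] k) (b : B) (r : R) :
    contractMinus (biproduct Y S) φ (b ⊗ₜ incl k R H r) ∈ LinearMap.range (incl k R H) := by
  rw [contractMinus_eq_sw]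
  change sw (biproductComul Y _) _ ∈ _
  rw [biproductComul_incl]
  simp (disch := fun_prop) only [sw_sw, sw_pure]
  exact sw_mem _ _ _ fun _ _ => sw_mem _ _ _ fun _ _ =>
    Submodule.smul_mem _ _ (LinearMap.mem_range_self _ _)

end Subalgebra

/-! ### The Schrödinger structures on R and R'. -/

section Schroedinger

open Coalgebra HopfAlgebra TensorProduct

variable {k : Type*} [Field k] {H : Type*} [Ring H] [HopfAlgebra k H]
  {R : Type*} [Ring R] [Algebra k R] [Coalgebra k R] {Y : YDOps k H R} {S : R →ₗ[k] R}
  {H' : Type*} [Ring H'] [HopfAlgebra k H']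
  {R' : Type*} [Ring R'] [Algebra k R'] [Coalgebra k R'] {Y' : YDOps k H' R'} {S' : R' →ₗ[k] R'}

variable (Y S Y' S') in
/-- The Schrödinger representation and coaction on the subalgebra `R` of its biproduct. -/
def restrictedPlus (φ : R ⊗[k] H →ₗ[k] R' ⊗[k] H' →ₗ[k] k) :
    YDOps k ((R ⊗[k] H) ⊗[k] (R' ⊗[k] H')) R where
  act := retract k R H ∘ₗ (schroedingerPlus (biproduct Y S) (biproduct Y' S') φ).act ∘ₗ
    (incl k R H).lTensor _
  coact := plusCoact R' H' Y

variable (Y S Y' S') in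
/-- The Schrödinger representation and coaction on the subalgebra `R'` of its biproduct. -/
def restrictedMinus (φ : R ⊗[k] H →ₗ[k] R' ⊗[k] H' →ₗ[k] k) :
    YDOps k ((R ⊗[k] H) ⊗[k] (R' ⊗[k] H')) R' where
  act := retract k R' H' ∘ₗ (schroedingerMinus (biproduct Y S) (biproduct Y' S') φ).act ∘ₗ
    (incl k R' H').lTensor _
  coact := (TensorProduct.mk k (R ⊗[k] H) (R' ⊗[k] H') (1 ⊗ₜ 1)).rTensor R' ∘ₗ
    (TensorProduct.assoc k R' H' R').symm.toLinearMap ∘ₗ Y'.coact.lTensor R' ∘ₗ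
    Coalgebra.comul (R := k) (A := R')

theorem lTensor_coact_comul (x : R) : (TensorProduct.assoc k R H R).symm
    (Y.coact.lTensor R (comul (R := k) x)) = sw (comul (R := k) x) fun x₁ x₂ =>
      sw (Y.coact x₂) fun u y => (x₁ ⊗ₜ[k] u) ⊗ₜ[k] y := by
  rw [map_eq_sw (LinearMap.lTensor R Y.coact), map_sw]
  refine sw_congr _ fun x₁ x₂ => ?_
  rw [LinearMap.lTensor_tmul]
  conv_lhs => rw [← sw_tmul_eq (Y.coact x₂)]
  simp only [tmul_sw, map_sw, TensorProduct.assoc_symm_tmul]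

/-- The action is defined with the retraction, which loses nothing: contraction and adjoint action
both keep the image of `R`. -/
theorem restrictedPlus_isRestriction (hY : IsBraidedHopf Y S)
    (φ : R ⊗[k] H →ₗ[k] R' ⊗[k] H' →ₗ[k] k) :
    IsRestriction (incl k R H) (restrictedPlus Y S Y' S' φ)
      (schroedingerPlus (biproduct Y S) (biproduct Y' S') φ) where
  act_eq d m := by
    refine incl_retract ?_
    rw [LinearMap.comp_apply, LinearMap.lTensor_tmul]
    induction d using TensorProduct.induction_on with
    | zero => rw [zero_tmul, map_zero]; exact Submodule.zero_mem _
    | add x y hx hy => rw [add_tmul, map_add]; exact Submodule.add_mem _ hx hy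
    | tmul a b =>
      obtain ⟨r, hr⟩ := contractPlus_incl_mem (Y := Y) (S := S) (biproduct Y' S') φ b m
      change (biproduct Y S).adjoint (a ⊗ₜ contractPlus _ _ φ (b ⊗ₜ incl k R H m)) ∈ _
      rw [← hr]
      exact adjoint_incl_mem hY a r
  coact_eq m := by
    change (incl k R H).lTensor _ (LinearMap.rTensor _ _ (_ : (R ⊗[k] H) ⊗[k] R)) =
      LinearMap.rTensor _ _ (biproductComul Y (incl k R H m))
    rw [biproductComul_incl]
    simp only [LinearMap.comp_apply, LinearEquiv.coe_coe, lTensor_coact_comul, map_sw,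
      LinearMap.rTensor_tmul, LinearMap.lTensor_tmul]
    rfl

theorem restrictedMinus_isRestriction (hY' : IsBraidedHopf Y' S')
    (φ : R ⊗[k] H →ₗ[k] R' ⊗[k] H' →ₗ[k] k) :
    IsRestriction (incl k R' H') (restrictedMinus Y S Y' S' φ)
      (schroedingerMinus (biproduct Y S) (biproduct Y' S') φ) where
  act_eq d m := by
    refine incl_retract ?_
    rw [LinearMap.comp_apply, LinearMap.lTensor_tmul]
    induction d using TensorProduct.induction_on with
    | zero => rw [zero_tmul, map_zero]; exact Submodule.zero_mem _
    | add x y hx hy => rw [add_tmul, map_add]; exact Submodule.add_mem _ hx hy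
    | tmul a b =>
      obtain ⟨r, hr⟩ := adjoint_incl_mem hY' b m
      change contractMinus _ φ (a ⊗ₜ (biproduct Y' S').adjoint (b ⊗ₜ incl k R' H' m)) ∈ _
      rw [← hr]
      exact contractMinus_incl_mem φ a r
  coact_eq m := by
    change (incl k R' H').lTensor _ (LinearMap.rTensor _ _ (_ : (R' ⊗[k] H') ⊗[k] R')) =
      LinearMap.rTensor _ _ (biproductComul Y' (incl k R' H' m))
    rw [biproductComul_incl]
    simp only [LinearMap.comp_apply, LinearEquiv.coe_coe, lTensor_coact_comul, map_sw,
      LinearMap.rTensor_tmul, LinearMap.lTensor_tmul]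
    rfl

/-- Provides the hypothesis `hcomul` of `braidedMul_isLeftModule` for x ↦ (x ⊗ 1) ⊗ 1. -/
theorem double_comul_incl (hB : (biproduct Y' S').IsHopf) (φ : R ⊗[k] H →ₗ[k] R' ⊗[k] H' →ₗ[k] k)
    (x : R) : (double (biproduct Y S) (biproduct Y' S') φ).comul (incl k R H x ⊗ₜ (1 ⊗ₜ 1)) =
      ((TensorProduct.mk k (R ⊗[k] H) (R' ⊗[k] H')).flip (1 ⊗ₜ 1) ∘ₗ incl k R H).lTensor _
        (plusCoact R' H' Y x) := by
  refine double_comul_tmul_one hB (incl k R H)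
    ((TensorProduct.assoc k R H R).symm (Y.coact.lTensor R (comul (R := k) x))) _ ?_
  refine (biproductComul_incl x).trans ?_
  rw [lTensor_coact_comul]
  simp only [map_sw, LinearMap.lTensor_tmul]

end Schroedinger

end NicholsDouble

end

theorem mainTheorem12
    {k : Type*} [Field k]
    -- `R` is the Nichols algebra `N⁺(V)` of the Yetter-Drinfeld module `V` over `H`
    {H : Type*} [Ring H] [HopfAlgebra k H]
    {V : Type*} [AddCommGroup V] [Module k V] (YV : NicholsDouble.YDOps k H V)
    (hV : NicholsDouble.IsYetterDrinfeld (NicholsDouble.HopfOps.of k H) YV)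
    {R : Type*} [Ring R] [Algebra k R] [Coalgebra k R]
    (Y : NicholsDouble.YDOps k H R) (S : R →ₗ[k] R) (gr : ℕ → Submodule k R) (j : V →ₗ[k] R)
    (hR : NicholsDouble.IsNicholsAlgebra YV Y S gr j)
    -- `R'` is the Nichols algebra `N⁻(V')` of the Yetter-Drinfeld module `V'` over `H'`
    {H' : Type*} [Ring H'] [HopfAlgebra k H']
    {V' : Type*} [AddCommGroup V'] [Module k V'] (YV' : NicholsDouble.YDOps k H' V')
    (hV' : NicholsDouble.IsYetterDrinfeld (NicholsDouble.HopfOps.of k H') YV')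
    {R' : Type*} [Ring R'] [Algebra k R'] [Coalgebra k R']
    (Y' : NicholsDouble.YDOps k H' R') (S' : R' →ₗ[k] R') (gr' : ℕ → Submodule k R')
    (j' : V' →ₗ[k] R')
    (hR' : NicholsDouble.IsNicholsAlgebra YV' Y' S' gr' j')
    -- a generalized Hopf pairing of the two biproducts
    (φ : R ⊗[k] H →ₗ[k] R' ⊗[k] H' →ₗ[k] k)
    (hφ : NicholsDouble.IsHopfPairing
      (NicholsDouble.biproduct Y S) (NicholsDouble.biproduct Y' S') φ) :
    (NicholsDouble.biproduct Y S).IsHopf ∧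
    (NicholsDouble.biproduct Y' S').IsHopf ∧
    (NicholsDouble.double
      (NicholsDouble.biproduct Y S) (NicholsDouble.biproduct Y' S') φ).IsHopf ∧
    ∃ (Zp : NicholsDouble.YDOps k ((R ⊗[k] H) ⊗[k] (R' ⊗[k] H')) R)
      (Zm : NicholsDouble.YDOps k ((R ⊗[k] H) ⊗[k] (R' ⊗[k] H')) R'),
      -- the structures on the Nichols algebras are restrictions of those on the two biproducts
      NicholsDouble.IsRestriction (NicholsDouble.incl k R H) Zp
        (NicholsDouble.schroedingerPlus
          (NicholsDouble.biproduct Y S) (NicholsDouble.biproduct Y' S') φ) ∧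
      NicholsDouble.IsRestriction (NicholsDouble.incl k R' H') Zm
        (NicholsDouble.schroedingerMinus
          (NicholsDouble.biproduct Y S) (NicholsDouble.biproduct Y' S') φ) ∧
      Zp.coact = NicholsDouble.plusCoact R' H' Y ∧
      -- both are Yetter-Drinfeld module algebras over the quantum double
      NicholsDouble.IsYDAlgebra
        (NicholsDouble.double
          (NicholsDouble.biproduct Y S) (NicholsDouble.biproduct Y' S') φ) Zp ∧
      NicholsDouble.IsYDAlgebra
        (NicholsDouble.double
          (NicholsDouble.biproduct Y S) (NicholsDouble.biproduct Y' S') φ) Zm ∧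
      -- the braided tensor product `R' ⊗ R` is an associative unital algebra
      NicholsDouble.IsUnitalAssoc (NicholsDouble.braidedMul Zm Zp) (1 ⊗ₜ 1) ∧
      -- it acts on `R'`: `R'` by multiplication and `R` by `x • z = ∑ φ(x, z₁) z₂`
      NicholsDouble.IsLeftModule (NicholsDouble.braidedMul Zm Zp) (1 ⊗ₜ 1)
        (NicholsDouble.differentialAct Zm) ∧
      (∀ y z : R', NicholsDouble.differentialAct Zm ((y ⊗ₜ (1 : R)) ⊗ₜ z) = y * z) ∧
      (∀ (x : R) (z : R'), NicholsDouble.incl k R' H'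
          (NicholsDouble.differentialAct Zm (((1 : R') ⊗ₜ x) ⊗ₜ z)) =
        NicholsDouble.contractMinus (NicholsDouble.biproduct Y' S') φ
          (NicholsDouble.incl k R H x ⊗ₜ NicholsDouble.incl k R' H' z)) := by
  have hY := hR.braidedHopf
  have hY' := hR'.braidedHopf
  have hA := NicholsDouble.biproduct_isHopf hY
  have hB := NicholsDouble.biproduct_isHopf hY'
  have hp := NicholsDouble.restrictedPlus_isRestriction (Y' := Y') (S' := S') hY φ
  have hm := NicholsDouble.restrictedMinus_isRestriction (Y := Y) (S := S) hY' φ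
  have hZp := hp.isYDAlgebra NicholsDouble.incl_injective
    (NicholsDouble.schroedingerPlus_isYDMonoid hA hB hφ)
    (NicholsDouble.biproductMul_incl hY) rfl
  have hZm := hm.isYDAlgebra NicholsDouble.incl_injective
    (NicholsDouble.schroedingerMinus_isYDMonoid hA hB hφ)
    (NicholsDouble.biproductMul_incl hY') rfl
  -- The witnesses are `restrictedPlus` and `restrictedMinus`, determined by `hp` and `hm`. The
  -- coaction of the first is `plusCoact` by definition.
  refine ⟨hA, hB, NicholsDouble.double_isHopf hA hB hφ, _, _, hp, hm, rfl, hZp, hZm,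
    NicholsDouble.braidedMul_isUnitalAssoc hZm hZp,
    NicholsDouble.braidedMul_isLeftModule hZm
      ((TensorProduct.mk k (R ⊗[k] H) (R' ⊗[k] H')).flip (1 ⊗ₜ 1) ∘ₗ NicholsDouble.incl k R H)
      rfl (fun x y => ?_) (NicholsDouble.double_comul_incl hB φ) _
      fun y x z => rfl, fun y z => ?_, fun x z => ?_⟩
  · refine Eq.trans ?_ (NicholsDouble.double_mul_tmul_one hA hB hφ _ _).symm
    exact congrArg (· ⊗ₜ[k] ((1 : R') ⊗ₜ[k] (1 : H'))) (NicholsDouble.biproductMul_incl hY x y)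
  · change y * (NicholsDouble.restrictedMinus Y S Y' S' φ).act (((1 ⊗ₜ 1) ⊗ₜ (1 ⊗ₜ 1)) ⊗ₜ z) = _
    exact congrArg (y * ·) (hZm.yd.module.one_act z)
  · change NicholsDouble.incl k R' H' (1 * (NicholsDouble.restrictedMinus Y S Y' S' φ).act
      ((NicholsDouble.incl k R H x ⊗ₜ (1 ⊗ₜ 1)) ⊗ₜ z)) = _
    -- The component of the acting element in the second biproduct is 1. Its adjoint action is
    -- trivial, and only the contraction is left.
    rw [one_mul, hm.act_eq]
    exact congrArg (fun t => NicholsDouble.contractMinus (NicholsDouble.biproduct Y' S') φ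
      (NicholsDouble.incl k R H x ⊗ₜ t)) (hB.adjoint_one _)
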